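/- Fix a sign $\sigma\in\{+1,-1\}$, a time $t_0>0$ and an integer $m\ge 1$. There exist constants $a_0>0$ and $\varepsilon>0$, depending only on $\sigma$, $t_0$ and $m$, such that the following holds for every real $a$ with $|a|<a_0$ and every $u_+\in\dot H^{-2}(\mathbb R)\cap H^m(\mathbb R)\cap W^{m,1}(\mathbb R)$ (complex-valued) with $$\|u_+\|_{\dot H^{-2}}+\|u_+\|_{H^m}+\|u_+\|_{W^{m,1}}<\varepsilon .$$ Set $$v_1(t)=a+e^{i\sigma a^2\log t}\,e^{it\partial_s^2}u_+ .$$ Then the equation $$i v_t+v_{ss}+\frac{\sigma}{t}\left(|v|^2-a^2\right)v=0\qquad (t\ge t_0,\ s\in\mathbb R),$$ understood in the sense of distributions in $s$ at each time, has a solution $v$ with $$v-v_1\in \mathcal C([t_0,\infty),H^m(\mathbb R))$$ and, as $t\to\infty$, $$\|(v-v_1)(t)\|_{L^2}=\mathcal O(t^{-1/2}),\qquad \|\partial_s^k(v-v_1)(t)\|_{L^2}=\mathcal O(t^{-1})\quad\text{for all integers } 0<k\le m,$$ and this solution is unique among all solutions with these properties. -/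

import Mathlib

open MeasureTheory Filter Topology Set
open scoped FourierTransform SchwartzMap ENNReal

noncomputable section

namespace GrossPitaevskii

/-- `g` is the `k`-th derivative, in the sense of (tempered) distributions, of `f`, both being
in `L^p(ℝ)`. All integrals converge by Hölder's inequality. -/
def IsWeakDeriv (p : ℝ≥0∞) (k : ℕ) (f g : ℝ → ℂ) : Prop :=
  MemLp f p volume ∧ MemLp g p volume ∧
    ∀ φ : 𝓢(ℝ, ℂ), ∫ s, f s * iteratedDeriv k φ s = (-1) ^ k * ∫ s, g s * φ s

/-- `‖∂_s^k f‖_{L^p}`, with value `∞` if `f` is not in `L^p` or has no `k`-th weak derivative in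
`L^p`. A weak derivative is unique up to null sets, so the infimum runs over a single value. -/
def derivENorm (p : ℝ≥0∞) (k : ℕ) (f : ℝ → ℂ) : ℝ≥0∞ :=
  ⨅ (g : ℝ → ℂ) (_ : IsWeakDeriv p k f g), eLpNorm g p volume

/-- The norm `∑_{k ≤ m} ‖∂_s^k f‖_{L^p}` of the Sobolev space `W^{m,p}(ℝ)`; it is finite exactly
for `f ∈ W^{m,p}(ℝ)`. For `p = 2` this is `H^m(ℝ)`. -/
def sobolevENorm (m : ℕ) (p : ℝ≥0∞) (f : ℝ → ℂ) : ℝ≥0∞ :=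
  ∑ k ∈ Finset.range (m + 1), derivENorm p k f

/-- The norm of the homogeneous Sobolev space `Ḣ^{-2}(ℝ)`, for integrable `f`, that is the
`L²` norm of `|η|^{-2} f̂(η)`, where `η = 2πξ` is the angular frequency. -/
def homNegTwoENorm (f : ℝ → ℂ) : ℝ≥0∞ :=
  eLpNorm (fun ξ : ℝ => (((2 * Real.pi * ξ) ^ 2)⁻¹ : ℂ) * 𝓕 f ξ) 2 volume

/-- The free Schrödinger evolution `e^{it∂_s²} f`, that is the Fourier multiplier with symbol
`e^{-itη²}`, `η = 2πξ`. It is meant for `f ∈ L¹(ℝ) ∩ H¹(ℝ)`: then `f̂` is a function in `L¹(ℝ)`, so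
both the Fourier integral and the inverse Fourier integral converge absolutely. -/
def freeSchrodinger (t : ℝ) (f : ℝ → ℂ) : ℝ → ℂ :=
  𝓕⁻ (fun ξ : ℝ => Complex.exp (-Complex.I * t * (2 * Real.pi * ξ) ^ 2) * 𝓕 f ξ)

/-- The long range profile `v₁(t) = a + e^{iσa² log t} e^{it∂_s²} u₊`. -/
def profile (σ a : ℝ) (u : ℝ → ℂ) (t : ℝ) : ℝ → ℂ :=
  fun s => a + Complex.exp (Complex.I * (σ * a ^ 2 * Real.log t : ℝ)) * freeSchrodinger t u s

/-- `v(t, s)` solves `i v_t + v_ss + (σ / t) (|v|² - a²) v = 0` on `[t₀, ∞) × ℝ`: each `v(t)` is a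
bounded function, and `v_t = i (v_ss + (σ / t) (|v|² - a²) v)` holds in the sense of distributions
in `s` at each time `t ≥ t₀` (with the one-sided time derivative at `t₀`). -/
def IsSolution (σ a t₀ : ℝ) (v : ℝ → ℝ → ℂ) : Prop :=
  (∀ t, t₀ ≤ t → MemLp (v t) ∞ volume) ∧
  ∀ φ : 𝓢(ℝ, ℂ), ∀ t, t₀ ≤ t →
    HasDerivWithinAt (fun τ => ∫ s, v τ s * φ s)
      (Complex.I * ((∫ s, v t s * iteratedDeriv 2 φ s) +
        ((σ / t : ℝ) : ℂ) * ∫ s, ((‖v t s‖ ^ 2 - a ^ 2 : ℝ) : ℂ) * v t s * φ s))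
      (Ici t₀) t

/-- `r ∈ C([t₀, ∞), H^m(ℝ))`. -/
def ContinuousInH (m : ℕ) (t₀ : ℝ) (r : ℝ → ℝ → ℂ) : Prop :=
  (∀ t, t₀ ≤ t → sobolevENorm m 2 (r t) < ∞) ∧
  ∀ t, t₀ ≤ t → Tendsto (fun τ => sobolevENorm m 2 (r τ - r t)) (𝓝[Ici t₀] t) (𝓝 0)

/-- `v` is a solution with `v - v₁ ∈ C([t₀, ∞), H^m)` and, as `t → ∞`,
`‖(v - v₁)(t)‖_{L²} = O(t^{-1/2})` and `‖∂_s^k (v - v₁)(t)‖_{L²} = O(t^{-1})` for `0 < k ≤ m`. -/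
structure IsAsymptoticSolution (σ a t₀ : ℝ) (m : ℕ) (u : ℝ → ℂ) (v : ℝ → ℝ → ℂ) : Prop where
  solution : IsSolution σ a t₀ v
  continuous : ContinuousInH m t₀ (fun t => v t - profile σ a u t)
  rate_zero : ∃ C : ℝ, ∀ᶠ t : ℝ in atTop,
    derivENorm 2 0 (v t - profile σ a u t) ≤ ENNReal.ofReal (C * t ^ (-(1 / 2) : ℝ))
  rate_deriv : ∀ k : ℕ, 0 < k → k ≤ m → ∃ C : ℝ, ∀ᶠ t : ℝ in atTop,
    derivENorm 2 k (v t - profile σ a u t) ≤ ENNReal.ofReal (C * t ^ (-1 : ℝ))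

end GrossPitaevskii

end

noncomputable section

namespace GrossPitaevskii

/-! Write `v = a + w`. Then `(|v|² - a²)v = a²(w + w̄) + 2a|w|² + aw² + |w|²w`, and the equation
says that `e^{-it∂²}w` has time derivative `(iσ/t) e^{-it∂²}` of this expression. The solution is
built backwards from `t = ∞` as profile plus remainder. Since `1/t` is not integrable, each term of
the profile `f = e^{it∂²}u₊`, up to its phase, needs its own reason for its integral over `[t, ∞)`
to converge.

The term `a²w` is absorbed exactly by the phase `e^{iσa² log t}` (`hasDerivAt_UH_neg_prof`). The
term `a²w̄` does not decay, but it oscillates against the group. Since `u₊ = A''` with `A ∈ H^{m+2}`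
(this is what `Ḣ^{-2}` provides, see `exists_second_antiderivative`), its transport is, apart from
the factor `t^{-1}` and the phase, the exact time derivative of a bounded curve (`hasDerivAt_dbl`),
and integration by parts in time yields `O(1/t)`. The cubic term is `O(t^{-1})` in `H^m` by two uses
of the dispersive estimate, so its integral against `dt/t` is `O(1/t)`.

The quadratic terms decay only like `t^{-1/2}` in `H^m`, which gives the `L²` rate `t^{-1/2}`. Their
derivatives do better: with `g = e^{it∂²}A'` one has `g_s = f`, hence `(i∂_t + ∂_s²)(fg) = ∂_s(f²)`
and `(i∂_t + ∂_s²)(fḡ) = 2∂_s|f|²` (`quad_schwartz`, `quad_conj_schwartz`). One space derivative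
thus turns the integrand into an exact time derivative, up to the phase and the factor `t^{-1}`, and
a second integration by parts gives `O(1/t)` for every derivative of positive order
(`norm_cp_succ_tail_le`).

The remainder solves a fixed point equation in the class of curves with these two rates
(`exists_decaying_solution`). Dispersive decay is used through the operator norm of multiplication
by `f` on `H^m`, which is `O(t^{-1/2})` by `norm_mulH_fr_le` although `f` does not decay in `H^m`.
The linear part `a²(y + ȳ)` of the remainder equation keeps each derivative at its own rate and has
a small constant because `a` is small.

For uniqueness, the difference of two solutions satisfies `‖D'‖ ≤ ‖D‖/(4t)` and `‖D‖ ≤ Mt^{-1/2}`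
for large times. Integrating from infinity halves `M`, repeatedly, so `D = 0` there, and Grönwall's
inequality carries this back to `t₀` (`mild_solution_unique`). -/

/-! ### Schwartz functions in `L²` and the bilinear pairing -/

/-- The Hilbert space `L²(ℝ)`. -/
abbrev L2 : Type := Lp ℂ 2 (volume : Measure ℝ)

/-- The class in `L²(ℝ)` of a Schwartz function. -/
def sL (φ : 𝓢(ℝ, ℂ)) : L2 := φ.toLp 2

lemma sL_ae (φ : 𝓢(ℝ, ℂ)) : (sL φ : ℝ → ℂ) =ᵐ[volume] φ := φ.coeFn_toLp 2

/-- The `k`-th derivative of a Schwartz function. -/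
def dS (k : ℕ) (φ : 𝓢(ℝ, ℂ)) : 𝓢(ℝ, ℂ) := (SchwartzMap.derivCLM ℂ ℂ)^[k] φ

lemma dS_coe (k : ℕ) (φ : 𝓢(ℝ, ℂ)) : (dS k φ : ℝ → ℂ) = iteratedDeriv k φ := by
  induction k with
  | zero => simp [dS]
  | succ k ih =>
    rw [iteratedDeriv_succ, ← ih, dS, Function.iterate_succ_apply']
    rfl

lemma dS_zero (φ : 𝓢(ℝ, ℂ)) : dS 0 φ = φ := rfl

lemma dS_dS (j k : ℕ) (φ : 𝓢(ℝ, ℂ)) : dS j (dS k φ) = dS (j + k) φ := by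
  simp [dS, Function.iterate_add_apply]

lemma dS_one_coe (φ : 𝓢(ℝ, ℂ)) : (dS 1 φ : ℝ → ℂ) = deriv φ := by
  rw [dS_coe, iteratedDeriv_one]

/-- The bilinear pairing `∫ f g` on `L²`. -/
def pair : L2 →L[ℂ] L2 →L[ℂ] ℂ := (ContinuousLinearMap.mul ℂ ℂ).lpPairing volume 2 2

lemma pair_eq (f g : L2) : pair f g = ∫ x, f x * g x :=
  (ContinuousLinearMap.mul ℂ ℂ).lpPairing_eq_integral f g

lemma pair_sL (f : L2) (φ : 𝓢(ℝ, ℂ)) : pair f (sL φ) = ∫ x, f x * φ x := by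
  rw [pair_eq]
  refine integral_congr_ae ?_
  filter_upwards [sL_ae φ] with x hx
  rw [hx]

lemma pair_sL_sL (f φ : 𝓢(ℝ, ℂ)) : pair (sL f) (sL φ) = ∫ x, f x * φ x := by
  rw [pair_sL]
  refine integral_congr_ae ?_
  filter_upwards [sL_ae f] with x hx
  rw [hx]

lemma pair_comm (f g : L2) : pair f g = pair g f := by
  simp only [pair_eq, mul_comm]

lemma sL_dense : DenseRange sL :=
  SchwartzMap.denseRange_toLpCLM (F := ℂ) (E := ℝ) (p := 2) (μ := volume) ENNReal.ofNat_ne_top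

/-- Two locally integrable functions with the same integral against Schwartz functions agree. -/
lemma ae_eq_of_integral_schwartz {f g : ℝ → ℂ} (hf : LocallyIntegrable f)
    (hg : LocallyIntegrable g)
    (h : ∀ φ : 𝓢(ℝ, ℂ), ∫ x, f x * φ x = ∫ x, g x * φ x) : f =ᵐ[volume] g := by
  refine ae_eq_of_integral_contDiff_smul_eq hf hg fun φ hφ hc => ?_
  have hs : HasCompactSupport (fun x => (φ x : ℂ)) := hc.comp_left (g := fun y : ℝ => (y : ℂ)) rfl
  have hd : ContDiff ℝ (⊤ : ℕ∞) (fun x => (φ x : ℂ)) := Complex.ofRealCLM.contDiff.comp hφ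
  have := h (hs.toSchwartzMap hd)
  have e : ∀ x, (hs.toSchwartzMap hd) x = (φ x : ℂ) := fun _ => rfl
  simp only [e] at this
  simpa [mul_comm] using this

lemma L2.locallyIntegrable (f : L2) : LocallyIntegrable (f : ℝ → ℂ) :=
  (Lp.memLp f).locallyIntegrable (by norm_num)

lemma eq_of_pair_sL {f g : L2} (h : ∀ φ, pair f (sL φ) = pair g (sL φ)) : f = g := by
  refine Lp.ext (ae_eq_of_integral_schwartz f.locallyIntegrable g.locallyIntegrable fun φ => ?_)
  simpa only [pair_sL] using h φ

/-! ### The free Schrödinger group on Schwartz functions and on `L²` -/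

lemma hasTemperateGrowth_cexp (c : ℂ) (hc : c.re = 0) :
    Function.HasTemperateGrowth (fun y : ℝ => Complex.exp (c * y)) := by
  have hd : ∀ n : ℕ, iteratedDeriv n (fun y : ℝ => Complex.exp (c * y)) =
      fun y : ℝ => c ^ n * Complex.exp (c * y) := by
    intro n
    induction n with
    | zero => simp
    | succ n ih =>
      rw [iteratedDeriv_succ, ih]
      funext y
      have h1 : HasDerivAt (fun y : ℝ => c * (y : ℂ)) c y := by
        simpa using (Complex.ofRealCLM.hasDerivAt (x := y)).const_mul c
      have := (h1.cexp.const_mul (c ^ n)).deriv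
      rw [this]; ring
  refine ⟨?_, fun n => ⟨0, ‖c‖ ^ n, fun x => ?_⟩⟩
  · have : ContDiff ℝ (⊤ : ℕ∞) (fun y : ℝ => c * (y : ℂ)) :=
      contDiff_const.mul Complex.ofRealCLM.contDiff
    exact this.cexp
  · rw [norm_iteratedFDeriv_eq_norm_iteratedDeriv, hd]
    simp [Complex.norm_exp, hc]

/-- The symbol `e^{-itη²}`, `η = 2πξ`, of the free Schrödinger group. -/
def sym (t : ℝ) (ξ : ℝ) : ℂ := Complex.exp (-Complex.I * t * (2 * Real.pi * ξ) ^ 2)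

lemma sym_eq (t ξ : ℝ) : sym t ξ = Complex.exp (((-(t * (2 * Real.pi * ξ) ^ 2) : ℝ) : ℂ) * Complex.I) := by
  rw [sym]; push_cast; ring_nf

lemma norm_sym (t ξ : ℝ) : ‖sym t ξ‖ = 1 := by
  rw [sym_eq, Complex.norm_exp_ofReal_mul_I]

lemma sym_add (s t ξ : ℝ) : sym (s + t) ξ = sym s ξ * sym t ξ := by
  rw [sym, sym, sym, ← Complex.exp_add]; push_cast; ring_nf

lemma sym_zero (ξ : ℝ) : sym 0 ξ = 1 := by simp [sym]

lemma sym_temperate (t : ℝ) : Function.HasTemperateGrowth (sym t) := by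
  have h1 : Function.HasTemperateGrowth (fun ξ : ℝ => t * (2 * Real.pi * ξ) ^ 2) := by fun_prop
  have := (hasTemperateGrowth_cexp (-Complex.I) (by simp)).comp h1
  convert this using 1
  funext ξ
  simp only [sym, Function.comp]
  push_cast; ring_nf

lemma sym_continuous (t : ℝ) : Continuous (sym t) := by
  unfold sym; fun_prop

/-- The free Schrödinger group on Schwartz functions. -/
def US (t : ℝ) : 𝓢(ℝ, ℂ) →L[ℂ] 𝓢(ℝ, ℂ) := SchwartzMap.fourierMultiplierCLM ℂ (sym t)

lemma US_add (s t : ℝ) (φ : 𝓢(ℝ, ℂ)) : US (s + t) φ = US s (US t φ) := by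
  rw [US, US, US, SchwartzMap.fourierMultiplierCLM_fourierMultiplierCLM_apply (sym_temperate s)
    (sym_temperate t)]
  congr 2
  funext ξ
  exact sym_add s t ξ

lemma US_zero (φ : 𝓢(ℝ, ℂ)) : US 0 φ = φ := by
  have : sym 0 = fun _ => (1 : ℂ) := funext sym_zero
  rw [US, this, SchwartzMap.fourierMultiplierCLM_const]
  simp

lemma fourier_US (t : ℝ) (φ : 𝓢(ℝ, ℂ)) (ξ : ℝ) : 𝓕 (US t φ) ξ = sym t ξ * 𝓕 φ ξ := by
  rw [US, SchwartzMap.fourierMultiplierCLM_apply, FourierTransform.fourier_fourierInv_eq,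
    SchwartzMap.smulLeftCLM_apply_apply (sym_temperate t), smul_eq_mul]

lemma schwartz_fourier_injective {f g : 𝓢(ℝ, ℂ)} (h : ∀ ξ, 𝓕 f ξ = 𝓕 g ξ) : f = g := by
  have : 𝓕 f = 𝓕 g := by ext ξ; exact h ξ
  exact (FourierTransform.fourierEquiv ℂ 𝓢(ℝ, ℂ)).injective this

lemma fourier_dS (k : ℕ) (φ : 𝓢(ℝ, ℂ)) (ξ : ℝ) :
    𝓕 (dS k φ) ξ = (2 * Real.pi * Complex.I * ξ) ^ k * 𝓕 φ ξ := by
  rw [SchwartzMap.fourier_coe, SchwartzMap.fourier_coe, dS_coe]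
  have := Real.fourier_iteratedDeriv (f := (φ : ℝ → ℂ)) (N := ⊤) (n := k) (by exact φ.smooth ⊤)
    (fun n _ => by rw [← dS_coe]; exact (dS n φ).integrable) le_top
  rw [this]; simp

lemma US_dS (t : ℝ) (k : ℕ) (φ : 𝓢(ℝ, ℂ)) : US t (dS k φ) = dS k (US t φ) := by
  refine schwartz_fourier_injective fun ξ => ?_
  rw [fourier_US, fourier_dS, fourier_dS, fourier_US]; ring

lemma norm_sL_eq_fourier (φ : 𝓢(ℝ, ℂ)) : ‖sL φ‖ = ‖sL (𝓕 φ)‖ :=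
  (SchwartzMap.norm_fourier_toL2_eq φ).symm

lemma norm_sL_le_of_fourier {φ ψ : 𝓢(ℝ, ℂ)} {C : ℝ} 
    (h : ∀ ξ, ‖𝓕 φ ξ‖ ≤ C * ‖𝓕 ψ ξ‖) : ‖sL φ‖ ≤ C * ‖sL ψ‖ := by
  rw [norm_sL_eq_fourier φ, norm_sL_eq_fourier ψ]
  refine Lp.norm_le_mul_norm_of_ae_le_mul ?_
  filter_upwards [sL_ae (𝓕 φ), sL_ae (𝓕 ψ)] with ξ h1 h2
  rw [h1, h2]; exact h ξ

lemma norm_sL_US (t : ℝ) (φ : 𝓢(ℝ, ℂ)) : ‖sL (US t φ)‖ = ‖sL φ‖ := by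
  refine le_antisymm ?_ ?_
  · simpa using norm_sL_le_of_fourier (φ := US t φ) (ψ := φ) (C := 1) fun ξ => by
      rw [fourier_US, norm_mul, norm_sym]
  · simpa using norm_sL_le_of_fourier (φ := φ) (ψ := US t φ) (C := 1) fun ξ => by
      rw [fourier_US, norm_mul, norm_sym]; simp

/-- The free Schrödinger group on Schwartz functions as a linear equivalence. -/
def USₑ (t : ℝ) : 𝓢(ℝ, ℂ) ≃ₗ[ℂ] 𝓢(ℝ, ℂ) where
  toLinearMap := (US t).toLinearMap
  invFun := US (-t)
  left_inv φ := by
    change US (-t) (US t φ) = φ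
    rw [← US_add]; simp [US_zero]
  right_inv φ := by
    change US t (US (-t) φ) = φ
    rw [← US_add]; simp [US_zero]

/-- The free Schrödinger group `e^{it∂²}` on `L²`. -/
def U (t : ℝ) : L2 ≃ₗᵢ[ℂ] L2 :=
  (USₑ t).extendOfIsometry (SchwartzMap.toLpCLM ℂ (E := ℝ) ℂ 2 volume)
    (SchwartzMap.toLpCLM ℂ (E := ℝ) ℂ 2 volume) sL_dense sL_dense (norm_sL_US t)

lemma U_sL (t : ℝ) (φ : 𝓢(ℝ, ℂ)) : U t (sL φ) = sL (US t φ) :=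
  (USₑ t).extendOfIsometry_eq (e₁ := (SchwartzMap.toLpCLM ℂ (E := ℝ) ℂ 2 volume).toLinearMap)
    (e₂ := (SchwartzMap.toLpCLM ℂ (E := ℝ) ℂ 2 volume).toLinearMap)
    sL_dense sL_dense (norm_sL_US t) φ

lemma U_add (s t : ℝ) (f : L2) : U (s + t) f = U s (U t f) := by
  refine sL_dense.induction_on (p := fun f => U (s + t) f = U s (U t f)) f
    (isClosed_eq (U _).continuous ((U s).continuous.comp (U t).continuous)) fun φ => ?_
  rw [U_sL, U_sL, U_sL, US_add]

lemma U_zero (f : L2) : U 0 f = f := by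
  refine sL_dense.induction_on (p := fun f => U 0 f = f) f
    (isClosed_eq (U _).continuous continuous_id) fun φ => ?_
  rw [U_sL, US_zero]

/-- The pairing has no conjugation, so the transpose of the group is the group itself and not its
inverse. The reason is that the symbol is even in `ξ`. -/
lemma pair_US (t : ℝ) (φ ψ : 𝓢(ℝ, ℂ)) : pair (sL (US t φ)) (sL ψ) = pair (sL φ) (sL (US t ψ)) := by
  have h : ∀ φ ψ : 𝓢(ℝ, ℂ), ∫ x, US t φ x * ψ x = ∫ ξ, sym t ξ * 𝓕 φ ξ * 𝓕⁻ ψ ξ := by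
    intro φ ψ
    have := SchwartzMap.integral_fourier_mul_eq (US t φ) (𝓕⁻ ψ)
    rw [FourierTransform.fourier_fourierInv_eq] at this
    rw [← this]
    simp only [fourier_US]
  rw [pair_sL_sL, pair_comm, pair_sL_sL, h, h]
  have e : ∀ φ : 𝓢(ℝ, ℂ), ∀ ξ, 𝓕⁻ φ ξ = 𝓕 φ (-ξ) := by
    intro φ ξ
    rw [SchwartzMap.fourierInv_coe, SchwartzMap.fourier_coe, Real.fourierInv_eq_fourier_neg]
  rw [← integral_neg_eq_self]
  refine integral_congr_ae (Eventually.of_forall fun ξ => ?_)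
  simp only [e, neg_neg, sym]
  push_cast; ring_nf

lemma pair_U (t : ℝ) (f : L2) (φ : 𝓢(ℝ, ℂ)) : pair (U t f) (sL φ) = pair f (sL (US t φ)) := by
  refine sL_dense.induction_on (p := fun f => pair (U t f) (sL φ) = pair f (sL (US t φ))) f
    (isClosed_eq ?_ ?_) fun ψ => ?_
  · exact (pair.flip (sL φ)).continuous.comp (U t).continuous
  · exact (pair.flip _).continuous
  · rw [U_sL, pair_US]

lemma pair_dS (f φ : 𝓢(ℝ, ℂ)) (k : ℕ) :
    pair (sL (dS k f)) (sL φ) = (-1) ^ k * pair (sL f) (sL (dS k φ)) := by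
  induction k generalizing φ with
  | zero => simp [dS_zero]
  | succ k ih =>
    have h : ∀ f g : 𝓢(ℝ, ℂ), pair (sL (dS 1 f)) (sL g) = - pair (sL f) (sL (dS 1 g)) := by
      intro f g
      rw [pair_sL_sL, pair_sL_sL, dS_one_coe, dS_one_coe,
        SchwartzMap.integral_mul_deriv_eq_neg_deriv_mul, neg_neg]
    rw [add_comm, ← dS_dS, h, ih, dS_dS, pow_add, pow_one, Nat.add_comm 1 k]; ring

lemma sL_add (φ ψ : 𝓢(ℝ, ℂ)) : sL (φ + ψ) = sL φ + sL ψ := rfl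
lemma sL_smul (c : ℂ) (φ : 𝓢(ℝ, ℂ)) : sL (c • φ) = c • sL φ := rfl
lemma sL_sub (φ ψ : 𝓢(ℝ, ℂ)) : sL (φ - ψ) = sL φ - sL ψ := rfl
lemma dS_add (k : ℕ) (φ ψ : 𝓢(ℝ, ℂ)) : dS k (φ + ψ) = dS k φ + dS k ψ :=
  iterate_map_add (SchwartzMap.derivCLM ℂ ℂ) k φ ψ
lemma dS_smul (k : ℕ) (c : ℂ) (φ : 𝓢(ℝ, ℂ)) : dS k (c • φ) = c • dS k φ := by
  induction k with
  | zero => rfl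
  | succ k ih => rw [add_comm, ← dS_dS, ih, ← dS_dS]; exact map_smul (SchwartzMap.derivCLM ℂ ℂ) c _

/-- Taylor's bound covers `|x| ≤ 1`; for larger `|x|` the trivial bound `2 + |x|` suffices. A bound
valid for all `x` is needed because `x` will be `-hη²` with `η` unbounded. -/
lemma norm_exp_sub_one_sub_le (x : ℝ) :
    ‖Complex.exp (x * Complex.I) - 1 - x * Complex.I‖ ≤ 3 * x ^ 2 := by
  by_cases h : |x| ≤ 1
  · refine (Complex.norm_exp_sub_one_sub_id_le (by simpa using h)).trans ?_
    simp; nlinarith [sq_nonneg x]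
  · push Not at h
    calc _ ≤ ‖Complex.exp (x * Complex.I)‖ + ‖(1 : ℂ)‖ + ‖(x : ℂ) * Complex.I‖ :=
          (norm_sub_le _ _).trans (by gcongr; exact norm_sub_le _ _)
      _ = 2 + |x| := by rw [Complex.norm_exp_ofReal_mul_I]; simp; ring
      _ ≤ 3 * |x| ^ 2 := by nlinarith
      _ = _ := by rw [sq_abs]

/-- `t ↦ e^{it∂²} φ` is differentiable in `L²` with derivative `i e^{it∂²} φ''`. -/
lemma hasDerivAt_sL_US (φ : 𝓢(ℝ, ℂ)) (t : ℝ) :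
    HasDerivAt (fun t => sL (US t φ)) (Complex.I • sL (US t (dS 2 φ))) t := by
  rw [hasDerivAt_iff_isLittleO_nhds_zero]
  -- On the Fourier side the error is the Taylor remainder of `e^{iy}` at `y = -hη²`, of size
  -- `h²η⁴`. This costs four derivatives of `φ`.
  have key : ∀ h : ℝ, ‖sL (US (t + h) φ) - sL (US t φ) - h • Complex.I • sL (US t (dS 2 φ))‖ ≤
      (3 * h ^ 2) * ‖sL (dS 4 φ)‖ := by
    intro h
    have e : sL (US (t + h) φ) - sL (US t φ) - h • Complex.I • sL (US t (dS 2 φ)) =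
        sL (US (t + h) φ - US t φ - ((h : ℂ) * Complex.I) • US t (dS 2 φ)) := by
      rw [sL_sub, sL_sub, sL_smul, mul_smul]; rfl
    rw [e]
    refine norm_sL_le_of_fourier fun ξ => ?_
    have e2 : 𝓕 (US (t + h) φ - US t φ - ((h : ℂ) * Complex.I) • US t (dS 2 φ)) ξ =
        𝓕 (US (t + h) φ) ξ - 𝓕 (US t φ) ξ - ((h : ℂ) * Complex.I) * 𝓕 (US t (dS 2 φ)) ξ := by
      simp only [← FourierTransform.fourierCLM_apply (R := ℂ), map_sub, map_smul]
      rfl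
    rw [e2, fourier_US, fourier_US, fourier_US, fourier_dS, fourier_dS, add_comm t h, sym_add]
    set y : ℝ := -(h * (2 * Real.pi * ξ) ^ 2) with hy
    have e3 : sym h ξ * sym t ξ * 𝓕 φ ξ - sym t ξ * 𝓕 φ ξ - (h : ℂ) * Complex.I *
        (sym t ξ * ((2 * Real.pi * Complex.I * ξ) ^ 2 * 𝓕 φ ξ)) =
        sym t ξ * (Complex.exp (y * Complex.I) - 1 - y * Complex.I) * 𝓕 φ ξ := by
      rw [sym_eq h ξ, ← hy]
      have : (h : ℂ) * (2 * Real.pi * Complex.I * ξ) ^ 2 = y := by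
        rw [hy]; push_cast; linear_combination (h : ℂ) * (2 * Real.pi * ξ) ^ 2 * Complex.I_sq
      linear_combination (-Complex.I * sym t ξ * 𝓕 φ ξ) * this
    rw [e3, norm_mul, norm_mul, norm_sym, one_mul, norm_mul, ← mul_assoc]
    gcongr
    refine (norm_exp_sub_one_sub_le y).trans (le_of_eq ?_)
    rw [norm_pow, hy]
    simp
    rw [abs_of_pos Real.pi_pos]
    have : |ξ| ^ 4 = ξ ^ 4 := by rw [← abs_pow, abs_of_nonneg (by positivity)]
    rw [mul_pow _ (|ξ|), this]; ring
  rw [Asymptotics.isLittleO_iff]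
  intro c hc
  have hb : Tendsto (fun h : ℝ => 3 * |h| * ‖sL (dS 4 φ)‖) (𝓝 0) (𝓝 0) := by
    have : Continuous (fun h : ℝ => 3 * |h| * ‖sL (dS 4 φ)‖) := by fun_prop
    simpa using this.tendsto 0
  filter_upwards [hb.eventually_lt_const hc] with h hh
  refine (key h).trans ?_
  calc 3 * h ^ 2 * ‖sL (dS 4 φ)‖ = (3 * |h| * ‖sL (dS 4 φ)‖) * |h| := by
        rw [← sq_abs]; ring
    _ ≤ c * ‖h‖ := by rw [Real.norm_eq_abs]; gcongr

/-- The set of `f` with a continuous orbit is closed, since the maps `U t` are isometries and orbits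
of nearby points are uniformly close in `t`. It contains the Schwartz functions, whose orbits are
differentiable. -/
lemma continuous_U_apply (f : L2) : Continuous (fun t => U t f) := by
  refine sL_dense.induction_on (p := fun f => Continuous (fun t => U t f)) f ?_ fun φ => ?_
  · have : {f : L2 | Continuous (fun t => U t f)} =
        (fun f => (fun t => U t f : ℝ → L2)) ⁻¹' {g | Continuous g} := rfl
    refine isClosed_of_closure_subset fun f hf => ?_
    rw [Metric.mem_closure_iff] at hf
    refine continuous_of_uniform_approx_of_continuous (f := fun t => U t f) ?_
    intro u hu
    obtain ⟨ε, hε, hεu⟩ := Metric.mem_uniformity_dist.1 hu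
    obtain ⟨g, hg, hfg⟩ := hf ε hε
    refine ⟨fun t => U t g, hg, fun t => hεu ?_⟩
    rw [(U t).dist_map]; exact hfg
  · simp only [U_sL]
    exact continuous_iff_continuousAt.2 fun t => (hasDerivAt_sL_US φ t).continuousAt

lemma continuous_U : Continuous (fun p : ℝ × L2 => U p.1 p.2) := by
  refine continuous_iff_continuousAt.2 fun ⟨t, f⟩ => ?_
  rw [ContinuousAt, tendsto_iff_dist_tendsto_zero]
  have hb : Tendsto (fun p : ℝ × L2 => dist p.2 f + dist (U p.1 f) (U t f)) (𝓝 (t, f)) (𝓝 0) := by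
    have : Continuous (fun p : ℝ × L2 => dist p.2 f + dist (U p.1 f) (U t f)) := by
      have := (continuous_U_apply f).comp (continuous_fst (X := ℝ) (Y := L2))
      exact (continuous_snd.dist continuous_const).add (this.dist continuous_const)
    simpa using this.tendsto (t, f)
  refine squeeze_zero (fun _ => dist_nonneg) (fun p => ?_) hb
  refine (dist_triangle _ (U p.1 f) _).trans ?_
  rw [(U p.1).dist_map]

attribute [irreducible] pair US U dS

/-! ### The space `H^m` as compatible tuples in `L²` -/

variable {m n : ℕ}

/-- The tuples `(f, f', …, f^{(m)})` in `L²`, as a subspace. -/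
def Hsub (m : ℕ) : Submodule ℂ (Fin (m + 1) → L2) where
  carrier := {F | ∀ (k : Fin (m + 1)) (φ : 𝓢(ℝ, ℂ)),
    pair (F k) (sL φ) = (-1) ^ (k : ℕ) * pair (F 0) (sL (dS k φ))}
  add_mem' {F G} hF hG k φ := by
    simp only [Pi.add_apply, map_add, add_apply, hF k φ, hG k φ]; ring
  zero_mem' k φ := by simp
  smul_mem' c F hF k φ := by
    simp only [Pi.smul_apply, map_smul, smul_apply, hF k φ, smul_eq_mul]; ring

/-- The compatibility conditions are tested weakly and hence are closed. This makes `H m` complete,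
as the fixed point argument and the Bochner integrals in `H m` require. -/
lemma Hsub_isClosed (m : ℕ) : IsClosed (Hsub m : Set (Fin (m + 1) → L2)) := by
  have : (Hsub m : Set (Fin (m + 1) → L2)) = ⋂ (k : Fin (m + 1)) (φ : 𝓢(ℝ, ℂ)),
      {F | pair (F k) (sL φ) = (-1) ^ (k : ℕ) * pair (F 0) (sL (dS k φ))} := by
    ext F; simp [Hsub]
  rw [this]
  refine isClosed_iInter fun k => isClosed_iInter fun φ => isClosed_eq ?_ ?_
  · exact (pair.flip (sL φ)).continuous.comp (continuous_apply k)
  · exact continuous_const.mul ((pair.flip (sL (dS k φ))).continuous.comp (continuous_apply 0))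

/-- The Sobolev space `H^m(ℝ)`, as the space of tuples `(f, f', …, f^{(m)})` in `L²`. -/
def H (m : ℕ) : Type := Hsub m

instance (m : ℕ) : NormedAddCommGroup (H m) := inferInstanceAs (NormedAddCommGroup (Hsub m))
instance (m : ℕ) : NormedSpace ℂ (H m) := inferInstanceAs (NormedSpace ℂ (Hsub m))
instance (m : ℕ) : CompleteSpace (H m) := (Hsub_isClosed m).completeSpace_coe


/-- The underlying tuple. -/
def tup (m : ℕ) : H m →L[ℂ] Fin (m + 1) → L2 := (Hsub m).subtypeL

lemma norm_tup (F : H m) : ‖tup m F‖ = ‖F‖ := rfl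

/-- The `k`-th derivative `H^m → L²`, with the value `0` for `k > m`. -/
def cp (k : ℕ) : H m →L[ℂ] L2 :=
  if h : k < m + 1 then (ContinuousLinearMap.proj ⟨k, h⟩).comp (tup m) else 0

lemma cp_eq {k : ℕ} (h : k < m + 1) (F : H m) : cp k F = tup m F ⟨k, h⟩ := by
  simp [cp, h]

lemma norm_cp_le (k : ℕ) (F : H m) : ‖cp k F‖ ≤ ‖F‖ := by
  by_cases h : k < m + 1
  · rw [cp_eq h, ← norm_tup]; exact norm_le_pi_norm (tup m F) _
  · simp [cp, h]

lemma norm_H_le {F : H m} {C : ℝ} (hC : 0 ≤ C) (h : ∀ k ≤ m, ‖cp k F‖ ≤ C) : ‖F‖ ≤ C := by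
  rw [← norm_tup]
  refine (pi_norm_le_iff_of_nonneg hC).2 fun k => ?_
  have := h k (Nat.lt_succ_iff.1 k.2)
  rwa [cp_eq k.2] at this

lemma pair_cp {k : ℕ} (hk : k ≤ m) (F : H m) (φ : 𝓢(ℝ, ℂ)) :
    pair (cp k F) (sL φ) = (-1) ^ k * pair (cp 0 F) (sL (dS k φ)) := by
  rw [cp_eq (Nat.lt_succ_of_le hk), cp_eq (Nat.succ_pos m)]
  exact Subtype.property (p := (· ∈ Hsub m)) F ⟨k, Nat.lt_succ_of_le hk⟩ φ

/-- An element of `H^m` from its derivatives. -/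
def mkH (m : ℕ) (f : ℕ → L2) (hf : ∀ k ≤ m, ∀ φ : 𝓢(ℝ, ℂ),
    pair (f k) (sL φ) = (-1) ^ k * pair (f 0) (sL (dS k φ))) : H m :=
  (⟨fun k => f k, fun k φ => hf k (Nat.lt_succ_iff.1 k.2) φ⟩ : Hsub m)

lemma cp_mkH {f : ℕ → L2} {hf} {k : ℕ} (hk : k ≤ m) : cp k (mkH m f hf) = f k := by
  rw [cp_eq (Nat.lt_succ_of_le hk)]; rfl

attribute [irreducible] mkH cp

lemma H_ext_cp {F G : H m} (h : ∀ k ≤ m, cp k F = cp k G) : F = G := by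
  refine Subtype.ext (p := (· ∈ Hsub m)) (funext fun k => ?_)
  have := h k (Nat.lt_succ_iff.1 k.2)
  rw [cp_eq k.2, cp_eq k.2] at this
  exact this

/-- Weak derivatives are determined by the function. Identities in `H m` thereby reduce to their
component of order `0` in `L²`. -/
lemma H_ext {F G : H m} (h : cp 0 F = cp 0 G) : F = G :=
  H_ext_cp fun k hk => eq_of_pair_sL fun φ => by rw [pair_cp hk, pair_cp hk, h]

/-- Testing an element of `H^m` against a Schwartz function. -/
def tst (m : ℕ) (φ : 𝓢(ℝ, ℂ)) : H m →L[ℂ] ℂ := (pair.flip (sL φ)).comp (cp 0)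

lemma tst_apply (φ : 𝓢(ℝ, ℂ)) (F : H m) : tst m φ F = pair (cp 0 F) (sL φ) := rfl

lemma eq_of_tst {F G : H m} (h : ∀ φ, tst m φ F = tst m φ G) : F = G :=
  H_ext (eq_of_pair_sL h)

/-- The embedding of Schwartz functions into `H^m`. -/
def toH (m : ℕ) : 𝓢(ℝ, ℂ) →ₗ[ℂ] H m where
  toFun φ := mkH m (fun k => sL (dS k φ)) fun k _ ψ => by rw [pair_dS, dS_zero]
  map_add' φ ψ := H_ext_cp fun k hk => by
    rw [map_add, cp_mkH hk, cp_mkH hk, cp_mkH hk, dS_add, sL_add]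
  map_smul' c φ := H_ext_cp fun k hk => by
    rw [map_smul, cp_mkH hk, cp_mkH hk, dS_smul, sL_smul]; rfl

lemma cp_toH {k : ℕ} (hk : k ≤ m) (φ : 𝓢(ℝ, ℂ)) : cp k (toH m φ) = sL (dS k φ) := by
  change cp k (mkH m _ _) = _
  rw [cp_mkH hk]

/-- Linear isometric maps of `H^m` from linear maps of the components. -/
def isoH {R : Type*} [Semiring R] [Module R L2] [Module R (H m)] (T : L2 → L2)
    (hT : ∀ f, ‖T f‖ = ‖f‖)
    (hc : ∀ F : H m, ∀ k ≤ m, ∀ φ : 𝓢(ℝ, ℂ),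
      pair (T (cp k F)) (sL φ) = (-1) ^ k * pair (T (cp 0 F)) (sL (dS k φ)))
    (hadd : ∀ f g, T (f + g) = T f + T g)
    (hsmul : ∀ (c : R) (F : H m), ∀ k ≤ m, T (cp k (c • F)) = cp k (c • mkH m _ (hc F))) :
    H m →ₗᵢ[R] H m where
  toFun F := mkH m (fun k => T (cp k F)) (hc F)
  map_add' F G := H_ext_cp fun k hk => by
    rw [map_add, cp_mkH hk, cp_mkH hk, cp_mkH hk, map_add, hadd]
  map_smul' c F := H_ext_cp fun k hk => by
    rw [cp_mkH hk]; exact hsmul c F k hk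
  norm_map' F := by
    refine le_antisymm (norm_H_le (norm_nonneg _) fun k hk => ?_)
      (norm_H_le (norm_nonneg _) fun k hk => ?_)
    · change ‖cp k (mkH m (fun k => T (cp k F)) (hc F))‖ ≤ _
      rw [cp_mkH hk, hT]; exact norm_cp_le k F
    · rw [← hT, ← cp_mkH (hf := hc F) hk]; exact norm_cp_le k _

/-- The free Schrödinger group on `H^m`. -/
def UH (m : ℕ) (t : ℝ) : H m →ₗᵢ[ℂ] H m :=
  isoH (U t) (U t).norm_map
    (fun F k hk φ => by rw [pair_U, pair_U, pair_cp hk, US_dS])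
    (map_add (U t)) (fun c F k hk => by rw [map_smul, map_smul, map_smul, cp_mkH hk])

lemma cp_UH {k : ℕ} (hk : k ≤ m) (t : ℝ) (F : H m) : cp k (UH m t F) = U t (cp k F) := by
  change cp k (mkH m _ _) = _
  rw [cp_mkH hk]

lemma UH_add (s t : ℝ) (F : H m) : UH m (s + t) F = UH m s (UH m t F) :=
  H_ext (by simp only [cp_UH (Nat.zero_le m), U_add])

lemma UH_zero (F : H m) : UH m 0 F = F := H_ext (by simp only [cp_UH (Nat.zero_le m), U_zero])

lemma UH_neg_UH (t : ℝ) (F : H m) : UH m (-t) (UH m t F) = F := by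
  rw [← UH_add, neg_add_cancel, UH_zero]

lemma UH_toH (t : ℝ) (φ : 𝓢(ℝ, ℂ)) : UH m t (toH m φ) = toH m (US t φ) :=
  H_ext (by rw [cp_UH (Nat.zero_le m), cp_toH (Nat.zero_le m), cp_toH (Nat.zero_le m), U_sL,
    dS_zero, dS_zero])

lemma tst_UH (t : ℝ) (F : H m) (φ : 𝓢(ℝ, ℂ)) : tst m φ (UH m t F) = tst m (US t φ) F := by
  rw [tst_apply, tst_apply, cp_UH (Nat.zero_le m), pair_U]

/-- A map into `H^m` is continuous when all its derivatives are. -/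
lemma continuous_H {X : Type*} [TopologicalSpace X] {f : X → H m}
    (h : ∀ k ≤ m, Continuous fun x => cp k (f x)) : Continuous f := by
  have h1 : Continuous fun x => tup m (f x) := continuous_pi fun k => by
    have := h k (Nat.lt_succ_iff.1 k.2)
    simp only [cp_eq k.2] at this
    exact this
  exact (isometry_subtype_coe (s := (Hsub m : Set (Fin (m + 1) → L2)))).isUniformInducing.isInducing.continuous_iff.2 h1

lemma continuous_UH : Continuous (fun p : ℝ × H m => UH m p.1 p.2) := by
  refine continuous_H fun k hk => ?_
  simp only [cp_UH hk]
  exact continuous_U.comp (continuous_fst.prodMk ((cp k).continuous.comp continuous_snd))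

attribute [irreducible] UH toH

/-! ### Conjugation and differentiation on `H^m` -/

/-- Complex conjugation on `L²`. -/
def conjL (f : L2) : L2 := star f

lemma conjL_ae (f : L2) : (conjL f : ℝ → ℂ) =ᵐ[volume] fun x => (starRingEnd ℂ) (f x) :=
  Lp.coeFn_star f

/-- Complex conjugation of Schwartz functions. -/
def conjS (φ : 𝓢(ℝ, ℂ)) : 𝓢(ℝ, ℂ) :=
  SchwartzMap.postcompCLM (𝕜 := ℝ) (Complex.conjCLE : ℂ →L[ℝ] ℂ) φ

lemma conjS_apply (φ : 𝓢(ℝ, ℂ)) (x : ℝ) : conjS φ x = (starRingEnd ℂ) (φ x) := rfl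

lemma dS_conjS (k : ℕ) (φ : 𝓢(ℝ, ℂ)) : dS k (conjS φ) = conjS (dS k φ) := by
  induction k with
  | zero => rw [dS_zero, dS_zero]
  | succ k ih =>
    rw [add_comm, ← dS_dS, ih, ← dS_dS]
    ext x
    rw [conjS_apply, dS_one_coe, dS_one_coe]
    have h := (dS k φ).hasDerivAt x
    exact (Complex.conjCLE.toContinuousLinearMap.hasFDerivAt.comp_hasDerivAt x h).deriv

lemma pair_conjL (f : L2) (φ : 𝓢(ℝ, ℂ)) :
    pair (conjL f) (sL φ) = (starRingEnd ℂ) (pair f (sL (conjS φ))) := by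
  rw [pair_sL, pair_sL, ← integral_conj]
  refine integral_congr_ae ?_
  filter_upwards [conjL_ae f] with x hx
  rw [hx, conjS_apply]; simp

lemma conjL_add (f g : L2) : conjL (f + g) = conjL f + conjL g := by
  refine Lp.ext ?_
  filter_upwards [conjL_ae f, conjL_ae g, conjL_ae (f + g), Lp.coeFn_add f g,
    Lp.coeFn_add (conjL f) (conjL g)] with x h1 h2 h3 h4 h5
  rw [h3, h4, h5]; simp [h1, h2]

lemma conjL_smul (c : ℂ) (f : L2) : conjL (c • f) = (starRingEnd ℂ) c • conjL f := by
  refine Lp.ext ?_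
  filter_upwards [conjL_ae f, conjL_ae (c • f), Lp.coeFn_smul c f,
    Lp.coeFn_smul ((starRingEnd ℂ) c) (conjL f)] with x h1 h3 h4 h5
  rw [h3, h4, h5]; simp [h1]

/-- Complex conjugation on `H^m`. -/
def cj (m : ℕ) : H m →ₗᵢ[ℝ] H m :=
  isoH conjL (fun f => by
      refine le_antisymm (Lp.norm_le_norm_of_ae_le ?_) (Lp.norm_le_norm_of_ae_le ?_) <;>
      · filter_upwards [conjL_ae f] with x hx
        rw [hx]; simp)
    (fun F k hk φ => by
      rw [pair_conjL, pair_conjL, pair_cp hk, dS_conjS]; simp)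
    conjL_add (fun c F k hk => by
      have e : ∀ F : H m, c • F = (c : ℂ) • F := fun F => rfl
      rw [e, e, map_smul, map_smul, cp_mkH hk, conjL_smul]; simp)

lemma cp_cj {k : ℕ} (hk : k ≤ m) (F : H m) : cp k (cj m F) = conjL (cp k F) := by
  change cp k (mkH m _ _) = _
  rw [cp_mkH hk]

lemma cj_smul (c : ℂ) (F : H m) : cj m (c • F) = (starRingEnd ℂ) c • cj m F :=
  H_ext (by rw [cp_cj (Nat.zero_le m), map_smul, map_smul, cp_cj (Nat.zero_le m), conjL_smul])

lemma cj_cj (F : H m) : cj m (cj m F) = F := by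
  refine H_ext ?_
  rw [cp_cj (Nat.zero_le m), cp_cj (Nat.zero_le m)]
  exact star_star (cp 0 F)

lemma cj_toH (φ : 𝓢(ℝ, ℂ)) : cj m (toH m φ) = toH m (conjS φ) := by
  refine eq_of_tst fun ψ => ?_
  rw [tst_apply, tst_apply, cp_cj (Nat.zero_le m), cp_toH (Nat.zero_le m), cp_toH (Nat.zero_le m),
    pair_conjL, pair_sL_sL, pair_sL_sL, ← integral_conj]
  simp [conjS_apply, dS_zero]

/-- Conjugation reverses time. Hence `w̄` oscillates against the group, which makes the linear term
in `w̄` harmless later on. -/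
lemma conjS_US (t : ℝ) (φ : 𝓢(ℝ, ℂ)) : conjS (US t φ) = US (-t) (conjS φ) := by
  have e : ∀ (φ : 𝓢(ℝ, ℂ)) (ξ : ℝ), 𝓕 (conjS φ) ξ = (starRingEnd ℂ) (𝓕 φ (-ξ)) := by
    intro φ ξ
    rw [SchwartzMap.fourier_coe, SchwartzMap.fourier_coe, Real.fourier_eq', Real.fourier_eq',
      ← integral_conj]
    refine integral_congr_ae (Eventually.of_forall fun x => ?_)
    simp only [conjS_apply, smul_eq_mul, map_mul, ← Complex.exp_conj]
    simp [Complex.conj_ofNat]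
  refine schwartz_fourier_injective fun ξ => ?_
  rw [fourier_US, e, e, fourier_US, map_mul]
  congr 1
  rw [sym, sym, ← Complex.exp_conj]
  simp [Complex.conj_ofNat]

lemma cj_UH (t : ℝ) (F : H m) : cj m (UH m t F) = UH m (-t) (cj m F) := by
  refine eq_of_tst fun φ => ?_
  rw [tst_UH, tst_apply, tst_apply, cp_cj (Nat.zero_le m), cp_cj (Nat.zero_le m),
    cp_UH (Nat.zero_le m), pair_conjL, pair_conjL, pair_U, conjS_US, neg_neg]

/-- Differentiation `H^n → H^m` of order `j`, for `j + m ≤ n`, as a linear map. -/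
def shiftₗ (m : ℕ) {n : ℕ} (j : ℕ) (h : j + m ≤ n) : H n →ₗ[ℂ] H m where
  toFun F := mkH m (fun k => cp (j + k) F) fun k hk φ => by
    rw [pair_cp (k := j + k) (by omega), pair_cp (k := j + 0) (by omega), add_zero, dS_dS,
      pow_add]
    ring
  map_add' F G := H_ext_cp fun k hk => by
    rw [map_add (cp k), cp_mkH hk, cp_mkH hk, cp_mkH hk, map_add]
  map_smul' c F := H_ext_cp fun k hk => by
    rw [map_smul (cp k), cp_mkH hk, cp_mkH hk, map_smul]; rfl

lemma cp_shiftₗ {j k : ℕ} (h : j + m ≤ n) (hk : k ≤ m) (F : H n) :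
    cp k (shiftₗ m j h F) = cp (j + k) F := by
  change cp k (mkH m _ _) = _
  rw [cp_mkH hk]

lemma norm_shiftₗ_le {j : ℕ} (h : j + m ≤ n) (F : H n) : ‖shiftₗ m j h F‖ ≤ ‖F‖ :=
  norm_H_le (norm_nonneg _) fun k hk => by
    rw [cp_shiftₗ h hk]; exact norm_cp_le _ F

/-- Differentiation `H^n → H^m` of order `j`, for `j + m ≤ n`. -/
def shiftH (m : ℕ) {n : ℕ} (j : ℕ) (h : j + m ≤ n) : H n →L[ℂ] H m :=
  LinearMap.mkContinuous (shiftₗ m j h) 1 fun F => by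
    rw [one_mul]; exact norm_shiftₗ_le h F

lemma cp_shiftH {j k : ℕ} (h : j + m ≤ n) (hk : k ≤ m) (F : H n) :
    cp k (shiftH m j h F) = cp (j + k) F := cp_shiftₗ h hk F

lemma norm_shiftH_le {j : ℕ} (h : j + m ≤ n) (F : H n) : ‖shiftH m j h F‖ ≤ ‖F‖ :=
  norm_shiftₗ_le h F

lemma shiftH_toH {j : ℕ} (h : j + m ≤ n) (φ : 𝓢(ℝ, ℂ)) :
    shiftH m j h (toH n φ) = toH m (dS j φ) :=
  H_ext (by rw [cp_shiftH h (Nat.zero_le m), cp_toH (by omega), cp_toH (by omega), dS_zero,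
    add_zero])

/-! ### Fourier description of `H^m` and density of Schwartz functions -/

lemma pair_fourier (f : L2) (ψ : 𝓢(ℝ, ℂ)) : pair (𝓕 f : L2) (sL ψ) = pair f (sL (𝓕 ψ)) := by
  refine sL_dense.induction_on (p := fun f => pair (𝓕 f : L2) (sL ψ) = pair f (sL (𝓕 ψ))) f
    (isClosed_eq ?_ ?_) fun φ => ?_
  · exact (pair.flip (sL ψ)).continuous.comp (Lp.fourierTransformₗᵢ ℝ ℂ).continuous
  · exact (pair.flip _).continuous
  · have : (𝓕 (sL φ) : L2) = sL (𝓕 φ) := SchwartzMap.toLp_fourier_eq φ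
    rw [this, pair_sL_sL, pair_sL_sL, SchwartzMap.integral_fourier_mul_eq]

lemma hasTemperateGrowth_fourier_symbol (k : ℕ) :
    Function.HasTemperateGrowth (fun ξ : ℝ => (2 * Real.pi * Complex.I * (ξ : ℂ)) ^ k) := by
  fun_prop

lemma pair_dS_fourier (k : ℕ) (f : L2) (φ : 𝓢(ℝ, ℂ)) :
    pair f (sL (dS k (𝓕 φ))) =
      (-1) ^ k * ∫ ξ, (2 * Real.pi * Complex.I * ξ) ^ k * (𝓕 f : L2) ξ * φ ξ := by
  have hχ := hasTemperateGrowth_fourier_symbol k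
  set ρ : 𝓢(ℝ, ℂ) := SchwartzMap.smulLeftCLM ℂ
    (fun ξ : ℝ => (2 * Real.pi * Complex.I * (ξ : ℂ)) ^ k) φ with hρ
  have e : dS k (𝓕 φ) = 𝓕 ((-1 : ℂ) ^ k • ρ) := by
    have e1 : 𝓕⁻ (dS k (𝓕 φ)) = (-1 : ℂ) ^ k • ρ := by
      ext ξ
      rw [SchwartzMap.fourierInv_coe, Real.fourierInv_eq_fourier_neg, ← SchwartzMap.fourier_coe,
        fourier_dS, SchwartzMap.fourier_coe, ← Real.fourierInv_eq_fourier_neg,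
        ← SchwartzMap.fourierInv_coe, FourierTransform.fourierInv_fourier_eq, smul_apply,
        hρ, SchwartzMap.smulLeftCLM_apply_apply hχ]
      simp only [smul_eq_mul, ← mul_assoc, ← mul_pow]
      push_cast; ring_nf
    rw [← e1, FourierTransform.fourier_fourierInv_eq]
  rw [e, ← pair_fourier, sL_smul, map_smul, smul_eq_mul, pair_sL]
  congr 1
  refine integral_congr_ae (Eventually.of_forall fun ξ => ?_)
  simp only [hρ, SchwartzMap.smulLeftCLM_apply_apply hχ, smul_eq_mul]
  ring

lemma fourier_cp {k : ℕ} (hk : k ≤ m) (F : H m) :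
    ((𝓕 (cp k F) : L2) : ℝ → ℂ) =ᵐ[volume]
      fun ξ => (2 * Real.pi * Complex.I * ξ) ^ k * (𝓕 (cp 0 F) : L2) ξ := by
  refine ae_eq_of_integral_schwartz (L2.locallyIntegrable _)
    ((L2.locallyIntegrable _).continuous_mul (by fun_prop)) fun φ => ?_
  rw [← pair_sL, pair_fourier, pair_cp hk, pair_dS_fourier, ← mul_assoc, ← mul_pow]
  simp

/-- Weak derivatives in terms of the Fourier transform. -/
lemma pair_eq_of_fourier {k : ℕ} {f g : L2} (h : ((𝓕 g : L2) : ℝ → ℂ) =ᵐ[volume]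
      fun ξ => (2 * Real.pi * Complex.I * ξ) ^ k * (𝓕 f : L2) ξ) (φ : 𝓢(ℝ, ℂ)) :
    pair g (sL φ) = (-1) ^ k * pair f (sL (dS k φ)) := by
  obtain ⟨ψ, rfl⟩ : ∃ ψ : 𝓢(ℝ, ℂ), φ = 𝓕 ψ := ⟨𝓕⁻ φ, (FourierTransform.fourier_fourierInv_eq φ).symm⟩
  rw [pair_dS_fourier, ← pair_fourier, pair_sL, ← mul_assoc, ← mul_pow]
  simp only [mul_neg, mul_one, neg_neg, one_pow, one_mul]
  refine integral_congr_ae ?_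
  filter_upwards [h] with ξ hξ
  rw [hξ]

/-- The inverse Japanese bracket `(1 + ξ²)^{-1/2}`. -/
def jap (ξ : ℝ) : ℝ := (1 + ‖ξ‖ ^ 2) ^ (-(1 / 2) : ℝ)

lemma jap_pos (ξ : ℝ) : 0 < jap ξ := by unfold jap; positivity

lemma jap_eq (ξ : ℝ) : jap ξ = (Real.sqrt (1 + ξ ^ 2))⁻¹ := by
  rw [jap, Real.rpow_neg (by positivity), Real.sqrt_eq_rpow]; simp

lemma jap_le_one (ξ : ℝ) : jap ξ ≤ 1 := by
  rw [jap_eq]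
  exact inv_le_one_of_one_le₀ (Real.one_le_sqrt.2 (by nlinarith [sq_nonneg ξ]))

lemma abs_mul_jap_le_one (ξ : ℝ) : |ξ| * jap ξ ≤ 1 := by
  rw [jap_eq, ← div_eq_mul_inv, div_le_one (by positivity)]
  exact Real.abs_le_sqrt (by linarith)

lemma inv_jap_le (ξ : ℝ) : (jap ξ)⁻¹ ≤ 1 + |ξ| := by
  rw [jap_eq, inv_inv, Real.sqrt_le_left (by positivity), ← sq_abs ξ]
  nlinarith [abs_nonneg ξ]

lemma jap_continuous : Continuous jap := by
  simp only [funext jap_eq]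
  refine Continuous.inv₀ (by fun_prop) fun ξ => ?_
  positivity

lemma jap_temperate (k : ℕ) : Function.HasTemperateGrowth (fun ξ : ℝ => ((jap ξ : ℂ)) ^ k) := by
  have h : Function.HasTemperateGrowth jap :=
    Function.hasTemperateGrowth_one_add_norm_sq_rpow ℝ (-(1 / 2))
  fun_prop

lemma abs_pow_mul_jap_pow_le {k : ℕ} (hk : k ≤ m) (ξ : ℝ) : |ξ| ^ k * jap ξ ^ m ≤ 1 := by
  obtain ⟨l, rfl⟩ := Nat.exists_eq_add_of_le hk
  rw [pow_add, ← mul_assoc, ← mul_pow]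
  have h1 := jap_pos ξ
  exact mul_le_one₀ (pow_le_one₀ (by positivity) (abs_mul_jap_le_one ξ)) (by positivity)
    (pow_le_one₀ h1.le (jap_le_one ξ))

/-- Schwartz functions are dense in `H^m`. -/
lemma toH_dense (m : ℕ) : DenseRange (toH m) := by
  intro F
  rw [Metric.mem_closure_range_iff]
  intro ε hε
  set g0 : L2 := 𝓕 (cp 0 F) with hg0
  -- With `⟨ξ⟩ = 1 / jap ξ`, membership in `H^m` puts `⟨ξ⟩^m F̂` in `L²`. Approximating this
  -- function by a Schwartz `ψ` and dividing the weight out again gives a Schwartz function whose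
  -- inverse transform approximates `F`.
  have hmem : MemLp (fun ξ => ((jap ξ : ℂ)⁻¹) ^ m * g0 ξ) 2 volume := by
    have hb : MemLp (fun ξ => (2 : ℝ) ^ (m - 1) * (‖g0 ξ‖ + ‖(𝓕 (cp m F) : L2) ξ‖)) 2 volume :=
      ((Lp.memLp g0).norm.add (Lp.memLp (𝓕 (cp m F) : L2)).norm).const_mul _
    refine hb.of_le ?_ ?_
    · refine AEStronglyMeasurable.mul ?_ (Lp.aestronglyMeasurable g0)
      refine Continuous.aestronglyMeasurable ?_
      refine (Continuous.inv₀ (Complex.continuous_ofReal.comp jap_continuous) fun ξ => ?_).pow m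
      simpa using (jap_pos ξ).ne'
    · filter_upwards [fourier_cp le_rfl F] with ξ hξ
      rw [hξ, norm_mul, norm_pow, norm_inv, Complex.norm_real, Real.norm_of_nonneg
        (jap_pos ξ).le, Real.norm_of_nonneg (by positivity : (0 : ℝ) ≤ 2 ^ (m - 1) *
        (‖g0 ξ‖ + ‖(2 * Real.pi * Complex.I * (ξ : ℂ)) ^ m * (𝓕 (cp 0 F) : L2) ξ‖)), norm_mul,
        norm_pow]
      have h1 : ‖(2 * Real.pi * Complex.I * (ξ : ℂ))‖ = 2 * Real.pi * |ξ| := by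
        simp [abs_of_pos Real.pi_pos]
      have h2 : (jap ξ)⁻¹ ^ m ≤ 2 ^ (m - 1) * (1 + (2 * Real.pi * |ξ|) ^ m) := by
        calc (jap ξ)⁻¹ ^ m ≤ (1 + |ξ|) ^ m :=
              pow_le_pow_left₀ (inv_nonneg.2 (jap_pos ξ).le) (inv_jap_le ξ) m
          _ ≤ 2 ^ (m - 1) * (1 ^ m + |ξ| ^ m) := add_pow_le zero_le_one (abs_nonneg ξ) m
          _ ≤ _ := by
            rw [one_pow]
            gcongr
            nlinarith [Real.pi_gt_three, abs_nonneg ξ]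
      rw [h1]
      calc _ ≤ 2 ^ (m - 1) * (1 + (2 * Real.pi * |ξ|) ^ m) * ‖g0 ξ‖ := by gcongr
        _ = _ := by ring
  set g : L2 := hmem.toLp with hg
  have hgae : (g : ℝ → ℂ) =ᵐ[volume] fun ξ => ((jap ξ : ℂ)⁻¹) ^ m * g0 ξ := hmem.coeFn_toLp
  have hC : 0 < (2 * Real.pi) ^ m + 1 := by positivity
  -- The tolerance accounts for `|2πξ|^k ⟨ξ⟩^{-m} ≤ (2π)^m` for `k ≤ m`, the loss in returning from
  -- `ψ` to the `k`-th derivative.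
  obtain ⟨ψ, hψ⟩ := (Metric.denseRange_iff.1 sL_dense) g (ε / 2 / ((2 * Real.pi) ^ m + 1))
    (by positivity)
  set ρ : 𝓢(ℝ, ℂ) := SchwartzMap.smulLeftCLM ℂ (fun ξ : ℝ => ((jap ξ : ℂ)) ^ m) ψ with hρ
  refine ⟨𝓕⁻ ρ, ?_⟩
  refine lt_of_le_of_lt ?_ (half_lt_self hε)
  rw [dist_comm, dist_eq_norm]
  refine norm_H_le (by positivity) fun k hk => ?_
  rw [map_sub, cp_toH hk, ← Lp.norm_fourier_eq]
  have e1 : (𝓕 (sL (dS k (𝓕⁻ ρ)) - cp k F) : L2) = sL (𝓕 (dS k (𝓕⁻ ρ))) - (𝓕 (cp k F) : L2) := by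
    have : (𝓕 (sL (dS k (𝓕⁻ ρ))) : L2) = sL (𝓕 (dS k (𝓕⁻ ρ))) := SchwartzMap.toLp_fourier_eq _
    rw [← this]
    exact map_sub (Lp.fourierTransformₗᵢ ℝ ℂ) _ _
  rw [e1]
  have hle : ‖sL (𝓕 (dS k (𝓕⁻ ρ))) - (𝓕 (cp k F) : L2)‖ ≤
      ((2 * Real.pi) ^ m + 1) * ‖sL ψ - g‖ := by
    refine Lp.norm_le_mul_norm_of_ae_le_mul ?_
    filter_upwards [fourier_cp hk F, sL_ae (𝓕 (dS k (𝓕⁻ ρ))), sL_ae ψ, hgae,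
      Lp.coeFn_sub (sL (𝓕 (dS k (𝓕⁻ ρ)))) (𝓕 (cp k F) : L2), Lp.coeFn_sub (sL ψ) g]
      with ξ h1 h2 h3 h4 h5 h6
    rw [h5, h6, Pi.sub_apply, Pi.sub_apply, h1, h2, h3, h4, fourier_dS,
      FourierTransform.fourier_fourierInv_eq, hρ,
      SchwartzMap.smulLeftCLM_apply_apply (jap_temperate m), smul_eq_mul]
    have hj : (jap ξ : ℂ) ^ m * ((jap ξ : ℂ)⁻¹) ^ m = 1 := by
      rw [← mul_pow, mul_inv_cancel₀ (by simpa using (jap_pos ξ).ne'), one_pow]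
    have e2 : (2 * Real.pi * Complex.I * (ξ : ℂ)) ^ k * ((jap ξ : ℂ) ^ m * ψ ξ) -
        (2 * Real.pi * Complex.I * (ξ : ℂ)) ^ k * g0 ξ =
        (2 * Real.pi * Complex.I * (ξ : ℂ)) ^ k * (jap ξ : ℂ) ^ m *
          (ψ ξ - (jap ξ : ℂ)⁻¹ ^ m * g0 ξ) := by
      linear_combination ((2 * Real.pi * Complex.I * (ξ : ℂ)) ^ k * g0 ξ) * hj
    rw [e2, norm_mul]
    gcongr
    rw [norm_mul, norm_pow, norm_pow, Complex.norm_real, Real.norm_of_nonneg (jap_pos ξ).le]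
    have h1 : ‖(2 * Real.pi * Complex.I * (ξ : ℂ))‖ = 2 * Real.pi * |ξ| := by
      simp [abs_of_pos Real.pi_pos]
    rw [h1, mul_pow, mul_assoc]
    have hk' : (2 * Real.pi) ^ k ≤ (2 * Real.pi) ^ m :=
      pow_le_pow_right₀ (by nlinarith [Real.pi_gt_three]) hk
    have hp : (0 : ℝ) ≤ (2 * Real.pi) ^ k := by positivity
    nlinarith [abs_pow_mul_jap_pow_le hk ξ]
  refine hle.trans ?_
  rw [dist_comm, dist_eq_norm, lt_div_iff₀ hC] at hψ
  linarith

/-! ### Sobolev embedding and the algebra `H^m`, `m ≥ 1` -/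

/-- An almost everywhere bound passes to the limit in `L²`. -/
lemma isClosed_ae_le : IsClosed {p : L2 × ℝ | ∀ᵐ x, ‖p.1 x‖ ≤ p.2} := by
  refine IsSeqClosed.isClosed fun p q hp hq => ?_
  rw [Prod.tendsto_iff] at hq
  obtain ⟨ns, hns, hlim⟩ := (tendstoInMeasure_of_tendsto_Lp hq.1).exists_seq_tendsto_ae
  have h2 := hq.2.comp hns.tendsto_atTop
  filter_upwards [hlim, ae_all_iff.2 hp] with x hx hpx
  exact le_of_tendsto_of_tendsto hx.norm h2 (Eventually.of_forall fun i => hpx (ns i))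

lemma norm_sq_L2 (f : L2) : ∫ x, ‖f x‖ ^ 2 = ‖f‖ ^ 2 := by
  have h := L2.inner_def (𝕜 := ℂ) f f
  rw [inner_self_eq_norm_sq_to_K] at h
  simp only [inner_self_eq_norm_sq_to_K] at h
  have h2 : (∫ x, ((‖f x‖ : ℂ)) ^ 2) = ((∫ x, ‖f x‖ ^ 2 : ℝ) : ℂ) := by
    rw [← integral_complex_ofReal]; push_cast; rfl
  exact Complex.ofReal_injective (h2.symm.trans (h.symm.trans (by push_cast; rfl)))

/-- Integrate `(φ²)' = 2φφ'` from `-∞` and use `2|φφ'| ≤ |φ|² + |φ'|²`. -/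
lemma schwartz_sq_le (φ : 𝓢(ℝ, ℂ)) (x : ℝ) : ‖φ x‖ ^ 2 ≤ ‖sL φ‖ ^ 2 + ‖sL (dS 1 φ)‖ ^ 2 := by
  have hd : ∀ y, HasDerivAt (fun y => φ y ^ 2) (2 * φ y * dS 1 φ y) y := by
    intro y
    have := (φ.hasDerivAt y).pow 2
    rw [dS_one_coe]
    refine this.congr_deriv ?_
    norm_num
  have hlim : Tendsto (fun y => φ y ^ 2) atBot (𝓝 0) := by
    have h0 : Tendsto φ atBot (𝓝 0) :=
      (φ.tendsto_cocompact).mono_left atBot_le_cocompact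
    simpa using h0.pow 2
  have hint : ∀ ψ : 𝓢(ℝ, ℂ), Integrable (fun y => ‖ψ y‖ ^ 2) ∧ ∫ y, ‖ψ y‖ ^ 2 = ‖sL ψ‖ ^ 2 := by
    intro ψ
    refine ⟨(memLp_two_iff_integrable_sq_norm ψ.continuous.aestronglyMeasurable).1 (ψ.memLp 2), ?_⟩
    rw [← norm_sq_L2]
    refine integral_congr_ae ?_
    filter_upwards [sL_ae ψ] with y hy
    rw [hy]
  have hle : ∀ y, ‖2 * φ y * dS 1 φ y‖ ≤ ‖φ y‖ ^ 2 + ‖dS 1 φ y‖ ^ 2 := by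
    intro y
    rw [norm_mul, norm_mul]
    simp only [RCLike.norm_ofNat]
    nlinarith [sq_nonneg (‖φ y‖ - ‖dS 1 φ y‖)]
  have hi : Integrable (fun y => 2 * φ y * dS 1 φ y) := by
    refine ((hint φ).1.add (hint (dS 1 φ)).1).mono' ?_ (Eventually.of_forall hle)
    exact ((continuous_const.mul φ.continuous).mul (dS 1 φ).continuous).aestronglyMeasurable
  have := integral_Iic_of_hasDerivAt_of_tendsto' (a := x) (fun y _ => hd y) hi.integrableOn hlim
  rw [sub_zero] at this
  rw [← norm_pow, ← this]
  calc _ ≤ ∫ y in Iic x, ‖2 * φ y * dS 1 φ y‖ := norm_integral_le_integral_norm _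
    _ ≤ ∫ y, ‖2 * φ y * dS 1 φ y‖ :=
        setIntegral_le_integral hi.norm (Eventually.of_forall fun _ => norm_nonneg _)
    _ ≤ ∫ y, (‖φ y‖ ^ 2 + ‖dS 1 φ y‖ ^ 2) :=
        integral_mono hi.norm ((hint φ).1.add (hint (dS 1 φ)).1) hle
    _ = _ := by rw [integral_add (hint φ).1 (hint (dS 1 φ)).1, (hint φ).2, (hint _).2]

/-- The Sobolev embedding `H^1 ⊂ L^∞`. -/
lemma sobolev_embedding {j : ℕ} (hj : j + 1 ≤ m) (F : H m) : ∀ᵐ x, ‖cp j F x‖ ≤ 2 * ‖F‖ := by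
  refine (toH_dense m).induction_on (p := fun F : H m => ∀ᵐ x, ‖cp j F x‖ ≤ 2 * ‖F‖) F ?_
    fun φ => ?_
  · exact isClosed_ae_le.preimage
      ((cp j).continuous.prodMk (continuous_const.mul continuous_norm) :
        Continuous fun F : H m => ((cp j F : L2), 2 * ‖F‖))
  · rw [cp_toH (by omega)]
    filter_upwards [sL_ae (dS j φ)] with x hx
    rw [hx]
    have h := schwartz_sq_le (dS j φ) x
    have h1 := norm_cp_le j (toH m φ)
    have h2 := norm_cp_le (1 + j) (toH m φ)
    rw [cp_toH (by omega)] at h1 h2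
    rw [dS_dS] at h
    have := norm_nonneg (toH m φ)
    refine abs_le_of_sq_le_sq' ?_ (by positivity) |>.2
    nlinarith [norm_nonneg (sL (dS j φ)), norm_nonneg (sL (dS (1 + j) φ))]

/-- The product of two Schwartz functions. -/
def mulS (φ ψ : 𝓢(ℝ, ℂ)) : 𝓢(ℝ, ℂ) := SchwartzMap.pairing (ContinuousLinearMap.mul ℂ ℂ) φ ψ

lemma mulS_apply (φ ψ : 𝓢(ℝ, ℂ)) (x : ℝ) : mulS φ ψ x = φ x * ψ x := rfl

lemma dS_mulS (k : ℕ) (φ ψ : 𝓢(ℝ, ℂ)) :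
    dS k (mulS φ ψ) = ∑ i ∈ Finset.range (k + 1), (k.choose i : ℂ) • mulS (dS i φ) (dS (k - i) ψ) := by
  ext x
  rw [dS_coe]
  have h : (mulS φ ψ : ℝ → ℂ) = (φ : ℝ → ℂ) * (ψ : ℝ → ℂ) := rfl
  rw [h, iteratedDeriv_mul (φ.contDiffAt _) (ψ.contDiffAt _)]
  have h2 : ∀ (s : Finset ℕ) (f : ℕ → 𝓢(ℝ, ℂ)), (∑ i ∈ s, f i) x = ∑ i ∈ s, f i x := by
    intro s f
    induction s using Finset.induction_on with
    | empty => simp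
    | insert a s ha ih => rw [Finset.sum_insert ha, Finset.sum_insert ha, ← ih]; rfl
  rw [h2]
  refine Finset.sum_congr rfl fun i _ => ?_
  rw [smul_apply, mulS_apply, dS_coe, dS_coe, smul_eq_mul, mul_assoc]

/-- The product `f^{(j)} g^{(l)}` in `L²`. -/
def mulC (j l : ℕ) (F G : H m) : L2 :=
  open Classical in
  if h : MemLp (fun x => cp j F x * cp l G x) 2 (volume : Measure ℝ) then h.toLp else 0

/-- Since `j + l ≤ m` and `m ≥ 1`, one of `j`, `l` is below `m`. The corresponding factor is bounded
by the Sobolev embedding, and the other one is in `L²`. -/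
lemma mulC_spec [Fact (1 ≤ m)] {j l : ℕ} (h : j + l ≤ m) (F G : H m) :
    MemLp (fun x => cp j F x * cp l G x) 2 (volume : Measure ℝ) := by
  have hm : 1 ≤ m := Fact.out
  have hmeas : AEStronglyMeasurable (fun x => cp j F x * cp l G x) volume :=
    (Lp.aestronglyMeasurable _).mul (Lp.aestronglyMeasurable _)
  by_cases hj : j + 1 ≤ m
  · refine (Lp.memLp (cp l G)).of_le_mul (c := 2 * ‖F‖) hmeas ?_
    filter_upwards [sobolev_embedding hj F] with x hx
    rw [norm_mul]; gcongr
  · refine (Lp.memLp (cp j F)).of_le_mul (c := 2 * ‖G‖) hmeas ?_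
    filter_upwards [sobolev_embedding (by omega : l + 1 ≤ m) G] with x hx
    rw [norm_mul, mul_comm]; gcongr

lemma mulC_ae [Fact (1 ≤ m)] {j l : ℕ} (h : j + l ≤ m) (F G : H m) :
    (mulC j l F G : ℝ → ℂ) =ᵐ[volume] fun x => cp j F x * cp l G x := by
  rw [mulC, dif_pos (mulC_spec h F G)]
  exact (mulC_spec h F G).coeFn_toLp

lemma norm_mulC_le [Fact (1 ≤ m)] {j l : ℕ} (h : j + l ≤ m) (F G : H m) :
    ‖mulC j l F G‖ ≤ 2 * ‖F‖ * ‖G‖ := by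
  have hm : 1 ≤ m := Fact.out
  by_cases hj : j + 1 ≤ m
  · have : ‖mulC j l F G‖ ≤ (2 * ‖F‖) * ‖cp l G‖ := by
      refine Lp.norm_le_mul_norm_of_ae_le_mul ?_
      filter_upwards [sobolev_embedding hj F, mulC_ae h F G] with x hx hx2
      rw [hx2, norm_mul]; gcongr
    exact this.trans (by gcongr; exact norm_cp_le l G)
  · have : ‖mulC j l F G‖ ≤ (2 * ‖G‖) * ‖cp j F‖ := by
      refine Lp.norm_le_mul_norm_of_ae_le_mul ?_
      filter_upwards [sobolev_embedding (by omega : l + 1 ≤ m) G, mulC_ae h F G] with x hx hx2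
      rw [hx2, norm_mul, mul_comm]; gcongr
    refine this.trans ?_
    nlinarith [norm_cp_le j F, norm_nonneg G]

/-- The product `f^{(j)} g^{(l)}` as a bilinear map `H^m × H^m → L²`. -/
def mulₗ [Fact (1 ≤ m)] (j l : ℕ) (h : j + l ≤ m) : H m →ₗ[ℂ] H m →ₗ[ℂ] L2 :=
  LinearMap.mk₂ ℂ (mulC j l)
    (fun F F' G => Lp.ext (by
      filter_upwards [mulC_ae h F G, mulC_ae h F' G, mulC_ae h (F + F') G,
        Lp.coeFn_add (mulC j l F G) (mulC j l F' G), Lp.coeFn_add (cp j F) (cp j F')]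
        with x h1 h2 h3 h4 h5
      rw [h3, h4, Pi.add_apply, h1, h2, map_add, h5, Pi.add_apply, add_mul]))
    (fun c F G => Lp.ext (by
      filter_upwards [mulC_ae h F G, mulC_ae h (c • F) G,
        Lp.coeFn_smul c (mulC j l F G), Lp.coeFn_smul c (cp j F)]
        with x h1 h3 h4 h5
      rw [h3, h4, Pi.smul_apply, h1, map_smul, h5, Pi.smul_apply, smul_eq_mul, smul_eq_mul,
        mul_assoc]))
    (fun F G G' => Lp.ext (by
      filter_upwards [mulC_ae h F G, mulC_ae h F G', mulC_ae h F (G + G'),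
        Lp.coeFn_add (mulC j l F G) (mulC j l F G'), Lp.coeFn_add (cp l G) (cp l G')]
        with x h1 h2 h3 h4 h5
      rw [h3, h4, Pi.add_apply, h1, h2, map_add, h5, Pi.add_apply, mul_add]))
    (fun c F G => Lp.ext (by
      filter_upwards [mulC_ae h F G, mulC_ae h F (c • G),
        Lp.coeFn_smul c (mulC j l F G), Lp.coeFn_smul c (cp l G)]
        with x h1 h3 h4 h5
      rw [h3, h4, Pi.smul_apply, h1, map_smul, h5, Pi.smul_apply, smul_eq_mul, smul_eq_mul,
        mul_left_comm]))

/-- The product `f^{(j)} g^{(l)}` as a continuous bilinear map `H^m × H^m → L²`, set to zero for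
`j + l > m`. -/
def mulB [Fact (1 ≤ m)] (j l : ℕ) : H m →L[ℂ] H m →L[ℂ] L2 :=
  if h : j + l ≤ m then (mulₗ j l h).mkContinuous₂ 2 (norm_mulC_le h) else 0

lemma mulB_apply [Fact (1 ≤ m)] {j l : ℕ} (h : j + l ≤ m) (F G : H m) :
    mulB j l F G = mulC j l F G := by
  rw [mulB, dif_pos h]; rfl

lemma mulB_ae [Fact (1 ≤ m)] {j l : ℕ} (h : j + l ≤ m) (F G : H m) :
    (mulB j l F G : ℝ → ℂ) =ᵐ[volume] fun x => cp j F x * cp l G x := by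
  rw [mulB_apply h]; exact mulC_ae h F G

lemma norm_mulB_le [Fact (1 ≤ m)] {j l : ℕ} (h : j + l ≤ m) (F G : H m) :
    ‖mulB j l F G‖ ≤ 2 * ‖F‖ * ‖G‖ := by
  rw [mulB_apply h]; exact norm_mulC_le h F G

lemma mulB_toH [Fact (1 ≤ m)] {j l : ℕ} (h : j + l ≤ m) (φ ψ : 𝓢(ℝ, ℂ)) :
    mulB j l (toH m φ) (toH m ψ) = sL (mulS (dS j φ) (dS l ψ)) := by
  refine Lp.ext ((mulB_ae h _ _).trans ?_)
  rw [cp_toH (by omega), cp_toH (by omega)]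
  filter_upwards [sL_ae (dS j φ), sL_ae (dS l ψ), sL_ae (mulS (dS j φ) (dS l ψ))] with x h1 h2 h3
  rw [h1, h2, h3, mulS_apply]

/-- Leibniz' formula for the `k`-th derivative of a product. -/
def leib [Fact (1 ≤ m)] (k : ℕ) : H m →L[ℂ] H m →L[ℂ] L2 :=
  ∑ i ∈ Finset.range (k + 1), (k.choose i : ℂ) • mulB i (k - i)

lemma leib_apply [Fact (1 ≤ m)] (k : ℕ) (F G : H m) :
    leib k F G = ∑ i ∈ Finset.range (k + 1), (k.choose i : ℂ) • mulB i (k - i) F G := by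
  simp [leib]

lemma leib_toH [Fact (1 ≤ m)] {k : ℕ} (hk : k ≤ m) (φ ψ : 𝓢(ℝ, ℂ)) :
    leib k (toH m φ) (toH m ψ) = sL (dS k (mulS φ ψ)) := by
  have h : ∀ χ : 𝓢(ℝ, ℂ), sL χ = SchwartzMap.toLpCLM ℂ (E := ℝ) ℂ 2 volume χ := fun _ => rfl
  rw [leib_apply, dS_mulS, h, map_sum]
  refine Finset.sum_congr rfl fun i hi => ?_
  have : i ≤ k := Nat.lt_succ_iff.1 (Finset.mem_range.1 hi)
  rw [mulB_toH (by omega), map_smul, h]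

lemma norm_leib_le [Fact (1 ≤ m)] {k : ℕ} (F G : H m) {M : ℝ}
    (h : ∀ i ≤ k, ‖mulB i (k - i) F G‖ ≤ M) : ‖leib k F G‖ ≤ 2 ^ k * M := by
  rw [leib_apply]
  refine (norm_sum_le _ _).trans ?_
  have : (2 : ℝ) ^ k * M = ∑ i ∈ Finset.range (k + 1), (k.choose i : ℝ) * M := by
    rw [← Finset.sum_mul]; congr 1; exact_mod_cast (Nat.sum_range_choose k).symm
  rw [this]
  refine Finset.sum_le_sum fun i hi => ?_
  rw [norm_smul, Complex.norm_natCast]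
  exact mul_le_mul_of_nonneg_left (h i (Nat.lt_succ_iff.1 (Finset.mem_range.1 hi)))
    (Nat.cast_nonneg _)

/-- For Schwartz functions this is Leibniz' formula followed by integration by parts. Both sides are
continuous in the pair `(F, G)`, so density finishes. -/
lemma leib_spec [Fact (1 ≤ m)] {k : ℕ} (hk : k ≤ m) (φ : 𝓢(ℝ, ℂ)) (F G : H m) :
    pair (leib k F G) (sL φ) = (-1) ^ k * pair (leib 0 F G) (sL (dS k φ)) := by
  have hc : ∀ (k : ℕ) (φ : 𝓢(ℝ, ℂ)),
      Continuous fun p : H m × H m => pair (leib k p.1 p.2) (sL φ) := fun k φ =>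
    (pair.flip (sL φ)).continuous.comp
      (((leib k).continuous.comp continuous_fst).clm_apply continuous_snd)
  refine ((toH_dense m).prodMap (toH_dense m)).induction_on
    (p := fun p : H m × H m => pair (leib k p.1 p.2) (sL φ) =
      (-1) ^ k * pair (leib 0 p.1 p.2) (sL (dS k φ))) (F, G)
    (isClosed_eq (hc k φ) (continuous_const.mul (hc 0 _))) fun p => ?_
  simp only [Prod.map_fst, Prod.map_snd]
  rw [leib_toH hk, leib_toH (Nat.zero_le m), pair_dS, dS_zero]

/-- The product on `H^m` as a bilinear map. -/
def mulHₗ (m : ℕ) [Fact (1 ≤ m)] : H m →ₗ[ℂ] H m →ₗ[ℂ] H m :=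
  LinearMap.mk₂ ℂ (fun F G => mkH m (fun k => leib k F G) fun k hk φ => leib_spec hk φ F G)
    (fun F F' G => H_ext_cp fun k hk => by
      rw [map_add (cp k), cp_mkH hk, cp_mkH hk, cp_mkH hk, map_add]; rfl)
    (fun c F G => H_ext_cp fun k hk => by
      rw [map_smul (cp k), cp_mkH hk, cp_mkH hk, map_smul]; rfl)
    (fun F G G' => H_ext_cp fun k hk => by
      rw [map_add (cp k), cp_mkH hk, cp_mkH hk, cp_mkH hk, map_add])
    (fun c F G => H_ext_cp fun k hk => by
      rw [map_smul (cp k), cp_mkH hk, cp_mkH hk, map_smul])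

lemma cp_mulHₗ [Fact (1 ≤ m)] {k : ℕ} (hk : k ≤ m) (F G : H m) :
    cp k (mulHₗ m F G) = leib k F G := by
  change cp k (mkH m _ _) = _
  rw [cp_mkH hk]

lemma norm_mulHₗ_le [Fact (1 ≤ m)] (F G : H m) : ‖mulHₗ m F G‖ ≤ (2 ^ (m + 1)) * ‖F‖ * ‖G‖ := by
  refine norm_H_le (by positivity) fun k hk => ?_
  rw [cp_mulHₗ hk]
  refine (norm_leib_le F G fun i hi => norm_mulB_le (by omega) F G).trans ?_
  calc (2 : ℝ) ^ k * (2 * ‖F‖ * ‖G‖) ≤ 2 ^ m * (2 * ‖F‖ * ‖G‖) := by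
        gcongr; norm_num
    _ = _ := by ring

/-- The product on `H^m`, `m ≥ 1`, as a continuous bilinear map. -/
def mulH (m : ℕ) [Fact (1 ≤ m)] : H m →L[ℂ] H m →L[ℂ] H m :=
  (mulHₗ m).mkContinuous₂ (2 ^ (m + 1)) norm_mulHₗ_le

lemma cp_mulH [Fact (1 ≤ m)] {k : ℕ} (hk : k ≤ m) (F G : H m) :
    cp k (mulH m F G) = leib k F G := cp_mulHₗ hk F G

lemma norm_mulH_apply_le [Fact (1 ≤ m)] (F G : H m) :
    ‖mulH m F G‖ ≤ 2 ^ (m + 1) * ‖F‖ * ‖G‖ := norm_mulHₗ_le F G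

lemma norm_mulH_le [Fact (1 ≤ m)] (F : H m) : ‖mulH m F‖ ≤ 2 ^ (m + 1) * ‖F‖ :=
  ContinuousLinearMap.opNorm_le_bound _ (by positivity) fun G => norm_mulH_apply_le F G

attribute [irreducible] mulH

lemma mulH_toH [Fact (1 ≤ m)] (φ ψ : 𝓢(ℝ, ℂ)) :
    mulH m (toH m φ) (toH m ψ) = toH m (mulS φ ψ) :=
  H_ext (by rw [cp_mulH (Nat.zero_le m), leib_toH (Nat.zero_le m), cp_toH (Nat.zero_le m)])

lemma mulH_ae [Fact (1 ≤ m)] (F G : H m) :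
    (cp 0 (mulH m F G) : ℝ → ℂ) =ᵐ[volume] fun x => cp 0 F x * cp 0 G x := by
  rw [cp_mulH (Nat.zero_le m), leib_apply]
  simpa using mulB_ae (m := m) (j := 0) (l := 0) (Nat.zero_le m) F G

lemma mulH_comm [Fact (1 ≤ m)] (F G : H m) : mulH m F G = mulH m G F := by
  refine H_ext (Lp.ext ?_)
  filter_upwards [mulH_ae F G, mulH_ae G F] with x h1 h2
  rw [h1, h2, mul_comm]

lemma cj_mulH [Fact (1 ≤ m)] (F G : H m) : cj m (mulH m F G) = mulH m (cj m F) (cj m G) := by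
  refine H_ext (Lp.ext ?_)
  rw [cp_cj (Nat.zero_le m)]
  filter_upwards [mulH_ae F G, mulH_ae (cj m F) (cj m G), conjL_ae (cp 0 (mulH m F G)),
    conjL_ae (cp 0 F), conjL_ae (cp 0 G)] with x h1 h2 h3 h4 h5
  rw [h3, h2, h1, cp_cj (Nat.zero_le m), cp_cj (Nat.zero_le m), h4, h5, map_mul]

/-- Lets a bound on multiplication by `w` serve for multiplication by `w̄` as well. -/
lemma norm_mulH_cj [Fact (1 ≤ m)] (F : H m) : ‖mulH m (cj m F)‖ ≤ ‖mulH m F‖ := by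
  refine ContinuousLinearMap.opNorm_le_bound _ (norm_nonneg _) fun G => ?_
  have : mulH m (cj m F) G = cj m (mulH m F (cj m G)) := by rw [cj_mulH, cj_cj]
  rw [this, (cj m).norm_map]
  refine ((mulH m F).le_opNorm _).trans ?_
  rw [(cj m).norm_map]

/-- Multiplication by a function whose derivatives up to order `m` are bounded by `M`. -/
lemma norm_mulH_le_of_ae [Fact (1 ≤ m)] {F : H m} {M : ℝ} (hM : 0 ≤ M)
    (h : ∀ k ≤ m, ∀ᵐ x, ‖cp k F x‖ ≤ M) : ‖mulH m F‖ ≤ 2 ^ m * M := by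
  refine ContinuousLinearMap.opNorm_le_bound _ (by positivity) fun G => ?_
  refine norm_H_le (by positivity) fun k hk => ?_
  rw [cp_mulH hk]
  -- All derivatives of `F` are taken in `L^∞` and those of `G` in `L²`. The decay of `F` in
  -- `W^{m,∞}` is thus inherited by the operator norm, whereas a bound by `‖F‖` would see no decay.
  refine (norm_leib_le F G (M := M * ‖G‖) fun i hi => ?_).trans ?_
  · have : ‖mulB i (k - i) F G‖ ≤ M * ‖cp (k - i) G‖ := by
      refine Lp.norm_le_mul_norm_of_ae_le_mul ?_
      filter_upwards [h i (by omega), mulB_ae (by omega : i + (k - i) ≤ m) F G] with x hx hx2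
      rw [hx2, norm_mul]; gcongr
    exact this.trans (by gcongr; exact norm_cp_le _ G)
  · rw [← mul_assoc]; gcongr; norm_num

/-! ### The dispersive estimate -/

/-- Functions bounded by `M` in the sense of distributions are bounded by `M`. -/
lemma ae_norm_le_of_integral_schwartz {g : ℝ → ℂ} (hg : LocallyIntegrable g) {M : ℝ}
    (h : ∀ φ : 𝓢(ℝ, ℂ), ‖∫ x, g x * φ x‖ ≤ M * ∫ x, ‖φ x‖) : ∀ᵐ x, ‖g x‖ ≤ M := by
  -- Normalized bumps around `x` are test functions of `L¹` norm one. Their convolutions with `g`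
  -- converge to `g` almost everywhere, because the ratio of outer to inner radius stays bounded.
  let b : ℕ → ContDiffBump (0 : ℝ) := fun i =>
    ⟨1 / ((i : ℝ) + 1), 2 * (1 / ((i : ℝ) + 1)), by positivity, by
      have : 0 < 1 / ((i : ℝ) + 1) := by positivity
      linarith⟩
  have hb : Tendsto (fun i => (b i).rOut) atTop (𝓝 0) := by
    have := (tendsto_one_div_add_atTop_nhds_zero_nat (𝕜 := ℝ)).const_mul 2
    simpa [b] using this
  have hlim := ContDiffBump.ae_convolution_tendsto_right_of_locallyIntegrable (μ := volume) (K := 2)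
    hb (Eventually.of_forall fun i => le_rfl) hg
  filter_upwards [hlim] with x hx
  refine le_of_tendsto hx.norm (Eventually.of_forall fun i => ?_)
  rw [convolution_eq_swap]
  have hc : HasCompactSupport (fun y => ((b i).normed volume (x - y) : ℂ)) := by
    have h1 : HasCompactSupport (fun y => (b i).normed volume (x - y)) :=
      (b i).hasCompactSupport_normed.comp_homeomorph (Homeomorph.subLeft x)
    exact h1.comp_left (g := fun y : ℝ => (y : ℂ)) rfl
  have hd : ContDiff ℝ (⊤ : ℕ∞) (fun y => ((b i).normed volume (x - y) : ℂ)) :=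
    Complex.ofRealCLM.contDiff.comp ((b i).contDiff_normed.comp (contDiff_const.sub contDiff_id))
  have := h (hc.toSchwartzMap hd)
  have e : ∀ y, (hc.toSchwartzMap hd) y = ((b i).normed volume (x - y) : ℂ) := fun _ => rfl
  simp only [e] at this
  have h2 : ∫ y, ‖((b i).normed volume (x - y) : ℂ)‖ = 1 := by
    rw [← (b i).integral_normed (μ := volume)]
    rw [← integral_sub_left_eq_self (fun y => (b i).normed volume y) volume x]
    refine integral_congr_ae (Eventually.of_forall fun y => ?_)
    simp [abs_of_nonneg ((b i).nonneg_normed _)]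
  rw [h2, mul_one] at this
  refine le_trans (le_of_eq ?_) this
  congr 1
  refine integral_congr_ae (Eventually.of_forall fun y => ?_)
  simp [mul_comm]

/-- The dispersive estimate for Schwartz functions. -/
lemma norm_US_le (t : ℝ) (ht : 0 < t) (φ : 𝓢(ℝ, ℂ)) (x : ℝ) :
    ‖US t φ x‖ ≤ (4 * Real.pi * t) ^ (-(1 / 2) : ℝ) * ∫ y, ‖φ y‖ := by
  -- The symbol regularized to `e^{-(ε+it)η²}`, times the phase that evaluates the inverse transform
  -- at `x`. For `ε > 0` it is an integrable Gaussian whose Fourier transform is explicit.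
  let G : ℝ → ℝ → ℂ := fun ε ξ =>
    Complex.exp (-Real.pi * (4 * Real.pi * (ε + t * Complex.I)) * ξ ^ 2 +
      2 * Real.pi * (x * Complex.I) * ξ)
  have hGe : ∀ ε ξ, G ε ξ = Complex.exp ((-(ε * (2 * Real.pi * ξ) ^ 2) : ℝ)) *
      (sym t ξ * Complex.exp ((2 * Real.pi * (x * ξ) : ℝ) * Complex.I)) := by
    intro ε ξ
    simp only [G, sym, ← Complex.exp_add]
    push_cast; ring_nf
  have hGn : ∀ ε, 0 ≤ ε → ∀ ξ, ‖G ε ξ‖ ≤ 1 := by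
    intro ε hε ξ
    rw [hGe, norm_mul, norm_mul, norm_sym, Complex.norm_exp_ofReal_mul_I, Complex.norm_exp,
      Complex.ofReal_re, mul_one, mul_one, Real.exp_le_one_iff]
    simp only [Left.neg_nonpos_iff]; positivity
  have hGc : ∀ ε, Continuous (G ε) := by intro ε; fun_prop
  have hrep : US t φ x = ∫ ξ, G 0 ξ * 𝓕 φ ξ := by
    have : US t φ = 𝓕⁻ (𝓕 (US t φ)) := (FourierTransform.fourierInv_fourier_eq _).symm
    rw [this, SchwartzMap.fourierInv_coe, Real.fourierInv_eq']
    refine integral_congr_ae (Eventually.of_forall fun ξ => ?_)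
    simp only [fourier_US, hGe, smul_eq_mul]
    simp
    ring_nf
  have hlim : Tendsto (fun ε : ℝ => ∫ ξ, G ε ξ * 𝓕 φ ξ) (𝓝[>] 0) (𝓝 (US t φ x)) := by
    rw [hrep]
    refine tendsto_integral_filter_of_dominated_convergence (fun ξ => ‖𝓕 φ ξ‖) ?_ ?_ ?_ ?_
    · exact Eventually.of_forall fun ε => ((hGc ε).mul (𝓕 φ).continuous).aestronglyMeasurable
    · filter_upwards [self_mem_nhdsWithin] with ε hε
      refine Eventually.of_forall fun ξ => ?_
      rw [norm_mul]
      exact mul_le_of_le_one_left (norm_nonneg _) (hGn ε (le_of_lt hε) ξ)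
    · exact (𝓕 φ).integrable.norm
    · refine Eventually.of_forall fun ξ => ?_
      have : Continuous fun ε : ℝ => G ε ξ * 𝓕 φ ξ := by fun_prop
      exact (this.tendsto 0).mono_left nhdsWithin_le_nhds
  refine le_of_tendsto hlim.norm ?_
  filter_upwards [self_mem_nhdsWithin] with ε hε
  have hε : 0 < ε := hε
  set b : ℂ := 4 * Real.pi * (ε + t * Complex.I) with hb
  have hbre : b.re = 4 * Real.pi * ε := by simp [hb]
  have hbim : b.im = 4 * Real.pi * t := by simp [hb]
  have hbpos : 0 < b.re := by rw [hbre]; positivity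
  have hb0 : b ≠ 0 := fun h => by rw [h] at hbpos; simp at hbpos
  have hGi : Integrable (G ε) := by
    have h := integrable_cexp_quadratic (b := Real.pi * b)
      (by rw [Complex.re_ofReal_mul]; exact mul_pos Real.pi_pos hbpos)
      (2 * Real.pi * (x * Complex.I)) 0
    refine h.congr (Eventually.of_forall fun ξ => ?_)
    simp [G, hb]
  have hflip : ∫ ξ, G ε ξ * 𝓕 φ ξ = ∫ y, φ y * 𝓕 (G ε) y := by
    have := VectorFourier.integral_bilin_fourierIntegral_eq_flip (ContinuousLinearMap.mul ℂ ℂ)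
      (μ := volume) (ν := volume) (L := innerₗ ℝ) Real.continuous_fourierChar continuous_inner
      φ.integrable hGi
    rw [flip_innerₗ] at this
    rw [SchwartzMap.fourier_coe]
    calc _ = ∫ ξ, 𝓕 (φ : ℝ → ℂ) ξ * G ε ξ := by simp only [mul_comm]
      _ = _ := this
  rw [hflip]
  have hF : ∀ y, ‖𝓕 (G ε) y‖ ≤ (4 * Real.pi * t) ^ (-(1 / 2) : ℝ) := by
    intro y
    have := fourier_gaussian_pi' hbpos (x * Complex.I)
    have h2 : 𝓕 (G ε) y = 1 / b ^ (1 / 2 : ℂ) *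
        Complex.exp (-Real.pi / b * (y + Complex.I * (x * Complex.I)) ^ 2) := congrFun this y
    rw [h2, norm_mul, norm_div, norm_one]
    have h3 : ‖b ^ (1 / 2 : ℂ)‖ = ‖b‖ ^ (1 / 2 : ℝ) := by
      have := Complex.norm_cpow_real b (1 / 2)
      push_cast at this
      exact this
    have h4 : (y + Complex.I * (x * Complex.I) : ℂ) = ((y - x : ℝ) : ℂ) := by
      push_cast; linear_combination (x : ℂ) * Complex.I_sq
    have h5 : ‖Complex.exp (-Real.pi / b * (y + Complex.I * (x * Complex.I)) ^ 2)‖ ≤ 1 := by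
      rw [h4, Complex.norm_exp, Real.exp_le_one_iff, ← Complex.ofReal_pow, Complex.re_mul_ofReal,
        neg_div, Complex.neg_re, Complex.div_re]
      simp only [Complex.ofReal_re, Complex.ofReal_im, zero_mul, zero_div, add_zero]
      have : 0 ≤ Real.pi * b.re / Complex.normSq b := by
        have := Complex.normSq_nonneg b
        positivity
      nlinarith [sq_nonneg (y - x)]
    -- The imaginary part of `b` alone gives a lower bound independent of `ε`, so the estimate
    -- survives the limit `ε → 0`.
    have h6 : 4 * Real.pi * t ≤ ‖b‖ := by
      rw [← hbim]; exact (le_abs_self _).trans (Complex.abs_im_le_norm b)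
    calc _ ≤ 1 / ‖b ^ (1 / 2 : ℂ)‖ * 1 := by gcongr
      _ = ‖b‖ ^ (-(1 / 2) : ℝ) := by
        rw [h3, Real.rpow_neg (norm_nonneg _)]; ring
      _ ≤ _ := Real.rpow_le_rpow_of_nonpos (by positivity) h6 (by norm_num)
  calc ‖∫ y, φ y * 𝓕 (G ε) y‖ ≤ ∫ y, (4 * Real.pi * t) ^ (-(1 / 2) : ℝ) * ‖φ y‖ := by
        refine norm_integral_le_of_norm_le (φ.integrable.norm.const_mul _)
          (Eventually.of_forall fun y => ?_)
        rw [norm_mul, mul_comm]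
        exact mul_le_mul_of_nonneg_right (hF y) (norm_nonneg _)
    _ = _ := integral_const_mul _ _

/-- The dispersive estimate `‖e^{it∂²} f‖_∞ ≤ (4πt)^{-1/2} ‖f‖_1`. -/
lemma dispersive (t : ℝ) (ht : 0 < t) (f : L2) (hf : Integrable f) :
    ∀ᵐ x, ‖U t f x‖ ≤ (4 * Real.pi * t) ^ (-(1 / 2) : ℝ) * ∫ y, ‖f y‖ := by
  refine ae_norm_le_of_integral_schwartz (L2.locallyIntegrable _) fun φ => ?_
  rw [← pair_sL, pair_U, pair_sL]
  have : ∫ y, ‖f y‖ * ((4 * Real.pi * t) ^ (-(1 / 2) : ℝ) * ∫ y, ‖φ y‖) =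
      (4 * Real.pi * t) ^ (-(1 / 2) : ℝ) * (∫ y, ‖f y‖) * ∫ x, ‖φ x‖ := by
    rw [integral_mul_const]; ring
  rw [← this]
  refine norm_integral_le_of_norm_le (hf.norm.mul_const _) (Eventually.of_forall fun y => ?_)
  rw [norm_mul]
  gcongr
  exact norm_US_le t ht φ y

/-! ### Weak, strong and mild time derivatives -/

lemma hasDerivWithinAt_tst_const {t₀ : ℝ} {e : ℝ → H m} {e' : H m} {t : ℝ}
    (h : HasDerivWithinAt e e' (Ici t₀) t) (φ : 𝓢(ℝ, ℂ)) :
    HasDerivWithinAt (fun τ => tst m φ (e τ)) (tst m φ e') (Ici t₀) t :=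
  ((tst m φ).restrictScalars ℝ).hasFDerivAt.comp_hasDerivWithinAt t h

/-- A curve in `H^m` which is differentiable in the sense of distributions, with continuous
derivative in `H^m`, is differentiable in `H^m`. -/
lemma hasDerivWithinAt_of_tst {t₀ : ℝ} {e g : ℝ → H m} (hg : ContinuousOn g (Ici t₀))
    (h : ∀ φ, ∀ t, t₀ ≤ t →
      HasDerivWithinAt (fun τ => tst m φ (e τ)) (tst m φ (g t)) (Ici t₀) t) :
    ∀ t, t₀ ≤ t → HasDerivWithinAt e (g t) (Ici t₀) t := by
  -- `k` extends `g` continuously to the whole line. Tested against any `φ`, the difference of `e`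
  -- and the primitive of `k` has zero derivative, so `e` is that primitive up to a constant.
  set k : ℝ → H m := fun τ => g (max τ t₀) with hk
  have hkc : Continuous k :=
    hg.comp_continuous (continuous_id.max continuous_const) fun τ => le_max_right τ t₀
  set E : ℝ → H m := fun t => ∫ τ in t₀..t, k τ with hE
  have hEd : ∀ t, HasDerivAt E (k t) t := fun t =>
    intervalIntegral.integral_hasDerivAt_right (hkc.intervalIntegrable _ _)
      (hkc.stronglyMeasurableAtFilter _ _) hkc.continuousAt
  have hkg : ∀ t, t₀ ≤ t → k t = g t := fun t ht => by simp only [hk, max_eq_left ht]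
  have hconst : ∀ t, t₀ ≤ t → e t = e t₀ + E t := by
    intro t ht
    refine eq_of_tst fun φ => ?_
    have hd : ∀ τ ∈ Ici t₀, HasDerivWithinAt (fun τ => tst m φ (e τ) - tst m φ (E τ)) 0 (Ici t₀) τ := by
      intro τ hτ
      have := (h φ τ hτ).sub (hasDerivWithinAt_tst_const (hEd τ).hasDerivWithinAt φ)
      rwa [hkg τ hτ, sub_self] at this
    have := (convex_Ici t₀).norm_image_sub_le_of_norm_hasDerivWithin_le (C := 0) hd
      (fun _ _ => by simp) (mem_Ici.2 le_rfl) (mem_Ici.2 ht)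
    rw [zero_mul] at this
    have h0 : E t₀ = 0 := by simp [hE]
    have := sub_eq_zero.1 (norm_le_zero_iff.1 this)
    rw [h0, map_zero, sub_zero] at this
    rw [map_add, ← this]; ring
  intro t ht
  rw [← hkg t ht]
  exact ((hEd t).const_add (e t₀)).hasDerivWithinAt.congr hconst (hconst t ht)

lemma hasDerivAt_of_tst {e g : ℝ → H m} (hg : Continuous g)
    (h : ∀ φ t, HasDerivAt (fun τ => tst m φ (e τ)) (tst m φ (g t)) t) (t : ℝ) :
    HasDerivAt e (g t) t :=
  (hasDerivWithinAt_of_tst (t₀ := t - 1) hg.continuousOn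
    (fun φ τ _ => (h φ τ).hasDerivWithinAt) t (by linarith)).hasDerivAt (Ici_mem_nhds (by linarith))

/-- The free evolution of an element of `H^{m+2}` is differentiable in `H^m`. -/
lemma hasDerivAt_UH (A : H n) {j : ℕ} (hj : j + m ≤ n) (hj2 : (j + 2) + m ≤ n) (t : ℝ) :
    HasDerivAt (fun t => UH m t (shiftH m j hj A))
      (Complex.I • UH m t (shiftH m (j + 2) hj2 A)) t := by
  refine hasDerivAt_of_tst (g := fun t => Complex.I • UH m t (shiftH m (j + 2) hj2 A)) ?_ ?_ t
  · exact (continuous_UH.comp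
      (continuous_id.prodMk (continuous_const (y := shiftH m (j + 2) hj2 A)))).const_smul Complex.I
  · intro φ t
    simp only [map_smul, tst_UH]
    simp only [tst_apply, cp_shiftH _ (Nat.zero_le m)]
    have := ((pair (cp (j + 0) A)).restrictScalars ℝ).hasFDerivAt.comp_hasDerivAt t
      (hasDerivAt_sL_US φ t)
    refine this.congr_deriv ?_
    change pair (cp (j + 0) A) (Complex.I • sL (US t (dS 2 φ))) = _
    rw [map_smul, US_dS, pair_cp (k := j + 0) (by omega),
      pair_cp (k := j + 2 + 0) (by omega), dS_dS, pow_add, pow_add]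
    simp [pow_add]

lemma tendsto_pair {α : Type*} {l : Filter α} {f g : α → L2} {a b : L2} (hf : Tendsto f l (𝓝 a))
    (hg : Tendsto g l (𝓝 b)) : Tendsto (fun x => pair (f x) (g x)) l (𝓝 (pair a b)) :=
  (pair.isBoundedBilinearMap.continuous.tendsto (a, b)).comp (hf.prodMk_nhds hg)

/-- Product rule for a pairing whose first factor is only weakly differentiable. -/
lemma hasDerivWithinAt_pair_weak {s : Set ℝ} {t : ℝ} {W ψ : ℝ → L2} {ψ' : L2} {D : ℂ}
    (hW : ContinuousWithinAt W s t) (hψ : HasDerivWithinAt ψ ψ' s t)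
    (hD : HasDerivWithinAt (fun τ => pair (W τ) (ψ t)) D s t) :
    HasDerivWithinAt (fun τ => pair (W τ) (ψ τ)) (D + pair (W t) ψ') s t := by
  -- Only continuity of `W` is used here, because `ψ` carries the difference quotient. The other
  -- half of the increment, with `ψ t` frozen, is the hypothesis `hD`.
  have h2 : HasDerivWithinAt (fun τ => pair (W τ) (ψ τ - ψ t)) (pair (W t) ψ') s t := by
    rw [hasDerivWithinAt_iff_tendsto_slope] at hψ ⊢
    have hW' : Tendsto W (𝓝[s \ {t}] t) (𝓝 (W t)) := hW.mono_left (nhdsWithin_mono _ sdiff_subset)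
    refine (tendsto_pair hW' hψ).congr fun τ => ?_
    simp only [slope, vsub_eq_sub, sub_self, map_zero, sub_zero]
    exact ((pair (W τ)).restrictScalars ℝ).map_smul ((τ - t)⁻¹) (ψ τ - ψ t)
  refine (hD.add h2).congr_of_eventuallyEq (Eventually.of_forall fun τ => ?_) ?_
  · simp [map_sub]
  · simp [map_sub]

/-- From the weak form of `i w_t + w_ss = i G` to its mild form. -/
lemma mild_of_weak {t₀ : ℝ} {w G : ℝ → H m} (hw : ContinuousOn w (Ici t₀))
    (hG : ContinuousOn G (Ici t₀))
    (h : ∀ φ, ∀ t, t₀ ≤ t → HasDerivWithinAt (fun τ => tst m φ (w τ))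
      (Complex.I * tst m (dS 2 φ) (w t) + tst m φ (G t)) (Ici t₀) t) :
    ∀ t, t₀ ≤ t → HasDerivWithinAt (fun τ => UH m (-τ) (w τ)) (UH m (-t) (G t)) (Ici t₀) t := by
  have hc : ∀ {f : ℝ → H m}, ContinuousOn f (Ici t₀) →
      ContinuousOn (fun τ => UH m (-τ) (f τ)) (Ici t₀) := fun hf =>
    continuous_UH.comp_continuousOn (continuous_neg.continuousOn.prodMk hf)
  refine hasDerivWithinAt_of_tst (hc hG) fun φ t ht => ?_
  -- Moving the flow onto the test function makes it differentiable in time, and its derivative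
  -- cancels the `∂_s²` term of the equation for `w`.
  have h1 : HasDerivAt (fun τ => sL (US (-τ) φ)) (-(Complex.I • sL (US (-t) (dS 2 φ)))) t := by
    have := (hasDerivAt_sL_US φ (-t)).scomp t (hasDerivAt_neg t)
    refine this.congr_deriv ?_
    rw [neg_smul, one_smul]
  have h2 := hasDerivWithinAt_pair_weak (W := fun τ => cp 0 (w τ)) (ψ := fun τ => sL (US (-τ) φ))
    ((cp 0).continuous.continuousAt.comp_continuousWithinAt (hw t ht)) h1.hasDerivWithinAt
    (h (US (-t) φ) t ht)
  simp only [tst_UH]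
  refine h2.congr_deriv ?_
  simp only [tst_apply, map_neg, map_smul, US_dS, smul_eq_mul]
  ring

/-- From the mild form of `i w_t + w_ss = i G` to its weak form. -/
lemma weak_of_mild {t₀ : ℝ} {w G : ℝ → H m} {t : ℝ}
    (h : HasDerivWithinAt (fun τ => UH m (-τ) (w τ)) (UH m (-t) (G t)) (Ici t₀) t)
    (φ : 𝓢(ℝ, ℂ)) : HasDerivWithinAt (fun τ => tst m φ (w τ))
      (Complex.I * tst m (dS 2 φ) (w t) + tst m φ (G t)) (Ici t₀) t := by
  have h1 : HasDerivWithinAt (fun τ => cp 0 (UH m (-τ) (w τ))) (cp 0 (UH m (-t) (G t))) (Ici t₀) t :=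
    ((cp 0).restrictScalars ℝ).hasFDerivAt.comp_hasDerivWithinAt t h
  have h3 := hasDerivWithinAt_pair_weak h1.continuousWithinAt
    (hasDerivAt_sL_US φ t).hasDerivWithinAt
    (((pair.flip (sL (US t φ))).restrictScalars ℝ).hasFDerivAt.comp_hasDerivWithinAt t h1)
  have e : ∀ (τ : ℝ) (F : H m) (φ : 𝓢(ℝ, ℂ)),
      pair (cp 0 (UH m (-τ) F)) (sL (US τ φ)) = tst m φ F := by
    intro τ F φ
    rw [← tst_apply, tst_UH, ← US_add, neg_add_cancel, US_zero]
  simp only [e] at h3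
  refine h3.congr_deriv ?_
  change pair (cp 0 (UH m (-t) (G t))) (sL (US t φ)) + _ = _
  rw [e, map_smul, e, smul_eq_mul]
  ring

/-! ### Integrals over `[t, ∞)` of decaying curves -/

lemma integrableOn_tail {E : Type*} [NormedAddCommGroup E] {g : ℝ → E} {t₀ t M p : ℝ} (ht₀ : 0 < t₀) (ht : t₀ ≤ t) (hp : 1 < p)
    (hg : ContinuousOn g (Ioi 0)) (hM : ∀ τ, t₀ ≤ τ → ‖g τ‖ ≤ M * τ ^ (-p)) :
    IntegrableOn g (Ioi t) := by
  have hi : IntegrableOn (fun τ => M * τ ^ (-p)) (Ioi t) :=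
    (integrableOn_Ioi_rpow_of_lt (by linarith) (by linarith)).const_mul M
  refine Integrable.mono' hi ?_ ?_
  · exact (hg.mono (Ioi_subset_Ioi (by linarith))).aestronglyMeasurable measurableSet_Ioi
  · exact (ae_restrict_iff' measurableSet_Ioi).2
      (Eventually.of_forall fun τ hτ => hM τ (ht.trans (le_of_lt hτ)))

/-- An integrand of size `Mτ^{-3/2}` gives `2Mt^{-1/2}` and one of size `Mτ^{-2}` gives `Mt^{-1}`.
These two cases produce the two rates of the theorem. -/
lemma norm_tail_le {E : Type*} [NormedAddCommGroup E] [NormedSpace ℝ E] {g : ℝ → E} {t₀ t M p : ℝ} (ht₀ : 0 < t₀) (ht : t₀ ≤ t) (hp : 1 < p)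
    (hM : ∀ τ, t₀ ≤ τ → ‖g τ‖ ≤ M * τ ^ (-p)) :
    ‖∫ τ in Ioi t, g τ‖ ≤ M / (p - 1) * t ^ (1 - p) := by
  have hi : IntegrableOn (fun τ => M * τ ^ (-p)) (Ioi t) :=
    (integrableOn_Ioi_rpow_of_lt (by linarith) (by linarith)).const_mul M
  refine (norm_integral_le_of_norm_le hi ((ae_restrict_iff' measurableSet_Ioi).2
      (Eventually.of_forall fun τ hτ => hM τ (ht.trans (le_of_lt hτ))))).trans (le_of_eq ?_)
  rw [integral_const_mul, integral_Ioi_rpow_of_lt (by linarith) (by linarith)]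
  have : -p + 1 = -(p - 1) := by ring
  rw [this, show 1 - p = -(p - 1) by ring, div_neg, neg_div, neg_neg]
  ring

lemma hasDerivAt_tail {E : Type*} [NormedAddCommGroup E] [NormedSpace ℝ E] [CompleteSpace E]
    {g : ℝ → E} {t₀ t M p : ℝ} (ht₀ : 0 < t₀) (ht : t₀ ≤ t) (hp : 1 < p)
    (hg : ContinuousOn g (Ioi 0)) (hM : ∀ τ, t₀ ≤ τ → ‖g τ‖ ≤ M * τ ^ (-p)) :
    HasDerivAt (fun t => ∫ τ in Ioi t, g τ) (-g t) t := by
  have ht' : 0 < t := ht₀.trans_le ht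
  have hint : IntegrableOn g (Ioi t) := integrableOn_tail ht₀ ht hp hg hM
  have hii : ∀ s, 0 < s → IntervalIntegrable g volume s t := fun s hs =>
    (hg.mono fun x hx => (lt_min hs ht').trans_le hx.1).intervalIntegrable
  have hd : HasDerivAt (fun s => (∫ τ in s..t, g τ) + ∫ τ in Ioi t, g τ) (-g t) t := by
    refine HasDerivAt.add_const _ ?_
    refine intervalIntegral.integral_hasDerivAt_left (hii t ht') ?_ (hg.continuousAt (Ioi_mem_nhds ht'))
    exact hg.stronglyMeasurableAtFilter isOpen_Ioi t ht'
  refine hd.congr_of_eventuallyEq ?_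
  filter_upwards [Ioi_mem_nhds ht'] with s hs
  by_cases hst : s ≤ t
  · rw [intervalIntegral.integral_of_le hst, ← setIntegral_union]
    · rw [Ioc_union_Ioi_eq_Ioi hst]
    · exact Ioc_disjoint_Ioi le_rfl
    · exact measurableSet_Ioi
    · exact (intervalIntegrable_iff_integrableOn_Ioc_of_le hst).1 (hii s hs)
    · exact hint
  · push Not at hst
    rw [intervalIntegral.integral_symm, intervalIntegral.integral_of_le hst.le,
      ← Ioc_union_Ioi_eq_Ioi hst.le, setIntegral_union (Ioc_disjoint_Ioi le_rfl) measurableSet_Ioi]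
    · abel
    · exact (intervalIntegrable_iff_integrableOn_Ioc_of_le hst.le).1 (hii s hs).symm
    · exact hint.mono_set (Ioi_subset_Ioi hst.le)

/-! ### Quadratic expressions whose space derivative is an exact time derivative -/

lemma dS_one_mulS (a b : 𝓢(ℝ, ℂ)) : dS 1 (mulS a b) = mulS (dS 1 a) b + mulS a (dS 1 b) := by
  rw [dS_mulS]
  simp [Finset.sum_range_succ, dS_zero]
  abel

lemma dS_two_mulS (a b : 𝓢(ℝ, ℂ)) :
    dS 2 (mulS a b) = mulS (dS 2 a) b + (2 : ℂ) • mulS (dS 1 a) (dS 1 b) + mulS a (dS 2 b) := by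
  rw [dS_mulS]
  simp [Finset.sum_range_succ, dS_zero]
  abel

lemma tst_dS_toH (k : ℕ) (φ ψ : 𝓢(ℝ, ℂ)) :
    tst m (dS k ψ) (toH m φ) = (-1) ^ k * tst m ψ (toH m (dS k φ)) := by
  rw [tst_apply, tst_apply, cp_toH (Nat.zero_le m), cp_toH (Nat.zero_le m), dS_zero, dS_zero,
    pair_dS, ← mul_assoc, ← mul_pow]
  simp

lemma hasDerivAt_toH_US (φ : 𝓢(ℝ, ℂ)) (t : ℝ) :
    HasDerivAt (fun t => toH m (US t φ)) (Complex.I • toH m (US t (dS 2 φ))) t := by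
  have := hasDerivAt_UH (m := m) (toH (m + 2) φ) (j := 0) (by omega) (by omega) t
  simpa only [shiftH_toH, UH_toH, dS_zero] using this

/-- Differentiation of a product tested against a Schwartz function evolving freely. -/
lemma hasDerivAt_tst_UH_mulH [Fact (1 ≤ m)] {a b : ℝ → H m} {a' b' : H m} {t : ℝ}
    (ha : HasDerivAt a a' t) (hb : HasDerivAt b b' t) (φ : 𝓢(ℝ, ℂ)) :
    HasDerivAt (fun τ => tst m φ (UH m (-τ) (mulH m (a τ) (b τ))))
      (tst m (US (-t) φ) (mulH m a' (b t) + mulH m (a t) b') -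
        Complex.I * tst m (dS 2 (US (-t) φ)) (mulH m (a t) (b t))) t := by
  have h1 : HasDerivAt (fun τ => sL (US (-τ) φ)) (-(Complex.I • sL (US (-t) (dS 2 φ)))) t := by
    refine ((hasDerivAt_sL_US φ (-t)).scomp t (hasDerivAt_neg t)).congr_deriv ?_
    rw [neg_smul, one_smul]
  have h2 : HasDerivAt (fun τ => mulH m (a τ) (b τ)) (mulH m (a t) b' + mulH m a' (b t)) t :=
    ((mulH m).bilinearRestrictScalars ℝ).hasDerivAt_of_bilinear (fun _ => ha) (fun _ => hb)
  have h3 : HasDerivAt (fun τ => cp 0 (mulH m (a τ) (b τ)))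
      (cp 0 (mulH m (a t) b' + mulH m a' (b t))) t :=
    ((cp 0).restrictScalars ℝ).hasFDerivAt.comp_hasDerivAt t h2
  have h4 := (pair.bilinearRestrictScalars ℝ).hasDerivAt_of_bilinear (fun _ => h3) (fun _ => h1)
  simp only [tst_UH]
  refine h4.congr_deriv ?_
  change pair (cp 0 (mulH m (a t) (b t))) _ + pair (cp 0 (mulH m (a t) b' + mulH m a' (b t))) _ = _
  simp only [tst_apply, map_neg, map_smul, US_dS, smul_eq_mul, map_add, add_apply]
  ring

/-- Let `f = e^{it∂²}χ''` and `g = e^{it∂²}χ'`, so that `g_s = f`. Both factors solve the free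
equation, so applying `i∂_t + ∂_s²` to `fg` leaves only the cross term `2f_s g_s = 2f_s f =
∂_s(f²)`. -/
lemma quad_schwartz [Fact (1 ≤ m)] (χ φ : 𝓢(ℝ, ℂ)) (t : ℝ) :
    HasDerivAt (fun τ => tst m φ (UH m (-τ)
        (mulH m (toH m (US τ (dS 2 χ))) (toH m (US τ (dS 1 χ))))))
      (Complex.I * tst m (dS 1 φ) (UH m (-t)
        (mulH m (toH m (US t (dS 2 χ))) (toH m (US t (dS 2 χ)))))) t := by
  have h := hasDerivAt_tst_UH_mulH (m := m) (hasDerivAt_toH_US (dS 2 χ) t)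
    (hasDerivAt_toH_US (dS 1 χ) t) φ
  refine h.congr_deriv ?_
  have e1 : US t (dS 2 χ) = dS 1 (US t (dS 1 χ)) := by rw [← US_dS, dS_dS]
  have e2 : US t (dS 2 (dS 2 χ)) = dS 2 (dS 1 (US t (dS 1 χ))) := by
    rw [← US_dS, ← US_dS, dS_dS, dS_dS, dS_dS]
  have e3 : US t (dS 2 (dS 1 χ)) = dS 2 (US t (dS 1 χ)) := by rw [← US_dS]
  rw [e1, e2, e3]
  generalize US t (dS 1 χ) = g
  simp only [tst_UH, US_dS, tst_dS_toH, map_smul, smul_apply, mulH_toH,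
    dS_one_mulS, dS_two_mulS, map_add, smul_eq_mul, dS_dS, pow_one]
  have hc : mulS (dS (1 + 1) g) (dS 1 g) = mulS (dS 1 g) (dS (1 + 1) g) := by
    ext x; simp only [mulS_apply]; ring
  norm_num at hc ⊢
  rw [hc]
  ring

/-- Here `ḡ` solves the conjugate equation, so its second derivative doubles instead of cancelling.
What remains is `2f_s ḡ_s + 2f ḡ_ss = 2f_s f̄ + 2f f̄_s = 2∂_s|f|²`. -/
lemma quad_conj_schwartz [Fact (1 ≤ m)] (χ φ : 𝓢(ℝ, ℂ)) (t : ℝ) :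
    HasDerivAt (fun τ => tst m φ (UH m (-τ)
        (mulH m (toH m (US τ (dS 2 χ))) (cj m (toH m (US τ (dS 1 χ)))))))
      (2 * Complex.I * tst m (dS 1 φ) (UH m (-t)
        (mulH m (toH m (US t (dS 2 χ))) (cj m (toH m (US t (dS 2 χ))))))) t := by
  have hcj : HasDerivAt (fun τ => cj m (toH m (US τ (dS 1 χ))))
      (cj m (Complex.I • toH m (US t (dS 2 (dS 1 χ))))) t :=
    (cj m).toContinuousLinearMap.hasFDerivAt.comp_hasDerivAt t (hasDerivAt_toH_US (dS 1 χ) t)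
  have h := hasDerivAt_tst_UH_mulH (m := m) (hasDerivAt_toH_US (dS 2 χ) t) hcj φ
  refine h.congr_deriv ?_
  have e1 : US t (dS 2 χ) = dS 1 (US t (dS 1 χ)) := by rw [← US_dS, dS_dS]
  have e2 : US t (dS 2 (dS 2 χ)) = dS 2 (dS 1 (US t (dS 1 χ))) := by
    rw [← US_dS, ← US_dS, dS_dS, dS_dS, dS_dS]
  have e3 : US t (dS 2 (dS 1 χ)) = dS 2 (US t (dS 1 χ)) := by rw [← US_dS]
  rw [e1, e2, e3]
  generalize US t (dS 1 χ) = g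
  simp only [tst_UH, US_dS, tst_dS_toH, map_smul, smul_apply, mulH_toH, cj_smul, cj_toH,
    dS_one_mulS, dS_two_mulS, map_add, smul_eq_mul, dS_dS, pow_one, Complex.conj_I, ← dS_conjS]
  norm_num
  ring

/-- Extension by density of the time derivative of a quadratic expression. -/
lemma hasDerivAt_tst_of_dense {P S : H n → ℝ → H m} (hP : Continuous (Function.uncurry P))
    (hS : Continuous (Function.uncurry S)) {c : ℂ} (φ : 𝓢(ℝ, ℂ))
    (h : ∀ χ t, HasDerivAt (fun τ => tst m φ (P (toH n χ) τ))
      (c * tst m (dS 1 φ) (S (toH n χ) t)) t) (A : H n) (t : ℝ) :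
    HasDerivAt (fun τ => tst m φ (P A τ)) (c * tst m (dS 1 φ) (S A t)) t := by
  have hcS : Continuous (fun p : H n × ℝ => c * tst m (dS 1 φ) (S p.1 p.2)) :=
    continuous_const.mul ((tst m (dS 1 φ)).continuous.comp hS)
  have hcP : ∀ t, Continuous (fun A : H n => tst m φ (P A t)) := fun t =>
    (tst m φ).continuous.comp (hP.comp (continuous_id.prodMk continuous_const))
  -- A derivative need not pass to the limit in `A`, but its integrated form does, both sides being
  -- continuous in `A`. Differentiating again recovers the claim.
  have key : ∀ A : H n, ∀ t, tst m φ (P A t) =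
      tst m φ (P A 0) + ∫ τ in (0 : ℝ)..t, c * tst m (dS 1 φ) (S A τ) := by
    intro A t
    refine (toH_dense n).induction_on (p := fun A : H n => tst m φ (P A t) =
      tst m φ (P A 0) + ∫ τ in (0 : ℝ)..t, c * tst m (dS 1 φ) (S A τ)) A
      (isClosed_eq (hcP t) ((hcP 0).add ?_)) fun χ => ?_
    · exact intervalIntegral.continuous_parametric_intervalIntegral_of_continuous' hcS 0 t
    · rw [intervalIntegral.integral_eq_sub_of_hasDerivAt (fun τ _ => h χ τ)
        ((hcS.comp (continuous_const.prodMk continuous_id)).intervalIntegrable _ _)]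
      ring
  have hcA : Continuous (fun τ => c * tst m (dS 1 φ) (S A τ)) :=
    hcS.comp (continuous_const.prodMk continuous_id)
  have hd : HasDerivAt (fun t => tst m φ (P A 0) + ∫ τ in (0 : ℝ)..t, c * tst m (dS 1 φ) (S A τ))
      (c * tst m (dS 1 φ) (S A t)) t :=
    (intervalIntegral.integral_hasDerivAt_right (hcA.intervalIntegrable _ _)
      (hcA.stronglyMeasurableAtFilter _ _) hcA.continuousAt).const_add _
  exact hd.congr_of_eventuallyEq (Eventually.of_forall fun τ => key A τ)

lemma continuous_UH_shiftH {j : ℕ} (h : j + m ≤ n) :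
    Continuous (fun p : H n × ℝ => UH m p.2 (shiftH m j h p.1)) :=
  continuous_UH.comp (continuous_snd.prodMk ((shiftH m j h).continuous.comp continuous_fst))

lemma continuous_mulH [Fact (1 ≤ m)] {X : Type*} [TopologicalSpace X] {a b : X → H m}
    (ha : Continuous a) (hb : Continuous b) : Continuous (fun x => mulH m (a x) (b x)) :=
  ((mulH m).continuous.comp ha).clm_apply hb

/-- With `f = e^{it∂²} A''` and `g = e^{it∂²} A'`, `(i∂_t + ∂_s²)(f g) = ∂_s (f²)`. -/
lemma hasDerivAt_quad [Fact (1 ≤ m)] (A : H (m + 2)) (φ : 𝓢(ℝ, ℂ)) (t : ℝ) :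
    HasDerivAt (fun τ => tst m φ (UH m (-τ)
        (mulH m (UH m τ (shiftH m 2 (by omega) A)) (UH m τ (shiftH m 1 (by omega) A)))))
      (Complex.I * tst m (dS 1 φ) (UH m (-t)
        (mulH m (UH m t (shiftH m 2 (by omega) A)) (UH m t (shiftH m 2 (by omega) A))))) t := by
  refine hasDerivAt_tst_of_dense
    (P := fun A τ => UH m (-τ)
      (mulH m (UH m τ (shiftH m 2 (by omega) A)) (UH m τ (shiftH m 1 (by omega) A))))
    (S := fun A τ => UH m (-τ)
      (mulH m (UH m τ (shiftH m 2 (by omega) A)) (UH m τ (shiftH m 2 (by omega) A)))) ?_ ?_ φ ?_ A t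
  · exact continuous_UH.comp ((continuous_neg.comp continuous_snd).prodMk
      (continuous_mulH (continuous_UH_shiftH _) (continuous_UH_shiftH _)))
  · exact continuous_UH.comp ((continuous_neg.comp continuous_snd).prodMk
      (continuous_mulH (continuous_UH_shiftH _) (continuous_UH_shiftH _)))
  · intro χ t
    simpa only [shiftH_toH, UH_toH] using quad_schwartz χ φ t

/-- With `f = e^{it∂²} A''` and `g = e^{it∂²} A'`, `(i∂_t + ∂_s²)(f ḡ) = 2 ∂_s |f|²`. -/
lemma hasDerivAt_quad_conj [Fact (1 ≤ m)] (A : H (m + 2)) (φ : 𝓢(ℝ, ℂ)) (t : ℝ) :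
    HasDerivAt (fun τ => tst m φ (UH m (-τ)
        (mulH m (UH m τ (shiftH m 2 (by omega) A)) (cj m (UH m τ (shiftH m 1 (by omega) A))))))
      (2 * Complex.I * tst m (dS 1 φ) (UH m (-t)
        (mulH m (UH m t (shiftH m 2 (by omega) A))
          (cj m (UH m t (shiftH m 2 (by omega) A)))))) t := by
  refine hasDerivAt_tst_of_dense
    (P := fun A τ => UH m (-τ)
      (mulH m (UH m τ (shiftH m 2 (by omega) A)) (cj m (UH m τ (shiftH m 1 (by omega) A)))))
    (S := fun A τ => UH m (-τ)
      (mulH m (UH m τ (shiftH m 2 (by omega) A)) (cj m (UH m τ (shiftH m 2 (by omega) A))))) 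
    ?_ ?_ φ ?_ A t
  · exact continuous_UH.comp ((continuous_neg.comp continuous_snd).prodMk
      (continuous_mulH (continuous_UH_shiftH _) ((cj m).continuous.comp (continuous_UH_shiftH _))))
  · exact continuous_UH.comp ((continuous_neg.comp continuous_snd).prodMk
      (continuous_mulH (continuous_UH_shiftH _) ((cj m).continuous.comp (continuous_UH_shiftH _))))
  · intro χ t
    simpa only [shiftH_toH, UH_toH] using quad_conj_schwartz χ φ t

/-! ### Phases and integration by parts in time -/

/-- The phase `t^{iλ}`. -/
def ph (l t : ℝ) : ℂ := Complex.exp (Complex.I * (l * Real.log t : ℝ))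

lemma norm_ph (l t : ℝ) : ‖ph l t‖ = 1 := by
  rw [ph, mul_comm, Complex.norm_exp_ofReal_mul_I]

lemma ph_add (l l' t : ℝ) : ph (l + l') t = ph l t * ph l' t := by
  rw [ph, ph, ph, ← Complex.exp_add]; push_cast; ring_nf

lemma ph_zero (t : ℝ) : ph 0 t = 1 := by simp [ph]

lemma conj_ph (l t : ℝ) : (starRingEnd ℂ) (ph l t) = ph (-l) t := by
  rw [ph, ph, ← Complex.exp_conj]; simp

lemma hasDerivAt_ph (l : ℝ) {t : ℝ} (ht : 0 < t) :
    HasDerivAt (ph l) (Complex.I * l / t * ph l t) t := by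
  have h1 : HasDerivAt (fun t : ℝ => ((l * Real.log t : ℝ) : ℂ)) ((l * t⁻¹ : ℝ) : ℂ) t :=
    ((Real.hasDerivAt_log ht.ne').const_mul l).ofReal_comp
  refine (h1.const_mul Complex.I).cexp.congr_deriv ?_
  rw [ph]; push_cast; ring

lemma continuousOn_ph (l : ℝ) : ContinuousOn (ph l) (Ioi 0) := fun _ ht =>
  (hasDerivAt_ph l ht).continuousAt.continuousWithinAt

lemma hasDerivAt_ph_div (l : ℝ) {t : ℝ} (ht : 0 < t) :
    HasDerivAt (fun t => ph l t / t) ((Complex.I * l - 1) * ph l t / t ^ 2) t := by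
  have h0 : (t : ℂ) ≠ 0 := by exact_mod_cast ht.ne'
  refine ((hasDerivAt_ph l ht).div (HasDerivAt.ofReal_comp (hasDerivAt_id t)) h0).congr_deriv ?_
  simp only [id, Complex.ofReal_one]
  field_simp

lemma norm_ph_div (l : ℝ) {t : ℝ} (ht : 0 < t) : ‖ph l t / t‖ = t ^ (-1 : ℝ) := by
  rw [norm_div, norm_ph, Complex.norm_real, Real.norm_of_nonneg ht.le, Real.rpow_neg_one, one_div]

lemma norm_ph_div_deriv (l : ℝ) {t : ℝ} (ht : 0 < t) :
    ‖(Complex.I * l - 1) * ph l t / t ^ 2‖ ≤ (1 + |l|) * t ^ (-2 : ℝ) := by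
  have h : t ^ (-2 : ℝ) = (t ^ 2)⁻¹ := by
    rw [Real.rpow_neg ht.le]; norm_num
  rw [norm_div, norm_mul, norm_ph, norm_pow, Complex.norm_real, Real.norm_of_nonneg ht.le, h,
    div_eq_mul_inv, mul_one]
  gcongr
  refine (norm_sub_le _ _).trans (le_of_eq ?_)
  simp [add_comm]

lemma continuousOn_ph_div_deriv (l : ℝ) :
    ContinuousOn (fun t : ℝ => (Complex.I * l - 1) * ph l t / (t : ℂ) ^ 2) (Ioi 0) := by
  refine ContinuousOn.div (continuousOn_const.mul (continuousOn_ph l)) (by fun_prop) fun t ht => ?_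
  have : (t : ℂ) ≠ 0 := by exact_mod_cast (ne_of_gt ht)
  positivity

/-- The remainder in the integration by parts of `∫_t^∞ τ^{iλ-1} P'(τ) dτ`. -/
def byParts (l : ℝ) (P : ℝ → H m) (t : ℝ) : H m :=
  (ph l t / t) • P t + ∫ τ in Ioi t, ((Complex.I * l - 1) * ph l τ / (τ : ℂ) ^ 2) • P τ

lemma continuousOn_byParts_integrand (l : ℝ) {P : ℝ → H m} (hP : Continuous P) :
    ContinuousOn (fun τ : ℝ => ((Complex.I * l - 1) * ph l τ / (τ : ℂ) ^ 2) • P τ) (Ioi 0) :=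
  (continuousOn_ph_div_deriv l).smul hP.continuousOn

lemma norm_byParts_integrand_le (l : ℝ) {P : ℝ → H m} {M : ℝ} (hM : ∀ t, ‖P t‖ ≤ M) {τ : ℝ}
    (hτ : 0 < τ) :
    ‖((Complex.I * l - 1) * ph l τ / (τ : ℂ) ^ 2) • P τ‖ ≤ ((1 + |l|) * M) * τ ^ (-2 : ℝ) := by
  rw [norm_smul]
  calc _ ≤ ((1 + |l|) * τ ^ (-2 : ℝ)) * M := by
        gcongr
        · exact norm_ph_div_deriv l hτ
        · exact hM τ
    _ = _ := by ring

lemma norm_byParts_le (l : ℝ) {P : ℝ → H m} {M : ℝ} (hM : ∀ t, ‖P t‖ ≤ M) {t : ℝ}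
    (ht : 0 < t) : ‖byParts l P t‖ ≤ (2 + |l|) * M * t ^ (-1 : ℝ) := by
  refine (norm_add_le _ _).trans ?_
  have h1 : ‖(ph l t / t) • P t‖ ≤ t ^ (-1 : ℝ) * M := by
    rw [norm_smul, norm_ph_div l ht]
    gcongr
    exact hM t
  have h2 := norm_tail_le (p := 2) ht le_rfl (by norm_num)
    (fun τ hτ => norm_byParts_integrand_le l hM (ht.trans_le hτ))
  norm_num at h2 h1 ⊢
  linarith

/-- The evolution of `byParts`, in a weak form. -/
lemma hasDerivAt_clm_byParts {F : Type*} [NormedAddCommGroup F] [NormedSpace ℂ F] (T : H m →L[ℂ] F)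
    (l : ℝ) {P : ℝ → H m} (hP : Continuous P) {M : ℝ} (hM : ∀ t, ‖P t‖ ≤ M) {t : ℝ} (ht : 0 < t)
    {D : F} (hD : HasDerivAt (fun t => T (P t)) D t) :
    HasDerivAt (fun t => T (byParts l P t)) ((ph l t / t) • D) t := by
  -- The derivative of the tail cancels that of the prefactor `ph l t / t`, so only `D` survives.
  -- Differentiability of `P` is needed only after applying `T`.
  have h1 := hasDerivAt_tail (p := 2) ht le_rfl (by norm_num)
    (continuousOn_byParts_integrand l hP)
    (fun τ hτ => norm_byParts_integrand_le l hM (ht.trans_le hτ))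
  have h2 := (T.restrictScalars ℝ).hasFDerivAt.comp_hasDerivAt t h1
  have h3 := (hasDerivAt_ph_div l ht).smul hD
  have h4 := h3.add h2
  have e : (fun t => T (byParts l P t)) = (fun t => (ph l t / t) • T (P t)) +
      (T.restrictScalars ℝ) ∘ fun t => ∫ τ in Ioi t,
        ((Complex.I * l - 1) * ph l τ / (τ : ℂ) ^ 2) • P τ := by
    funext t
    simp [byParts]
  rw [e]
  refine h4.congr_deriv ?_
  change _ + T (-_) = _
  rw [map_neg, map_smul]
  abel

lemma eq_zero_of_hasDerivAt_zero {F : Type*} [NormedAddCommGroup F] [NormedSpace ℝ F] {g : ℝ → F}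
    {t : ℝ} (h : ∀ τ, t ≤ τ → HasDerivAt g 0 τ) (hg : Tendsto g atTop (𝓝 0)) : g t = 0 := by
  have hc : ∀ T, t ≤ T → g T = g t := fun T hT =>
    constant_of_has_deriv_right_zero (f := g) (a := t) (b := T)
      (fun τ hτ => (h τ hτ.1).continuousAt.continuousWithinAt)
      (fun τ hτ => (h τ hτ.1).hasDerivWithinAt) T ⟨hT, le_rfl⟩
  refine tendsto_nhds_unique (tendsto_const_nhds.congr' ?_) hg
  filter_upwards [eventually_ge_atTop t] with T hT
  exact (hc T hT).symm

lemma tendsto_zero_of_norm_le_rpow {F : Type*} [NormedAddCommGroup F] {g : ℝ → F} {t₀ M p : ℝ}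
    (hp : p < 0) (h : ∀ t, t₀ ≤ t → ‖g t‖ ≤ M * t ^ p) : Tendsto g atTop (𝓝 0) := by
  refine squeeze_zero_norm' (a := fun t => M * t ^ p) ?_ ?_
  · filter_upwards [eventually_ge_atTop t₀] with t ht using h t ht
  · have := (tendsto_rpow_neg_atTop (y := -p) (by linarith)).const_mul M
    simpa using this

/-- If `P' = c ∂_s S` weakly, then the derivatives of `∫_t^∞ τ^{iλ-1} S(τ) dτ` decay like `1/t`. -/
lemma norm_cp_succ_tail_le {P S : ℝ → H m} (hP : Continuous P) (hS : Continuous S) {c : ℂ}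
    {l M M' t₀ : ℝ} (ht₀ : 0 < t₀)
    (h : ∀ φ t, HasDerivAt (fun τ => tst m φ (P τ)) (-(c * tst m (dS 1 φ) (S t))) t)
    (hM : ∀ t, ‖P t‖ ≤ M) (hM' : ∀ t, t₀ ≤ t → ‖S t‖ ≤ M' * t ^ (-(1 / 2) : ℝ)) {k : ℕ}
    (hk : k + 1 ≤ m) {t : ℝ} (ht : t₀ ≤ t) :
    ‖c‖ * ‖cp (k + 1) (∫ τ in Ioi t, (ph l τ / τ) • S τ)‖ ≤ (2 + |l|) * M * t ^ (-1 : ℝ) := by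
  have hpos : ∀ {τ}, t₀ ≤ τ → 0 < τ := fun hτ => ht₀.trans_le hτ
  have hSb : ∀ τ, t₀ ≤ τ → ‖(ph l τ / τ) • S τ‖ ≤ M' * τ ^ (-(3 / 2) : ℝ) := by
    intro τ hτ
    rw [norm_smul, norm_ph_div l (hpos hτ)]
    calc τ ^ (-1 : ℝ) * ‖S τ‖ ≤ τ ^ (-1 : ℝ) * (M' * τ ^ (-(1 / 2) : ℝ)) := by
          have := hpos hτ
          gcongr; exact hM' τ hτ
      _ = M' * (τ ^ (-1 : ℝ) * τ ^ (-(1 / 2) : ℝ)) := by ring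
      _ = _ := by rw [← Real.rpow_add (hpos hτ)]; norm_num
  have hSc : ContinuousOn (fun τ : ℝ => (ph l τ / τ) • S τ) (Ioi 0) := by
    have h1 : ContinuousOn (fun τ : ℝ => ph l τ / τ) (Ioi 0) := fun τ hτ =>
      (hasDerivAt_ph_div l hτ).continuousAt.continuousWithinAt
    exact h1.smul hS.continuousOn
  set D : ℝ → H m := fun t => ∫ τ in Ioi t, (ph l τ / τ) • S τ with hD
  -- Both terms have the same time derivative and tend to zero at infinity. This is the integration
  -- by parts, carried out weakly since `∂_s S` need not lie in `H^m`.
  have key : ∀ φ, c * tst m (dS 1 φ) (D t) - tst m φ (byParts l P t) = 0 := by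
    intro φ
    refine eq_zero_of_hasDerivAt_zero
      (g := fun t => c * tst m (dS 1 φ) (D t) - tst m φ (byParts l P t)) (fun τ hτ => ?_) ?_
    · have h1 := hasDerivAt_tail (p := 3 / 2) ht₀ (ht.trans hτ) (by norm_num) hSc hSb
      have h2 := (((tst m (dS 1 φ)).restrictScalars ℝ).hasFDerivAt.comp_hasDerivAt τ h1).const_mul c
      have h3 := hasDerivAt_clm_byParts (tst m φ) l hP hM (hpos (ht.trans hτ)) (h φ τ)
      refine (h2.sub h3).congr_deriv ?_
      change c * tst m (dS 1 φ) (-_) - _ = _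
      rw [map_neg, map_smul, smul_eq_mul, smul_eq_mul]
      ring
    · have h1 : Tendsto D atTop (𝓝 0) := by
        refine tendsto_zero_of_norm_le_rpow (t₀ := t₀)
          (M := M' / (3 / 2 - 1)) (p := 1 - 3 / 2) (by norm_num) fun t ht => ?_
        exact norm_tail_le ht₀ ht (by norm_num) hSb
      have h2 : Tendsto (byParts l P) atTop (𝓝 0) :=
        tendsto_zero_of_norm_le_rpow (t₀ := t₀) (p := -1) (by norm_num) fun t ht =>
          norm_byParts_le l hM (hpos ht)
      have h3 := (((tst m (dS 1 φ)).continuous.tendsto 0).comp h1).const_mul c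
      have h4 := ((tst m φ).continuous.tendsto 0).comp h2
      simpa using h3.sub h4
  -- Testing with `φ^{(k)}` trades the derivative of order `k + 1` of the tail for the derivative of
  -- order `k` of the boundary terms, which are `O(1/t)` in `H^m`.
  have heq : c • cp (k + 1) (D t) = - cp k (byParts l P t) := by
    refine eq_of_pair_sL fun φ => ?_
    have := sub_eq_zero.1 (key (dS k φ))
    rw [tst_apply, tst_apply, dS_dS, add_comm 1 k] at this
    rw [map_smul, map_neg, smul_apply, neg_apply, pair_cp hk, pair_cp (k := k) (by omega), ← this,
      smul_eq_mul, pow_succ]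
    ring
  rw [← norm_smul, heq, norm_neg]
  exact (norm_cp_le _ _).trans (norm_byParts_le l hM (hpos ht))

/-! ### The fixed point argument -/

/-- Picard iteration for `y(t) = E(t) - ∫_t^∞ N(τ, y(τ)) dτ` in a space of decaying functions. -/
lemma exists_decaying_solution {t₀ δ : ℝ} (ht₀ : 0 < t₀) (hδ : 0 ≤ δ) {E : ℝ → H m}
    (hE : ContinuousOn E (Ici t₀)) (hE0 : ∀ t, t₀ ≤ t → ‖E t‖ ≤ δ / 2 * t ^ (-(1 / 2) : ℝ))
    (hEk : ∀ k, 1 ≤ k → k ≤ m → ∀ t, t₀ ≤ t → ‖cp k (E t)‖ ≤ δ / 2 * t ^ (-1 : ℝ))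
    {N : ℝ → H m → H m} (hN : ContinuousOn (Function.uncurry N) (Ioi 0 ×ˢ univ))
    (hN0 : ∀ t, N t 0 = 0) {L : ℝ → ℝ}
    (hL : ∀ ρ, 0 ≤ ρ → ∀ t, t₀ ≤ t → ∀ y y', ‖y‖ ≤ ρ * t ^ (-(1 / 2) : ℝ) →
      ‖y'‖ ≤ ρ * t ^ (-(1 / 2) : ℝ) → ‖N t y - N t y'‖ ≤ L ρ * t ^ (-1 : ℝ) * ‖y - y'‖)
    (hL0 : |L δ| ≤ 1 / 8)
    (hNk : ∀ t, t₀ ≤ t → ∀ y, ‖y‖ ≤ δ * t ^ (-(1 / 2) : ℝ) →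
      ∀ k, 1 ≤ k → k ≤ m → ‖cp k y‖ ≤ δ * t ^ (-1 : ℝ) → ‖cp k (N t y)‖ ≤ δ / 2 * t ^ (-2 : ℝ)) :
    ∃ y : ℝ → H m, ContinuousOn y (Ioi 0) ∧ (∀ t, t₀ ≤ t → ‖y t‖ ≤ δ * t ^ (-(1 / 2) : ℝ)) ∧
      (∀ k, 1 ≤ k → k ≤ m → ∀ t, t₀ ≤ t → ‖cp k (y t)‖ ≤ δ * t ^ (-1 : ℝ)) ∧
      ∀ t, t₀ ≤ t → y t = E t - ∫ τ in Ioi t, N τ (y τ) := by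
  have hpos : ∀ {τ}, t₀ ≤ τ → 0 < τ := fun hτ => ht₀.trans_le hτ
  -- The unknown is rescaled to `R = t^{1/2}y`, so that the rate `t^{-1/2}` becomes boundedness.
  set Y : (BoundedContinuousFunction ℝ (H m)) → ℝ → H m := fun R τ => (τ ^ (-(1 / 2) : ℝ)) • R τ
    with hY
  have hYc : ∀ R, ContinuousOn (Y R) (Ioi 0) := fun R =>
by
    have h1 : ContinuousOn (fun τ : ℝ => τ ^ (-(1 / 2) : ℝ)) (Ioi 0) := fun τ hτ =>
      (Real.continuousAt_rpow_const τ _ (Or.inl (ne_of_gt hτ))).continuousWithinAt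
    exact h1.smul R.continuous.continuousOn
  have hYn : ∀ R τ, t₀ ≤ τ → ∀ ρ, ‖R‖ ≤ ρ → ‖Y R τ‖ ≤ ρ * τ ^ (-(1 / 2) : ℝ) := by
    intro R τ hτ ρ hρ
    have := Real.rpow_nonneg (hpos hτ).le (-(1 / 2) : ℝ)
    rw [hY]
    simp only
    rw [norm_smul, Real.norm_of_nonneg this, mul_comm]
    gcongr
    exact (R.norm_coe_le_norm τ).trans hρ
  have hNc : ∀ R, ContinuousOn (fun τ => N τ (Y R τ)) (Ioi 0) := fun R =>
    hN.comp (continuousOn_id.prodMk (hYc R)) fun τ hτ => ⟨hτ, mem_univ _⟩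
  have hrp : ∀ τ : ℝ, t₀ ≤ τ → τ ^ (-1 : ℝ) * τ ^ (-(1 / 2) : ℝ) = τ ^ (-(3 / 2) : ℝ) := by
    intro τ hτ
    rw [← Real.rpow_add (hpos hτ)]; norm_num
  have hdiff : ∀ ρ, 0 ≤ ρ → ∀ R R' : BoundedContinuousFunction ℝ (H m), ‖R‖ ≤ ρ → ‖R'‖ ≤ ρ →
      ∀ τ, t₀ ≤ τ → ‖N τ (Y R τ) - N τ (Y R' τ)‖ ≤ (|L ρ| * ‖R - R'‖) * τ ^ (-(3 / 2) : ℝ) := by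
    intro ρ hρ R R' hR hR' τ hτ
    have h1 := hL ρ hρ τ hτ _ _ (hYn R τ hτ ρ hR) (hYn R' τ hτ ρ hR')
    have h2 : Y R τ - Y R' τ = Y (R - R') τ := by simp [hY, smul_sub]
    have h3 := hYn (R - R') τ hτ _ le_rfl
    rw [h2] at h1
    have := Real.rpow_nonneg (hpos hτ).le (-1 : ℝ)
    calc _ ≤ L ρ * τ ^ (-1 : ℝ) * ‖Y (R - R') τ‖ := h1
      _ ≤ |L ρ| * τ ^ (-1 : ℝ) * (‖R - R'‖ * τ ^ (-(1 / 2) : ℝ)) := by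
          gcongr
          exact le_abs_self _
      _ = |L ρ| * ‖R - R'‖ * (τ ^ (-1 : ℝ) * τ ^ (-(1 / 2) : ℝ)) := by ring
      _ = _ := by rw [hrp τ hτ]
  have hNb : ∀ ρ, 0 ≤ ρ → ∀ R : BoundedContinuousFunction ℝ (H m), ‖R‖ ≤ ρ →
      ∀ τ, t₀ ≤ τ → ‖N τ (Y R τ)‖ ≤ (|L ρ| * ‖R‖) * τ ^ (-(3 / 2) : ℝ) := by
    intro ρ hρ R hR τ hτ
    have := hdiff ρ hρ R 0 hR (by simpa using hρ) τ hτ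
    have h0 : Y 0 τ = 0 := by simp [hY]
    rwa [h0, hN0, sub_zero, sub_zero] at this
  set D : BoundedContinuousFunction ℝ (H m) → ℝ → H m := fun R t =>
    E t - ∫ τ in Ioi t, N τ (Y R τ) with hD
  have hDc : ∀ R, ContinuousOn (D R) (Ici t₀) := fun R => hE.sub fun t ht =>
    (hasDerivAt_tail (p := 3 / 2) ht₀ ht (by norm_num) (hNc R)
      (hNb _ (norm_nonneg R) R le_rfl)).continuousAt.continuousWithinAt
  have hDn : ∀ ρ, 0 ≤ ρ → ∀ R : BoundedContinuousFunction ℝ (H m), ‖R‖ ≤ ρ → ∀ t, t₀ ≤ t →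
      ‖D R t‖ ≤ (δ / 2 + 2 * (|L ρ| * ‖R‖)) * t ^ (-(1 / 2) : ℝ) := by
    intro ρ hρ R hR t ht
    have h2 := norm_tail_le (p := 3 / 2) ht₀ ht (by norm_num) (hNb ρ hρ R hR)
    have h3 := (norm_sub_le (E t) (∫ τ in Ioi t, N τ (Y R τ))).trans (add_le_add (hE0 t ht) h2)
    refine h3.trans (le_of_eq ?_)
    norm_num
    ring
  have hroot : ∀ t, t₀ ≤ t → ∀ (y : H m) (C : ℝ), ‖y‖ ≤ C * t ^ (-(1 / 2) : ℝ) →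
      ‖(t ^ (1 / 2 : ℝ)) • y‖ ≤ C := by
    intro t ht y C h
    rw [norm_smul, Real.norm_of_nonneg (Real.rpow_nonneg (hpos ht).le _)]
    calc _ ≤ t ^ (1 / 2 : ℝ) * (C * t ^ (-(1 / 2) : ℝ)) := by
          have := Real.rpow_nonneg (hpos ht).le (1 / 2 : ℝ)
          gcongr
      _ = C * (t ^ (1 / 2 : ℝ) * t ^ (-(1 / 2) : ℝ)) := by ring
      _ = C := by rw [← Real.rpow_add (hpos ht)]; simp
  -- Freezing time below `t₀` extends the curve to the whole line. The map is defined on all bounded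
  -- `R`, which is why `hL` is assumed for every radius and not only for `δ`.
  set Φ : BoundedContinuousFunction ℝ (H m) → BoundedContinuousFunction ℝ (H m) := fun R =>
    BoundedContinuousFunction.ofNormedAddCommGroup
      (fun t => ((max t t₀) ^ (1 / 2 : ℝ)) • D R (max t t₀))
      (((continuous_id.max continuous_const).rpow_const fun t => Or.inr (by norm_num)).smul
        ((hDc R).comp_continuous (continuous_id.max continuous_const) fun t => le_max_right t t₀))
      (δ / 2 + 2 * (|L ‖R‖| * ‖R‖))
      (fun t => hroot _ (le_max_right t t₀) _ _
        (hDn _ (norm_nonneg R) R le_rfl _ (le_max_right t t₀))) with hΦ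
  have hΦa : ∀ R t, Φ R t = ((max t t₀) ^ (1 / 2 : ℝ)) • D R (max t t₀) := fun R t => rfl
  have hYΦ : ∀ R t, t₀ ≤ t → Y (Φ R) t = D R t := by
    intro R t ht
    simp only [hY, hΦa, max_eq_left ht]
    rw [smul_smul, ← Real.rpow_add (hpos ht)]
    simp
  -- The faster rate of the derivatives is kept as a closed condition and is not part of the norm.
  -- The contraction then only concerns the rate `t^{-1/2}`, with no Lipschitz estimate at rate
  -- `t^{-1}`.
  set S : Set (BoundedContinuousFunction ℝ (H m)) := {R | ‖R‖ ≤ δ ∧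
    ∀ k, 1 ≤ k → k ≤ m → ∀ t, t₀ ≤ t → ‖cp k (R t)‖ ≤ δ * t ^ (-(1 / 2) : ℝ)} with hS
  have hSc : IsClosed S := by
    have hev : ∀ t, Continuous fun R : BoundedContinuousFunction ℝ (H m) => R t := fun t =>
      (BoundedContinuousFunction.evalCLM ℝ t).continuous
    have e : S = {R | ‖R‖ ≤ δ} ∩ ⋂ (k : ℕ) (_ : 1 ≤ k) (_ : k ≤ m) (t : ℝ) (_ : t₀ ≤ t),
        {R | ‖cp k (R t)‖ ≤ δ * t ^ (-(1 / 2) : ℝ)} := by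
      ext R; simp [hS]
    rw [e]
    refine (isClosed_le continuous_norm continuous_const).inter ?_
    refine isClosed_iInter fun k => isClosed_iInter fun _ => isClosed_iInter fun _ =>
      isClosed_iInter fun t => isClosed_iInter fun _ => ?_
    exact isClosed_le (((cp k).continuous.comp (hev t)).norm) continuous_const
  have hYk : ∀ R ∈ S, ∀ k, 1 ≤ k → k ≤ m → ∀ t, t₀ ≤ t → ‖cp k (Y R t)‖ ≤ δ * t ^ (-1 : ℝ) := by
    intro R hR k hk1 hk2 t ht
    have h1 := hR.2 k hk1 hk2 t ht
    have h2 : cp k (Y R t) = (t ^ (-(1 / 2) : ℝ)) • cp k (R t) :=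
      ((cp k).restrictScalars ℝ).map_smul _ _
    have h3 := Real.rpow_nonneg (hpos ht).le (-(1 / 2) : ℝ)
    rw [h2, norm_smul, Real.norm_of_nonneg h3]
    calc _ ≤ t ^ (-(1 / 2) : ℝ) * (δ * t ^ (-(1 / 2) : ℝ)) := by gcongr
      _ = δ * (t ^ (-(1 / 2) : ℝ) * t ^ (-(1 / 2) : ℝ)) := by ring
      _ = _ := by rw [← Real.rpow_add (hpos ht)]; norm_num
  have hDk : ∀ R ∈ S, ∀ k, 1 ≤ k → k ≤ m → ∀ t, t₀ ≤ t → ‖cp k (D R t)‖ ≤ δ * t ^ (-1 : ℝ) := by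
    intro R hR k hk1 hk2 t ht
    have hi := integrableOn_tail (p := 3 / 2) ht₀ ht (by norm_num) (hNc R)
      (hNb _ (norm_nonneg R) R le_rfl)
    have h1 : cp k (D R t) = cp k (E t) - ∫ τ in Ioi t, cp k (N τ (Y R τ)) := by
      rw [hD, map_sub, ContinuousLinearMap.integral_comp_comm _ hi]
    have h2 := norm_tail_le (p := 2) (g := fun τ => cp k (N τ (Y R τ))) ht₀ ht (by norm_num)
      fun τ hτ => hNk τ hτ _ (hYn R τ hτ δ hR.1) k hk1 hk2 (hYk R hR k hk1 hk2 τ hτ)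
    rw [h1]
    refine (norm_sub_le _ _).trans ((add_le_add (hEk k hk1 hk2 t ht) h2).trans (le_of_eq ?_))
    norm_num
    ring
  have hmaps : MapsTo Φ S S := by
    intro R hR
    refine ⟨?_, fun k hk1 hk2 t ht => ?_⟩
    · refine (BoundedContinuousFunction.norm_le hδ).2 fun t => ?_
      refine hroot _ (le_max_right t t₀) _ _ ((hDn δ hδ R hR.1 _ (le_max_right t t₀)).trans ?_)
      have h1 := Real.rpow_nonneg (hpos (le_max_right t t₀)).le (-(1 / 2) : ℝ)
      gcongr
      -- The tail doubles the Lipschitz constant, so the image has norm at most `δ/2 + 2 · δ/8 ≤ δ`.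
      have h2 : |L δ| * ‖R‖ ≤ 1 / 8 * δ := by gcongr; exact hR.1
      linarith
    · have h1 := hDk R hR k hk1 hk2 t ht
      have h2 : cp k (Φ R t) = (t ^ (1 / 2 : ℝ)) • cp k (D R t) := by
        rw [hΦa, max_eq_left ht]
        exact ((cp k).restrictScalars ℝ).map_smul _ _
      have h3 := Real.rpow_nonneg (hpos ht).le (1 / 2 : ℝ)
      rw [h2, norm_smul, Real.norm_of_nonneg h3]
      calc _ ≤ t ^ (1 / 2 : ℝ) * (δ * t ^ (-1 : ℝ)) := by gcongr
        _ = δ * (t ^ (1 / 2 : ℝ) * t ^ (-1 : ℝ)) := by ring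
        _ = _ := by rw [← Real.rpow_add (hpos ht)]; norm_num
  -- The same doubling gives the constant `2 · 1/8 ≤ 1/2`.
  have hcontr : ContractingWith (1 / 2) (hmaps.restrict Φ S S) := by
    refine ⟨by norm_num, LipschitzWith.of_dist_le_mul fun R R' => ?_⟩
    rw [Subtype.dist_eq, Subtype.dist_eq, dist_eq_norm, dist_eq_norm]
    change ‖Φ R - Φ R'‖ ≤ _
    refine (BoundedContinuousFunction.norm_le (by positivity)).2 fun t => ?_
    rw [BoundedContinuousFunction.sub_apply, hΦa, hΦa, ← smul_sub]
    have ht := le_max_right t t₀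
    refine hroot _ ht _ _ ?_
    have e : D R (max t t₀) - D R' (max t t₀) =
        - ∫ τ in Ioi (max t t₀), (N τ (Y R τ) - N τ (Y R' τ)) := by
      rw [integral_sub]
      · simp only [hD]; abel
      · exact integrableOn_tail (p := 3 / 2) ht₀ ht (by norm_num) (hNc R)
          (hNb _ (norm_nonneg _) R le_rfl)
      · exact integrableOn_tail (p := 3 / 2) ht₀ ht (by norm_num) (hNc R')
          (hNb _ (norm_nonneg _) R' le_rfl)
    rw [e, norm_neg]
    refine (norm_tail_le (p := 3 / 2) ht₀ ht (by norm_num)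
      (hdiff δ hδ R R' R.2.1 R'.2.1)).trans ?_
    have h1 := Real.rpow_nonneg (hpos ht).le (-(1 / 2) : ℝ)
    have h2 : |L δ| * ‖(R : BoundedContinuousFunction ℝ (H m)) - R'‖ ≤
        1 / 8 * ‖(R : BoundedContinuousFunction ℝ (H m)) - R'‖ := by gcongr
    norm_num at h1 h2 ⊢
    gcongr
    linarith [norm_nonneg ((R : BoundedContinuousFunction ℝ (H m)) - R')]
  have h0S : (0 : BoundedContinuousFunction ℝ (H m)) ∈ S := by
    refine ⟨by simpa using hδ, fun k _ _ t ht => ?_⟩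
    have := Real.rpow_nonneg (hpos ht).le (-(1 / 2) : ℝ)
    simp only [BoundedContinuousFunction.coe_zero, Pi.zero_apply, map_zero, norm_zero]
    positivity
  obtain ⟨R, hRS, hfix, -⟩ := hcontr.exists_fixedPoint' hSc.isComplete hmaps h0S (edist_ne_top _ _)
  have hYD : ∀ t, t₀ ≤ t → Y R t = D R t := fun t ht => by
    rw [← hYΦ R t ht, hfix.eq]
  exact ⟨Y R, hYc R, fun t ht => hYn R t ht δ hRS.1, hYk R hRS, fun t ht => hYD t ht⟩

/-! ### Lipschitz bounds for the quadratic and cubic terms -/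

lemma mulH_left_comm [Fact (1 ≤ m)] (F G K : H m) :
    mulH m F (mulH m G K) = mulH m G (mulH m F K) := by
  refine H_ext (Lp.ext ?_)
  filter_upwards [mulH_ae F (mulH m G K), mulH_ae G (mulH m F K), mulH_ae G K, mulH_ae F K]
    with x h1 h2 h3 h4
  rw [h1, h2, h3, h4]; ring

/-- The part `2a|w|² + a w² + |w|² w` of the nonlinearity. -/
def Bn [Fact (1 ≤ m)] (a : ℝ) (w : H m) : H m :=
  (2 * a : ℂ) • mulH m w (cj m w) + (a : ℂ) • mulH m w w + mulH m w (mulH m w (cj m w))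

lemma continuous_Bn [Fact (1 ≤ m)] (a : ℝ) : Continuous (Bn (m := m) a) := by
  have h1 : Continuous (fun w : H m => mulH m w (cj m w)) :=
    continuous_mulH continuous_id (cj m).continuous
  have h2 : Continuous (fun w : H m => mulH m w w) := continuous_mulH continuous_id continuous_id
  have h3 : Continuous (fun w : H m => mulH m w (mulH m w (cj m w))) :=
    continuous_mulH continuous_id h1
  unfold Bn
  exact ((h1.const_smul (2 * a : ℂ)).add (h2.const_smul (a : ℂ))).add h3

lemma norm_mulH_apply_le_of_le [Fact (1 ≤ m)] {w : H m} {μ : ℝ} (h : ‖mulH m w‖ ≤ μ) (d : H m) :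
    ‖mulH m w d‖ ≤ μ * ‖d‖ := (mulH m w).le_of_opNorm_le h d

/-- Every difference is expanded so that `w - w'` (or its conjugate) is one factor and all others
act as multiplication operators. Only the operator norm `μ` enters; for the profile it decays like
`t^{-1/2}`, while the `H^m` norm does not. -/
lemma norm_Bn_sub_le [Fact (1 ≤ m)] (a : ℝ) {w w' : H m} {μ : ℝ} (h : ‖mulH m w‖ ≤ μ)
    (h' : ‖mulH m w'‖ ≤ μ) :
    ‖Bn a w - Bn a w'‖ ≤ (6 * |a| * μ + 3 * μ ^ 2) * ‖w - w'‖ := by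
  have hμ : 0 ≤ μ := (norm_nonneg _).trans h
  have hc' : ‖mulH m (cj m w')‖ ≤ μ := (norm_mulH_cj w').trans h'
  obtain ⟨d, rfl⟩ : ∃ d, w = w' + d := ⟨w - w', by abel⟩
  set w := w' + d with hw
  have hd : w - w' = d := by rw [hw]; abel
  rw [hd]
  have e1 : mulH m w (cj m w) - mulH m w' (cj m w') = mulH m w (cj m d) + mulH m (cj m w') d := by
    rw [mulH_comm (cj m w') d, ← hd]
    simp only [map_sub, sub_apply]
    abel
  have e2 : mulH m w w - mulH m w' w' = mulH m w d + mulH m w' d := by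
    rw [mulH_comm w' d, ← hd]
    simp only [map_sub, sub_apply]
    abel
  have n1 : ‖mulH m w (cj m w) - mulH m w' (cj m w')‖ ≤ 2 * μ * ‖d‖ := by
    rw [e1]
    have h1 := norm_mulH_apply_le_of_le h (cj m d)
    have h2 := norm_mulH_apply_le_of_le hc' d
    rw [(cj m).norm_map] at h1
    linarith [norm_add_le (mulH m w (cj m d)) (mulH m (cj m w') d)]
  have n2 : ‖mulH m w w - mulH m w' w'‖ ≤ 2 * μ * ‖d‖ := by
    rw [e2]
    have h1 := norm_mulH_apply_le_of_le h d
    have h2 := norm_mulH_apply_le_of_le h' d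
    linarith [norm_add_le (mulH m w d) (mulH m w' d)]
  have n3 : ‖mulH m w (mulH m w (cj m w)) - mulH m w' (mulH m w' (cj m w'))‖ ≤
      3 * μ ^ 2 * ‖d‖ := by
    have e3 : mulH m w (mulH m w (cj m w)) - mulH m w' (mulH m w' (cj m w')) =
        mulH m w (mulH m w (cj m w) - mulH m w' (cj m w')) +
          mulH m w' (mulH m (cj m w') d) := by
      rw [mulH_comm (cj m w') d, mulH_left_comm w' d, ← hd]
      simp only [map_sub, sub_apply]
      abel
    rw [e3]
    have h1 := norm_mulH_apply_le_of_le h (mulH m w (cj m w) - mulH m w' (cj m w'))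
    have h2 := norm_mulH_apply_le_of_le h' (mulH m (cj m w') d)
    have h3 := norm_mulH_apply_le_of_le hc' d
    have h4 := norm_add_le (mulH m w (mulH m w (cj m w) - mulH m w' (cj m w')))
      (mulH m w' (mulH m (cj m w') d))
    have h5 := mul_le_mul_of_nonneg_left n1 hμ
    have h6 := mul_le_mul_of_nonneg_left h3 hμ
    linarith
  have e4 : Bn a w - Bn a w' = (2 * a : ℂ) • (mulH m w (cj m w) - mulH m w' (cj m w')) +
      (a : ℂ) • (mulH m w w - mulH m w' w') +
      (mulH m w (mulH m w (cj m w)) - mulH m w' (mulH m w' (cj m w'))) := by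
    simp only [Bn, smul_sub]; abel
  rw [e4]
  refine (norm_add₃_le).trans ?_
  rw [norm_smul, norm_smul, norm_mul, Complex.norm_real, Real.norm_eq_abs, Complex.norm_ofNat]
  have h1 := mul_le_mul_of_nonneg_left n1 (abs_nonneg a)
  have h2 := mul_le_mul_of_nonneg_left n2 (abs_nonneg a)
  linarith

/-! ### The profile and the terms that it generates -/

/-- The free evolution of the second derivative of `A`. -/
def fr (A : H (m + 2)) (t : ℝ) : H m := UH m t (shiftH m 2 (by omega) A)

/-- The profile `e^{iσa² log t} e^{it∂²} A''`. -/
def prof (σ a : ℝ) (A : H (m + 2)) (t : ℝ) : H m := ph (σ * a ^ 2) t • fr A t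

lemma continuous_fr (A : H (m + 2)) : Continuous (fr A) :=
  continuous_UH.comp (continuous_id.prodMk continuous_const)

lemma continuousOn_prof (σ a : ℝ) (A : H (m + 2)) : ContinuousOn (prof σ a A) (Ioi 0) :=
  (continuousOn_ph _).smul (continuous_fr A).continuousOn

lemma norm_fr_le (A : H (m + 2)) (t : ℝ) : ‖fr A t‖ ≤ ‖A‖ := by
  rw [fr, LinearIsometry.norm_map]; exact norm_shiftH_le _ A

lemma norm_mulH_prof [Fact (1 ≤ m)] (σ a : ℝ) (A : H (m + 2)) (t : ℝ) :
    ‖mulH m (prof σ a A t)‖ = ‖mulH m (fr A t)‖ := by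
  rw [prof, map_smul, norm_smul, norm_ph, one_mul]

lemma cj_prof (σ a : ℝ) (A : H (m + 2)) (t : ℝ) :
    cj m (prof σ a A t) = ph (-(σ * a ^ 2)) t • cj m (fr A t) := by
  rw [prof, cj_smul, conj_ph]

lemma mulH_prof_cj [Fact (1 ≤ m)] (σ a : ℝ) (A : H (m + 2)) (t : ℝ) :
    mulH m (prof σ a A t) (cj m (prof σ a A t)) = mulH m (fr A t) (cj m (fr A t)) := by
  rw [cj_prof, prof, map_smul, map_smul, smul_apply, smul_smul, ← ph_add, neg_add_cancel, ph_zero,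
    one_smul]

lemma mulH_prof_prof [Fact (1 ≤ m)] (σ a : ℝ) (A : H (m + 2)) (t : ℝ) :
    mulH m (prof σ a A t) (prof σ a A t) = ph (2 * (σ * a ^ 2)) t • mulH m (fr A t) (fr A t) := by
  rw [prof, map_smul, map_smul, smul_apply, smul_smul, ← ph_add, two_mul]

lemma cj_shiftH {j : ℕ} (h : j + m ≤ n) (A : H n) : cj m (shiftH m j h A) = shiftH m j h (cj n A) :=
  H_ext (by rw [cp_cj (Nat.zero_le m), cp_shiftH h (Nat.zero_le m), cp_shiftH h (Nat.zero_le m),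
    cp_cj (by omega)])

/-- The backward evolution at double speed of `Ā`. -/
def dbl (A : H (m + 2)) (t : ℝ) : H m := UH m (-2 * t) (cj m (shiftH m 0 (by omega) A))

/-- The transported conjugate `e^{-it∂²} f̄` carries `e^{-2it∂²}`, one factor from the transport and
one from the conjugation. It is therefore the time derivative of a bounded curve, at the price of
two antiderivatives of `u₊`. -/
lemma hasDerivAt_dbl (A : H (m + 2)) (t : ℝ) :
    HasDerivAt (dbl A) ((-2 * Complex.I) • UH m (-t) (cj m (fr A t))) t := by
  have h := hasDerivAt_UH (m := m) (cj (m + 2) A) (j := 0) (by omega) (by omega) (-2 * t)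
  have h2 := h.scomp t ((hasDerivAt_id t).const_mul (-2 : ℝ))
  have e : dbl A = fun t => UH m (-2 * t) (shiftH m 0 (by omega) (cj (m + 2) A)) :=
    funext fun t => by rw [dbl, cj_shiftH]
  rw [e]
  refine h2.congr_deriv ?_
  rw [fr, cj_UH, ← UH_add, cj_shiftH, mul_one, show -2 * t = -t + -t by ring,
    show (-2 : ℝ) • Complex.I • UH m (-t + -t) (shiftH m (0 + 2) (by omega) (cj (m + 2) A)) =
      ((-2 : ℝ) : ℂ) • Complex.I • UH m (-t + -t) (shiftH m (0 + 2) (by omega) (cj (m + 2) A))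
      from rfl, smul_smul]
  push_cast
  rfl

lemma continuous_dbl (A : H (m + 2)) : Continuous (dbl A) :=
  continuous_UH.comp ((continuous_const.mul continuous_id).prodMk continuous_const)

lemma norm_dbl_le (A : H (m + 2)) (t : ℝ) : ‖dbl A t‖ ≤ ‖A‖ := by
  rw [dbl, LinearIsometry.norm_map, LinearIsometry.norm_map]; exact norm_shiftH_le _ A

lemma rpow_neg_one_le_half {t₀ t : ℝ} (ht₀ : 0 < t₀) (ht : t₀ ≤ t) :
    t ^ (-1 : ℝ) ≤ t₀ ^ (-(1 / 2) : ℝ) * t ^ (-(1 / 2) : ℝ) := by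
  have h : 0 < t := ht₀.trans_le ht
  rw [show (-1 : ℝ) = -(1 / 2) + -(1 / 2) by norm_num, Real.rpow_add h]
  exact mul_le_mul_of_nonneg_right
    (Real.rpow_le_rpow_of_nonpos (z := -(1 / 2)) ht₀ ht (by norm_num)) (Real.rpow_nonneg h.le _)

/-- `e^{-it∂²} |e^{it∂²} A''|²` -/
def quadConj [Fact (1 ≤ m)] (A : H (m + 2)) (t : ℝ) : H m :=
  UH m (-t) (mulH m (fr A t) (cj m (fr A t)))

/-- `e^{-it∂²} (e^{it∂²} A'')²` -/
def quad [Fact (1 ≤ m)] (A : H (m + 2)) (t : ℝ) : H m := UH m (-t) (mulH m (fr A t) (fr A t))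

/-- The cubic term of the profile, transported by the free evolution. -/
def cubic [Fact (1 ≤ m)] (σ a : ℝ) (A : H (m + 2)) (t : ℝ) : H m :=
  UH m (-t) (mulH m (prof σ a A t) (mulH m (prof σ a A t) (cj m (prof σ a A t))))

/-- The terms of the nonlinearity which do not depend on the remainder, integrated in time. -/
def source [Fact (1 ≤ m)] (σ a : ℝ) (A : H (m + 2)) (t : ℝ) : H m :=
  -- The coefficient is `iσa² / (-2i)`, the divisor coming from `hasDerivAt_dbl`. The tails enter
  -- with a minus sign because `∫_t^∞` differentiates to minus its integrand.
  (-(σ * a ^ 2 / 2) : ℂ) • byParts (-(σ * a ^ 2)) (dbl A) t -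
    ((2 * a * σ * Complex.I : ℂ) • (∫ τ in Ioi t, (ph 0 τ / τ) • quadConj A τ) +
      (a * σ * Complex.I : ℂ) • (∫ τ in Ioi t, (ph (2 * (σ * a ^ 2)) τ / τ) • quad A τ) +
      (σ * Complex.I : ℂ) • ∫ τ in Ioi t, (ph 0 τ / τ) • cubic σ a A τ)

lemma continuous_UH_neg {f : ℝ → H m} (hf : Continuous f) : Continuous fun t => UH m (-t) (f t) :=
  continuous_UH.comp (continuous_neg.prodMk hf)

lemma continuousOn_UH_neg {f : ℝ → H m} {s : Set ℝ} (hf : ContinuousOn f s) :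
    ContinuousOn (fun t => UH m (-t) (f t)) s :=
  continuous_UH.comp_continuousOn (continuous_neg.continuousOn.prodMk hf)

lemma continuousOn_mulH [Fact (1 ≤ m)] {X : Type*} [TopologicalSpace X] {s : Set X} {a b : X → H m}
    (ha : ContinuousOn a s) (hb : ContinuousOn b s) :
    ContinuousOn (fun x => mulH m (a x) (b x)) s :=
  ((mulH m).continuous.comp_continuousOn ha).clm_apply hb

lemma continuous_quadConj [Fact (1 ≤ m)] (A : H (m + 2)) : Continuous (quadConj A) :=
  continuous_UH_neg (continuous_mulH (continuous_fr A) ((cj m).continuous.comp (continuous_fr A)))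

lemma continuous_quad [Fact (1 ≤ m)] (A : H (m + 2)) : Continuous (quad A) :=
  continuous_UH_neg (continuous_mulH (continuous_fr A) (continuous_fr A))

lemma continuousOn_cubic [Fact (1 ≤ m)] (σ a : ℝ) (A : H (m + 2)) :
    ContinuousOn (cubic σ a A) (Ioi 0) := by
  have h := continuousOn_prof σ a A
  exact continuousOn_UH_neg (continuousOn_mulH h
    (continuousOn_mulH h ((cj m).continuous.comp_continuousOn h)))

lemma continuousOn_ph_div (l : ℝ) : ContinuousOn (fun t : ℝ => ph l t / t) (Ioi 0) := fun _ ht =>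
  (hasDerivAt_ph_div l ht).continuousAt.continuousWithinAt

lemma norm_ph_div_smul_le (l : ℝ) {y : H m} {t M p : ℝ} (ht : 0 < t) (h : ‖y‖ ≤ M * t ^ (-p)) :
    ‖(ph l t / t) • y‖ ≤ M * t ^ (-(p + 1)) := by
  rw [norm_smul, norm_ph_div l ht]
  calc t ^ (-1 : ℝ) * ‖y‖ ≤ t ^ (-1 : ℝ) * (M * t ^ (-p)) := by gcongr
    _ = M * (t ^ (-1 : ℝ) * t ^ (-p)) := by ring
    _ = _ := by rw [← Real.rpow_add ht]; ring_nf

/-- Bounds on `∫_t^∞ τ^{iλ-1} S(τ) dτ`. -/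
lemma tail_ph {S : ℝ → H m} (hS : ContinuousOn S (Ioi 0)) {t₀ M p l : ℝ} (ht₀ : 0 < t₀)
    (hp : 0 < p) (h : ∀ t, t₀ ≤ t → ‖S t‖ ≤ M * t ^ (-p)) {t : ℝ} (ht : t₀ ≤ t) :
    HasDerivAt (fun t => ∫ τ in Ioi t, (ph l τ / τ) • S τ) (-((ph l t / t) • S t)) t ∧
    ‖∫ τ in Ioi t, (ph l τ / τ) • S τ‖ ≤ M / p * t ^ (-p) := by
  have h1 : ∀ τ, t₀ ≤ τ → ‖(ph l τ / τ) • S τ‖ ≤ M * τ ^ (-(p + 1)) := fun τ hτ =>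
    norm_ph_div_smul_le l (ht₀.trans_le hτ) (h τ hτ)
  refine ⟨hasDerivAt_tail ht₀ ht (by linarith) ((continuousOn_ph_div l).smul hS) h1, ?_⟩
  have := norm_tail_le ht₀ ht (by linarith) h1
  rwa [add_sub_cancel_right, show 1 - (p + 1) = -p by ring] at this

lemma hasDerivAt_tst_quad [Fact (1 ≤ m)] (A : H (m + 2)) (φ : 𝓢(ℝ, ℂ)) (t : ℝ) :
    HasDerivAt (fun τ => tst m φ (UH m (-τ) (mulH m (fr A τ) (UH m τ (shiftH m 1 (by omega) A)))))
      (-(-Complex.I * tst m (dS 1 φ) (quad A t))) t :=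
  (hasDerivAt_quad A φ t).congr_deriv (by rw [quad, fr]; ring)

lemma hasDerivAt_tst_quadConj [Fact (1 ≤ m)] (A : H (m + 2)) (φ : 𝓢(ℝ, ℂ)) (t : ℝ) :
    HasDerivAt (fun τ => tst m φ
      (UH m (-τ) (mulH m (fr A τ) (cj m (UH m τ (shiftH m 1 (by omega) A))))))
      (-((-2 * Complex.I) * tst m (dS 1 φ) (quadConj A t))) t :=
  (hasDerivAt_quad_conj A φ t).congr_deriv (by rw [quadConj, fr]; ring)

section

variable [Fact (1 ≤ m)] {A : H (m + 2)} {t₀ ε : ℝ} 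

lemma norm_quadConj_le (hA : ‖A‖ ≤ ε) (hd : ∀ t, t₀ ≤ t → ‖mulH m (fr A t)‖ ≤ ε * t ^ (-(1 / 2) : ℝ))
    (t : ℝ) (ht : t₀ ≤ t) : ‖quadConj A t‖ ≤ ε ^ 2 * t ^ (-(1 / 2) : ℝ) := by
  rw [quadConj, LinearIsometry.norm_map]
  have h := hd t ht
  have := norm_mulH_apply_le_of_le h (cj m (fr A t))
  rw [LinearIsometry.norm_map] at this
  have h2 := mul_le_mul_of_nonneg_left ((norm_fr_le A t).trans hA) ((norm_nonneg _).trans h)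
  linarith

lemma norm_quad_le (hA : ‖A‖ ≤ ε) (hd : ∀ t, t₀ ≤ t → ‖mulH m (fr A t)‖ ≤ ε * t ^ (-(1 / 2) : ℝ))
    (t : ℝ) (ht : t₀ ≤ t) : ‖quad A t‖ ≤ ε ^ 2 * t ^ (-(1 / 2) : ℝ) := by
  rw [quad, LinearIsometry.norm_map]
  have h := hd t ht
  have := norm_mulH_apply_le_of_le h (fr A t)
  have h2 := mul_le_mul_of_nonneg_left ((norm_fr_le A t).trans hA) ((norm_nonneg _).trans h)
  linarith

lemma norm_cubic_le (ht₀ : 0 < t₀) (hA : ‖A‖ ≤ ε)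
    (hd : ∀ t, t₀ ≤ t → ‖mulH m (fr A t)‖ ≤ ε * t ^ (-(1 / 2) : ℝ))
    (σ a t : ℝ) (ht : t₀ ≤ t) : ‖cubic σ a A t‖ ≤ ε ^ 3 * t ^ (-1 : ℝ) := by
  have h := hd t ht
  have h0 := (norm_nonneg _).trans h
  rw [cubic, LinearIsometry.norm_map, mulH_prof_cj]
  have h1 := norm_mulH_apply_le_of_le ((norm_mulH_prof σ a A t).le.trans h)
    (mulH m (fr A t) (cj m (fr A t)))
  have h2 := norm_quadConj_le hA hd t ht
  rw [quadConj, LinearIsometry.norm_map] at h2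
  have e : t ^ (-1 : ℝ) = t ^ (-(1 / 2) : ℝ) * t ^ (-(1 / 2) : ℝ) := by
    rw [← Real.rpow_add (ht₀.trans_le ht)]; norm_num
  rw [e]
  have h3 := mul_le_mul_of_nonneg_left h2 h0
  linarith

/-- The derivative contains all terms of the nonlinearity at the profile except `a²w`, which the
phase of the profile accounts for. -/
lemma hasDerivAt_source (ht₀ : 0 < t₀) (hA : ‖A‖ ≤ ε)
    (hd : ∀ t, t₀ ≤ t → ‖mulH m (fr A t)‖ ≤ ε * t ^ (-(1 / 2) : ℝ)) (σ a : ℝ) {t : ℝ}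
    (ht : t₀ ≤ t) :
    HasDerivAt (source σ a A) ((Complex.I * σ / t) • UH m (-t)
      ((a ^ 2 : ℂ) • cj m (prof σ a A t) + Bn a (prof σ a A t))) t := by
  have h1 := hasDerivAt_clm_byParts (ContinuousLinearMap.id ℂ (H m)) (-(σ * a ^ 2))
    (continuous_dbl A) (norm_dbl_le A) (ht₀.trans_le ht) (hasDerivAt_dbl A t)
  have h2 := (tail_ph (l := 0) (continuous_quadConj A).continuousOn ht₀ (by norm_num)
    (norm_quadConj_le hA hd) ht).1
  have h3 := (tail_ph (l := 2 * (σ * a ^ 2)) (continuous_quad A).continuousOn ht₀ (by norm_num)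
    (norm_quad_le hA hd) ht).1
  have h4 := (tail_ph (l := 0) (continuousOn_cubic σ a A) ht₀ (by norm_num)
    (norm_cubic_le ht₀ hA hd σ a) ht).1
  have h5 := (h1.const_smul (-(σ * a ^ 2 / 2) : ℂ)).sub
    (((h2.const_smul (2 * a * σ * Complex.I : ℂ)).add
      (h3.const_smul (a * σ * Complex.I : ℂ))).add (h4.const_smul (σ * Complex.I : ℂ)))
  refine h5.congr_deriv ?_
  have ht' : (t : ℂ) ≠ 0 := by exact_mod_cast (ht₀.trans_le ht).ne'
  rw [Bn, mulH_prof_cj, mulH_prof_prof, cubic, mulH_prof_cj, cj_prof, quad, quadConj, ph_zero]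
  simp only [map_add, map_smul, smul_add, smul_smul, smul_neg]
  module

/-- In `H^m` the two quadratic tails dominate with `t^{-1/2}`; the other terms are `O(1/t)`, and
`t₀^{-1/2}` converts their rate. After at least one derivative the quadratic tails are `O(1/t)` as
well, by `norm_cp_succ_tail_le`. -/
lemma norm_source_le (ht₀ : 0 < t₀) (hε : ε ≤ 1) (hA : ‖A‖ ≤ ε)
    (hd : ∀ t, t₀ ≤ t → ‖mulH m (fr A t)‖ ≤ ε * t ^ (-(1 / 2) : ℝ)) {σ a : ℝ} (hσ : |σ| = 1)
    (ha : |a| ≤ 1) {t : ℝ} (ht : t₀ ≤ t) :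
    ‖source σ a A t‖ ≤ (6 + 3 * t₀ ^ (-(1 / 2) : ℝ)) * ε * t ^ (-(1 / 2) : ℝ) ∧
    ∀ k, 1 ≤ k → k ≤ m → ‖cp k (source σ a A t)‖ ≤ (3 + 6 * 2 ^ (m + 1)) * ε * t ^ (-1 : ℝ) := by
  have hpos : 0 < t := ht₀.trans_le ht
  have hε0 : 0 ≤ ε := (norm_nonneg A).trans hA
  have ha2 : a ^ 2 ≤ 1 := by rw [← sq_abs]; exact pow_le_one₀ (abs_nonneg a) ha
  have hε2 : ε ^ 2 ≤ ε := by nlinarith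
  have hε3 : ε ^ 3 ≤ ε := by nlinarith
  have hl : |σ * a ^ 2| ≤ 1 := by rw [abs_mul, hσ, one_mul, abs_of_nonneg (sq_nonneg a)]; exact ha2
  have r1 : 0 ≤ t ^ (-1 : ℝ) := Real.rpow_nonneg hpos.le _
  have r2 : 0 ≤ t ^ (-(1 / 2) : ℝ) := Real.rpow_nonneg hpos.le _
  set X1 := byParts (-(σ * a ^ 2)) (dbl A) t with hX1
  set X2 := ∫ τ in Ioi t, (ph 0 τ / τ) • quadConj A τ with hX2
  set X3 := ∫ τ in Ioi t, (ph (2 * (σ * a ^ 2)) τ / τ) • quad A τ with hX3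
  set X4 := ∫ τ in Ioi t, (ph 0 τ / τ) • cubic σ a A τ with hX4
  have n1 : ‖X1‖ ≤ 3 * ε * t ^ (-1 : ℝ) := by
    refine (norm_byParts_le (M := ε) _ (fun t => (norm_dbl_le A t).trans hA) hpos).trans ?_
    rw [abs_neg]
    gcongr
    linarith
  have n2 : ‖X2‖ ≤ 2 * ε * t ^ (-(1 / 2) : ℝ) := by
    refine ((tail_ph (l := 0) (continuous_quadConj A).continuousOn ht₀ (by norm_num)
      (norm_quadConj_le hA hd) ht).2).trans ?_
    gcongr
    linarith
  have n3 : ‖X3‖ ≤ 2 * ε * t ^ (-(1 / 2) : ℝ) := by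
    refine ((tail_ph (l := 2 * (σ * a ^ 2)) (continuous_quad A).continuousOn ht₀ (by norm_num)
      (norm_quad_le hA hd) ht).2).trans ?_
    gcongr
    linarith
  have n4 : ‖X4‖ ≤ ε * t ^ (-1 : ℝ) := by
    refine ((tail_ph (l := 0) (continuousOn_cubic σ a A) ht₀ (by norm_num)
      (norm_cubic_le ht₀ hA hd σ a) ht).2).trans ?_
    gcongr
    linarith
  have hG : ∀ t, ‖UH m t (shiftH m 1 (by omega) A)‖ ≤ ε := fun t => by
    rw [LinearIsometry.norm_map]; exact (norm_shiftH_le _ A).trans hA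
  have hGc : Continuous fun t => UH m t (shiftH m 1 (by omega) A) :=
    continuous_UH.comp (continuous_id.prodMk continuous_const)
  have hprod : ∀ (g : H m) (t : ℝ), ‖g‖ ≤ ε →
      ‖UH m (-t) (mulH m (fr A t) g)‖ ≤ 2 ^ (m + 1) * ε := by
    intro g t hg
    rw [LinearIsometry.norm_map]
    refine (norm_mulH_apply_le _ _).trans ?_
    have h1 := (norm_fr_le A t).trans hA
    calc (2 : ℝ) ^ (m + 1) * ‖fr A t‖ * ‖g‖ ≤ 2 ^ (m + 1) * ε * 1 := by
          gcongr; exact hg.trans hε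
      _ = _ := mul_one _
  have hc1 : ‖(-(σ * a ^ 2 / 2) : ℂ)‖ ≤ 1 / 2 := by
    rw [norm_neg, norm_div, norm_mul, norm_pow, Complex.norm_real, Complex.norm_real,
      Real.norm_eq_abs, Real.norm_eq_abs, sq_abs, hσ, Complex.norm_ofNat]
    linarith
  have hc2 : ‖(2 * a * σ * Complex.I : ℂ)‖ ≤ 2 := by
    simp only [norm_mul, Complex.norm_real, Real.norm_eq_abs, hσ, Complex.norm_ofNat,
      Complex.norm_I]
    linarith
  have hc3 : ‖(a * σ * Complex.I : ℂ)‖ ≤ 1 := by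
    simp only [norm_mul, Complex.norm_real, Real.norm_eq_abs, hσ, Complex.norm_I]
    linarith
  have hc4 : ‖(σ * Complex.I : ℂ)‖ ≤ 1 := by
    simp only [norm_mul, Complex.norm_real, Real.norm_eq_abs, hσ, Complex.norm_I]
    norm_num
  have hsum : ∀ {F : Type} [NormedAddCommGroup F] [NormedSpace ℂ F] (x1 x2 x3 x4 : F)
      (b1 b2 b3 b4 : ℝ), ‖x1‖ ≤ b1 → ‖x2‖ ≤ b2 → ‖x3‖ ≤ b3 → ‖x4‖ ≤ b4 →
      ‖(-(σ * a ^ 2 / 2) : ℂ) • x1 - ((2 * a * σ * Complex.I : ℂ) • x2 +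
        (a * σ * Complex.I : ℂ) • x3 + (σ * Complex.I : ℂ) • x4)‖ ≤
        1 / 2 * b1 + (2 * b2 + b3 + b4) := by
    intro F _ _ x1 x2 x3 x4 b1 b2 b3 b4 h1 h2 h3 h4
    have e : ∀ (c : ℂ) (x : F) (C b : ℝ), ‖c‖ ≤ C → ‖x‖ ≤ b → ‖c • x‖ ≤ C * b := by
      intro c x C b hc hx
      rw [norm_smul]
      exact mul_le_mul hc hx (norm_nonneg _) ((norm_nonneg _).trans hc)
    refine (norm_sub_le _ _).trans (add_le_add (e _ _ _ _ hc1 h1) (norm_add₃_le.trans ?_))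
    have := e _ _ _ _ hc3 h3
    have := e _ _ _ _ hc4 h4
    linarith [e _ _ _ _ hc2 h2]
  constructor
  · refine (hsum X1 X2 X3 X4 _ _ _ _ n1 n2 n3 n4).trans ?_
    have h1 := mul_le_mul_of_nonneg_left (rpow_neg_one_le_half ht₀ ht) hε0
    have h2 : 0 ≤ ε * (t₀ ^ (-(1 / 2) : ℝ) * t ^ (-(1 / 2) : ℝ)) := (mul_nonneg hε0 r1).trans h1
    linarith
  · intro k hk1 hk2
    obtain ⟨k, rfl⟩ : ∃ j, k = j + 1 := ⟨k - 1, by omega⟩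
    have k2 : ‖cp (k + 1) X2‖ ≤ 2 ^ (m + 1) * ε * t ^ (-1 : ℝ) := by
      have := norm_cp_succ_tail_le (l := 0) (k := k) (continuous_UH_neg (continuous_mulH
        (continuous_fr A) ((cj m).continuous.comp hGc))) (continuous_quadConj A) ht₀
        (hasDerivAt_tst_quadConj A) (fun t => hprod _ t (by
          rw [Function.comp_apply, LinearIsometry.norm_map]; exact hG t)) (norm_quadConj_le hA hd) hk2 ht
      simp only [norm_mul, norm_neg, Complex.norm_ofNat, Complex.norm_I, abs_zero] at this
      linarith
    have k3 : ‖cp (k + 1) X3‖ ≤ 4 * (2 ^ (m + 1) * ε * t ^ (-1 : ℝ)) := by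
      have := norm_cp_succ_tail_le (l := 2 * (σ * a ^ 2)) (k := k) (continuous_UH_neg
        (continuous_mulH (continuous_fr A) hGc)) (continuous_quad A) ht₀
        (hasDerivAt_tst_quad A) (fun t => hprod _ t (hG t)) (norm_quad_le hA hd) hk2 ht
      rw [norm_neg, Complex.norm_I, one_mul] at this
      refine this.trans ?_
      have h2 : |2 * (σ * a ^ 2)| ≤ 2 := by
        rw [abs_mul, abs_two]; linarith
      have : (2 + |2 * (σ * a ^ 2)|) * (2 ^ (m + 1) * ε) * t ^ (-1 : ℝ) ≤
          (2 + 2) * (2 ^ (m + 1) * ε) * t ^ (-1 : ℝ) := by gcongr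
      linarith
    have e : cp (k + 1) (source σ a A t) = (-(σ * a ^ 2 / 2) : ℂ) • cp (k + 1) X1 -
        ((2 * a * σ * Complex.I : ℂ) • cp (k + 1) X2 + (a * σ * Complex.I : ℂ) • cp (k + 1) X3 +
          (σ * Complex.I : ℂ) • cp (k + 1) X4) := by
      simp only [source, map_sub, map_add, map_smul, ← hX1, ← hX2, ← hX3, ← hX4]
    rw [e]
    refine (hsum _ _ _ _ _ _ _ _ ((norm_cp_le _ X1).trans n1) k2 k3
      ((norm_cp_le _ X4).trans n4)).trans ?_
    have := mul_nonneg hε0 r1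
    linarith

end

/-! ### The equation for the remainder and its solution -/

/-- The nonlinearity `(|a + w|² - a²)(a + w)`. -/
def nl [Fact (1 ≤ m)] (a : ℝ) (w : H m) : H m := (a ^ 2 : ℂ) • (w + cj m w) + Bn a w

lemma continuous_nl [Fact (1 ≤ m)] (a : ℝ) : Continuous (nl (m := m) a) := by
  have h1 : Continuous (fun w : H m => w + cj m w) := continuous_id.add (cj m).continuous
  unfold nl
  exact (h1.const_smul (a ^ 2 : ℂ)).add (continuous_Bn a)

lemma norm_conjL (f : L2) : ‖conjL f‖ = ‖f‖ := by
  refine le_antisymm (Lp.norm_le_norm_of_ae_le ?_) (Lp.norm_le_norm_of_ae_le ?_) <;>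
  · filter_upwards [conjL_ae f] with x hx
    rw [hx]; simp

/-- The linear part `a²(w + w̄)` brings no decay of its own, so its `k`-th derivative is estimated
by the `k`-th derivative of `w - w'`, which may decay faster. For the rest the full norm is
affordable, since `μ` decays. -/
lemma norm_cp_nl_sub_le [Fact (1 ≤ m)] (a : ℝ) {w w' : H m} {μ : ℝ} (h : ‖mulH m w‖ ≤ μ)
    (h' : ‖mulH m w'‖ ≤ μ) {k : ℕ} (hk : k ≤ m) :
    ‖cp k (nl a w - nl a w')‖ ≤
      2 * a ^ 2 * ‖cp k (w - w')‖ + (6 * |a| * μ + 3 * μ ^ 2) * ‖w - w'‖ := by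
  have e : nl a w - nl a w' = (a ^ 2 : ℂ) • ((w - w') + cj m (w - w')) + (Bn a w - Bn a w') := by
    simp only [nl, map_sub, smul_add, smul_sub]; abel
  rw [e, map_add, map_smul, map_add]
  refine (norm_add_le _ _).trans (add_le_add ?_ ((norm_cp_le _ _).trans (norm_Bn_sub_le a h h')))
  rw [norm_smul, norm_pow, Complex.norm_real, Real.norm_eq_abs, sq_abs]
  have := norm_add_le (cp k (w - w')) (cp k (cj m (w - w')))
  rw [cp_cj hk, norm_conjL] at this
  rw [cp_cj hk]
  nlinarith [sq_nonneg a]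

lemma norm_nl_sub_le [Fact (1 ≤ m)] (a : ℝ) {w w' : H m} {μ : ℝ} (h : ‖mulH m w‖ ≤ μ)
    (h' : ‖mulH m w'‖ ≤ μ) :
    ‖nl a w - nl a w'‖ ≤ (2 * a ^ 2 + (6 * |a| * μ + 3 * μ ^ 2)) * ‖w - w'‖ := by
  have hμ : 0 ≤ μ := (norm_nonneg _).trans h
  refine norm_H_le (by positivity) fun k hk => (norm_cp_nl_sub_le a h h' hk).trans ?_
  rw [add_mul (2 * a ^ 2)]
  gcongr
  exact norm_cp_le _ _

lemma norm_coeff {σ t : ℝ} (hσ : |σ| = 1) (ht : 0 < t) : ‖(Complex.I * σ / t : ℂ)‖ = t ^ (-1 : ℝ) := by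
  rw [norm_div, norm_mul, Complex.norm_I, Complex.norm_real, Complex.norm_real, Real.norm_eq_abs,
    hσ, Real.norm_of_nonneg ht.le, Real.rpow_neg_one, one_mul, one_div]

/-- The contribution of the remainder to the nonlinearity, transported by the free evolution. -/
def rem [Fact (1 ≤ m)] (σ a : ℝ) (A : H (m + 2)) (t : ℝ) (y : H m) : H m :=
  (Complex.I * σ / t) • UH m (-t) (nl a (prof σ a A t + UH m t y) - nl a (prof σ a A t))

lemma continuousOn_coeff (σ : ℝ) : ContinuousOn (fun t : ℝ => (Complex.I * σ / t : ℂ)) (Ioi 0) := by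
  refine ContinuousOn.div continuousOn_const (by fun_prop) fun t ht => ?_
  exact_mod_cast (ne_of_gt ht)

/-- After transport the profile is a fixed function times `t^{iσa²}`, and differentiating that phase
gives exactly the term `a²w`. This is the origin of the logarithmic phase. -/
lemma hasDerivAt_UH_neg_prof (σ a : ℝ) (A : H (m + 2)) {t : ℝ} (ht : 0 < t) :
    HasDerivAt (fun t => UH m (-t) (prof σ a A t))
      ((Complex.I * σ / t) • UH m (-t) ((a ^ 2 : ℂ) • prof σ a A t)) t := by
  have h := (hasDerivAt_ph (σ * a ^ 2) ht).smul_const (shiftH m 2 (by omega) A)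
  have e : ∀ t, UH m (-t) (prof σ a A t) = ph (σ * a ^ 2) t • shiftH m 2 (by omega) A := fun t => by
    rw [prof, map_smul, fr, UH_neg_UH]
  simp only [e, map_smul]
  refine h.congr_deriv ?_
  simp only [smul_smul]
  push_cast
  congr 1
  ring

section

variable [Fact (1 ≤ m)] {A : H (m + 2)} {t₀ ε σ a : ℝ}

lemma continuousOn_rem (σ a : ℝ) (A : H (m + 2)) :
    ContinuousOn (Function.uncurry (rem σ a A)) (Ioi 0 ×ˢ univ) := by
  have hf : ContinuousOn (fun p : ℝ × H m => p.1) (Ioi 0 ×ˢ univ) := continuousOn_fst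
  have hmap : MapsTo (fun p : ℝ × H m => p.1) (Ioi 0 ×ˢ univ) (Ioi 0) := fun p hp => hp.1
  have h1 := (continuousOn_coeff σ).comp hf hmap
  have h2 := (continuousOn_prof σ a A).comp hf hmap
  have h3 : ContinuousOn (fun p : ℝ × H m => UH m p.1 p.2) (Ioi 0 ×ˢ univ) :=
    continuous_UH.continuousOn
  have h4 := ((continuous_nl a).comp_continuousOn (h2.add h3)).sub
    ((continuous_nl a).comp_continuousOn h2)
  exact h1.smul (continuous_UH.comp_continuousOn (hf.neg.prodMk h4))

lemma norm_cp_rem_sub_le (hσ : |σ| = 1) (ht₀ : 0 < t₀)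
    (hd : ∀ t, t₀ ≤ t → ‖mulH m (fr A t)‖ ≤ ε * t ^ (-(1 / 2) : ℝ)) {ρ t : ℝ}
    (ht : t₀ ≤ t) {y y' : H m} (hy : ‖y‖ ≤ ρ * t ^ (-(1 / 2) : ℝ))
    (hy' : ‖y'‖ ≤ ρ * t ^ (-(1 / 2) : ℝ)) {k : ℕ} (hk : k ≤ m) :
    ‖cp k (rem σ a A t y - rem σ a A t y')‖ ≤ t ^ (-1 : ℝ) * (2 * a ^ 2 * ‖cp k (y - y')‖ +
      (6 * |a| * ((ε + 2 ^ (m + 1) * ρ) * t ^ (-(1 / 2) : ℝ)) +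
        3 * ((ε + 2 ^ (m + 1) * ρ) * t ^ (-(1 / 2) : ℝ)) ^ 2) * ‖y - y'‖) := by
  have hpos := ht₀.trans_le ht
  have hμ : ∀ y : H m, ‖y‖ ≤ ρ * t ^ (-(1 / 2) : ℝ) → ‖mulH m (prof σ a A t + UH m t y)‖ ≤
      (ε + 2 ^ (m + 1) * ρ) * t ^ (-(1 / 2) : ℝ) := by
    intro y hy
    rw [map_add]
    refine (norm_add_le _ _).trans ?_
    have h1 := (norm_mulH_prof σ a A t).le.trans (hd t ht)
    have h2 := norm_mulH_le (UH m t y)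
    rw [LinearIsometry.norm_map] at h2
    have h3 := mul_le_mul_of_nonneg_left hy (by positivity : (0 : ℝ) ≤ 2 ^ (m + 1))
    linarith
  have h := norm_cp_nl_sub_le a (hμ y hy) (hμ y' hy') hk
  rw [add_sub_add_left_eq_sub, ← map_sub, cp_UH hk, LinearIsometryEquiv.norm_map,
    LinearIsometry.norm_map] at h
  have e : rem σ a A t y - rem σ a A t y' = (Complex.I * σ / t) • UH m (-t)
      (nl a (prof σ a A t + UH m t y) - nl a (prof σ a A t + UH m t y')) := by
    rw [rem, rem, ← smul_sub, ← map_sub, sub_sub_sub_cancel_right]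
  rw [e, map_smul, cp_UH hk, norm_smul, norm_coeff hσ hpos, LinearIsometryEquiv.norm_map]
  gcongr

lemma rpow_neg_half_le {t : ℝ} (ht₀ : 0 < t₀) (ht : t₀ ≤ t) :
    t ^ (-(1 / 2) : ℝ) ≤ t₀ ^ (-(1 / 2) : ℝ) :=
  Real.rpow_le_rpow_of_nonpos (z := -(1 / 2)) ht₀ ht (by norm_num)

lemma norm_rem_sub_le (hσ : |σ| = 1) (ht₀ : 0 < t₀) (hε : 0 ≤ ε)
    (hd : ∀ t, t₀ ≤ t → ‖mulH m (fr A t)‖ ≤ ε * t ^ (-(1 / 2) : ℝ)) {ρ t : ℝ} (hρ : 0 ≤ ρ)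
    (ht : t₀ ≤ t) {y y' : H m} (hy : ‖y‖ ≤ ρ * t ^ (-(1 / 2) : ℝ))
    (hy' : ‖y'‖ ≤ ρ * t ^ (-(1 / 2) : ℝ)) :
    ‖rem σ a A t y - rem σ a A t y'‖ ≤ (2 * a ^ 2 +
      (6 * |a| * ((ε + 2 ^ (m + 1) * ρ) * t₀ ^ (-(1 / 2) : ℝ)) +
        3 * ((ε + 2 ^ (m + 1) * ρ) * t₀ ^ (-(1 / 2) : ℝ)) ^ 2)) * t ^ (-1 : ℝ) * ‖y - y'‖ := by
  have r1 := Real.rpow_nonneg (ht₀.trans_le ht).le (-1 : ℝ)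
  have r2 := Real.rpow_nonneg (ht₀.trans_le ht).le (-(1 / 2) : ℝ)
  have r3 := Real.rpow_nonneg ht₀.le (-(1 / 2) : ℝ)
  have hst := rpow_neg_half_le ht₀ ht
  refine norm_H_le (by positivity) fun k hk => ?_
  refine (norm_cp_rem_sub_le hσ ht₀ hd ht hy hy' hk).trans ?_
  set ν := ε + 2 ^ (m + 1) * ρ with hν
  have hν0 : 0 ≤ ν := by positivity
  have h1 : (6 * |a| * (ν * t ^ (-(1 / 2) : ℝ)) + 3 * (ν * t ^ (-(1 / 2) : ℝ)) ^ 2) ≤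
      (6 * |a| * (ν * t₀ ^ (-(1 / 2) : ℝ)) + 3 * (ν * t₀ ^ (-(1 / 2) : ℝ)) ^ 2) := by gcongr
  rw [mul_comm _ (t ^ (-1 : ℝ)), mul_assoc (t ^ (-1 : ℝ))]
  refine mul_le_mul_of_nonneg_left ?_ r1
  rw [add_mul (2 * a ^ 2)]
  exact add_le_add (mul_le_mul_of_nonneg_left (norm_cp_le _ _) (by positivity))
    (mul_le_mul_of_nonneg_right h1 (norm_nonneg _))

/-- The linear part contributes `t^{-1} · t^{-1}` and the rest `t^{-1} · t^{-1/2} · t^{-1/2}`. Both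
are `t^{-2}`, whose tail is again `t^{-1}`, so the rate of the derivatives is preserved. -/
lemma norm_cp_rem_le (hσ : |σ| = 1) (ht₀ : 0 < t₀) (hε : 0 ≤ ε)
    (hd : ∀ t, t₀ ≤ t → ‖mulH m (fr A t)‖ ≤ ε * t ^ (-(1 / 2) : ℝ)) {δ μ t : ℝ} (hδ : 0 ≤ δ)
    (hμ : ε + 2 ^ (m + 1) * δ ≤ μ)
    (hsmall : 2 * a ^ 2 + (6 * |a| * μ + 3 * μ ^ 2 * t₀ ^ (-(1 / 2) : ℝ)) ≤ 1 / 2)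
    (ht : t₀ ≤ t) {y : H m} (hy : ‖y‖ ≤ δ * t ^ (-(1 / 2) : ℝ)) {k : ℕ} (hk : k ≤ m)
    (hyk : ‖cp k y‖ ≤ δ * t ^ (-1 : ℝ)) : ‖cp k (rem σ a A t y)‖ ≤ δ / 2 * t ^ (-2 : ℝ) := by
  have hpos := ht₀.trans_le ht
  have r1 := Real.rpow_nonneg hpos.le (-1 : ℝ)
  have r2 := Real.rpow_nonneg hpos.le (-(1 / 2) : ℝ)
  have hst := rpow_neg_half_le ht₀ ht
  have h1 := norm_cp_rem_sub_le (σ := σ) (a := a) hσ ht₀ hd ht hy (y' := 0)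
    (by rw [norm_zero]; positivity) hk
  rw [show rem σ a A t 0 = 0 by simp [rem], sub_zero, sub_zero] at h1
  refine h1.trans ?_
  have e2 : t ^ (-2 : ℝ) = t ^ (-1 : ℝ) * t ^ (-1 : ℝ) := by
    rw [← Real.rpow_add hpos]; norm_num
  have e3 : t ^ (-1 : ℝ) = t ^ (-(1 / 2) : ℝ) * t ^ (-(1 / 2) : ℝ) := by
    rw [← Real.rpow_add hpos]; norm_num
  have h3 : 2 * a ^ 2 * ‖cp k y‖ ≤ 2 * a ^ 2 * (δ * t ^ (-1 : ℝ)) := by gcongr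
  set ν := ε + 2 ^ (m + 1) * δ with hν
  have hν0 : 0 ≤ ν := by positivity
  have hμ0 := hν0.trans hμ
  have h4 : (6 * |a| * (ν * t ^ (-(1 / 2) : ℝ)) + 3 * (ν * t ^ (-(1 / 2) : ℝ)) ^ 2) * ‖y‖ ≤
      (6 * |a| * μ + 3 * μ ^ 2 * t₀ ^ (-(1 / 2) : ℝ)) * (δ * t ^ (-1 : ℝ)) := by
    calc _ ≤ (6 * |a| * (μ * t ^ (-(1 / 2) : ℝ)) +
          3 * (μ * t ^ (-(1 / 2) : ℝ)) ^ 2) * (δ * t ^ (-(1 / 2) : ℝ)) := by gcongr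
      _ = (6 * |a| * μ + 3 * μ ^ 2 * t ^ (-(1 / 2) : ℝ)) *
          (δ * (t ^ (-(1 / 2) : ℝ) * t ^ (-(1 / 2) : ℝ))) := by ring
      _ ≤ _ := by rw [← e3]; gcongr
  have h6 := mul_le_mul_of_nonneg_right hsmall (mul_nonneg hδ r1)
  rw [add_mul] at h6
  rw [e2, show δ / 2 * (t ^ (-1 : ℝ) * t ^ (-1 : ℝ)) =
    t ^ (-1 : ℝ) * (1 / 2 * (δ * t ^ (-1 : ℝ))) by ring]
  exact mul_le_mul_of_nonneg_left ((add_le_add h3 h4).trans h6) r1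

/-- The phase, the source and the remainder term recombine into the full nonlinearity at profile
plus remainder. -/
lemma nl_prof_add (σ a : ℝ) (A : H (m + 2)) (t : ℝ) (y : H m) :
    (Complex.I * σ / t) • UH m (-t) ((a ^ 2 : ℂ) • prof σ a A t) +
      ((Complex.I * σ / t) • UH m (-t)
        ((a ^ 2 : ℂ) • cj m (prof σ a A t) + Bn a (prof σ a A t)) - -rem σ a A t y) =
      (Complex.I * σ / t) • UH m (-t) (nl a (prof σ a A t + UH m t y)) := by
  rw [rem, sub_neg_eq_add, ← smul_add, ← smul_add, ← map_add, ← map_add]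
  congr 2
  generalize nl a (prof σ a A t + UH m t y) = X
  rw [nl]
  simp only [smul_add]
  abel

lemma hasDerivWithinAt_of_duhamel (ht₀ : 0 < t₀) (hA : ‖A‖ ≤ ε)
    (hd : ∀ t, t₀ ≤ t → ‖mulH m (fr A t)‖ ≤ ε * t ^ (-(1 / 2) : ℝ)) {y : ℝ → H m} {M : ℝ}
    (hyc : ContinuousOn y (Ioi 0))
    (hb : ∀ τ, t₀ ≤ τ → ‖rem σ a A τ (y τ)‖ ≤ M * τ ^ (-(3 / 2) : ℝ))
    (hy : ∀ t, t₀ ≤ t → y t = source σ a A t - ∫ τ in Ioi t, rem σ a A τ (y τ)) {t : ℝ}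
    (ht : t₀ ≤ t) :
    HasDerivWithinAt (fun t => UH m (-t) (prof σ a A t + UH m t (y t)))
      ((Complex.I * σ / t) • UH m (-t) (nl a (prof σ a A t + UH m t (y t)))) (Ici t₀) t := by
  have hc : ContinuousOn (fun τ => rem σ a A τ (y τ)) (Ioi 0) :=
    (continuousOn_rem σ a A).comp (f := fun τ => (τ, y τ)) (continuousOn_id.prodMk hyc)
      fun τ hτ => ⟨hτ, mem_univ _⟩
  have h0 := hasDerivAt_tail (p := 3 / 2) ht₀ ht (by norm_num) hc hb
  have h1 : HasDerivAt (fun τ => UH m (-τ) (prof σ a A τ) +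
      (source σ a A τ - ∫ τ in Ioi τ, rem σ a A τ (y τ))) _ t :=
    (hasDerivAt_UH_neg_prof σ a A (ht₀.trans_le ht)).add
      ((hasDerivAt_source ht₀ hA hd σ a ht).sub h0)
  have h2 : ∀ τ, t₀ ≤ τ → UH m (-τ) (prof σ a A τ + UH m τ (y τ)) =
      UH m (-τ) (prof σ a A τ) + (source σ a A τ - ∫ τ in Ioi τ, rem σ a A τ (y τ)) :=
    fun τ hτ => by rw [map_add, UH_neg_UH, ← hy τ hτ]
  rw [← nl_prof_add]
  exact h1.hasDerivWithinAt.congr h2 (h2 t ht)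

/-- Existence of the remainder. -/
theorem exists_mild_solution (hσ : |σ| = 1) (ht₀ : 0 < t₀) (hε : ε ≤ 1) (ha : |a| ≤ 1)
    (hA : ‖A‖ ≤ ε) (hd : ∀ t, t₀ ≤ t → ‖mulH m (fr A t)‖ ≤ ε * t ^ (-(1 / 2) : ℝ))
    {C μ : ℝ} (hC : 9 + 6 * 2 ^ (m + 1) + 3 * t₀ ^ (-(1 / 2) : ℝ) ≤ C)
    (hμ : ε + 2 ^ (m + 1) * (2 * C * ε) ≤ μ)
    (hsmall : 2 * a ^ 2 + (6 * |a| * μ + 3 * μ ^ 2) * (1 + t₀ ^ (-(1 / 2) : ℝ)) ^ 2 ≤ 1 / 8) :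
    ∃ r : ℝ → H m, ContinuousOn r (Ioi 0) ∧
      (∀ t, t₀ ≤ t → ‖r t‖ ≤ 2 * C * ε * t ^ (-(1 / 2) : ℝ)) ∧
      (∀ k, 1 ≤ k → k ≤ m → ∀ t, t₀ ≤ t → ‖cp k (r t)‖ ≤ 2 * C * ε * t ^ (-1 : ℝ)) ∧
      ∀ t, t₀ ≤ t → HasDerivWithinAt (fun t => UH m (-t) (prof σ a A t + r t))
        ((Complex.I * σ / t) • UH m (-t) (nl a (prof σ a A t + r t))) (Ici t₀) t := by
  have hε0 : 0 ≤ ε := (norm_nonneg A).trans hA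
  set s := t₀ ^ (-(1 / 2) : ℝ) with hs
  have hs0 : 0 ≤ s := Real.rpow_nonneg ht₀.le _
  have hC0 : 0 ≤ C := le_trans (by positivity) hC
  have hμ0 : 0 ≤ μ := le_trans (by positivity) hμ
  set δ := 2 * C * ε with hδ
  have hδ0 : 0 ≤ δ := by positivity
  set L : ℝ → ℝ := fun ρ => 2 * a ^ 2 + (6 * |a| * ((ε + 2 ^ (m + 1) * ρ) * s) +
    3 * ((ε + 2 ^ (m + 1) * ρ) * s) ^ 2) with hL
  -- The factor `(1 + s)²` dominates `1`, `s` and `s²`, so one smallness hypothesis serves both the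
  -- contraction and the bounds on derivatives.
  have hs1 : s ≤ (1 + s) ^ 2 := by nlinarith
  have hs2 : s ^ 2 ≤ (1 + s) ^ 2 := by gcongr; linarith
  have hs3 : 1 ≤ (1 + s) ^ 2 := by nlinarith
  have hLδ : |L δ| ≤ 1 / 8 := by
    rw [hL, abs_of_nonneg (by positivity)]
    refine le_trans ?_ hsmall
    have : 6 * |a| * (ε + 2 ^ (m + 1) * δ) * s + 3 * (ε + 2 ^ (m + 1) * δ) ^ 2 * s ^ 2 ≤
      6 * |a| * μ * (1 + s) ^ 2 + 3 * μ ^ 2 * (1 + s) ^ 2 := by gcongr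
    linarith
  have hcomp : 2 * a ^ 2 + (6 * |a| * μ + 3 * μ ^ 2 * s) ≤ 1 / 2 := by
    have : 6 * |a| * μ * 1 + 3 * μ ^ 2 * s ≤
      6 * |a| * μ * (1 + s) ^ 2 + 3 * μ ^ 2 * (1 + s) ^ 2 := by gcongr
    linarith
  have hE := fun t ht => norm_source_le (σ := σ) (a := a) (t := t) ht₀ hε hA hd hσ ha ht
  have hE0 : ∀ t, t₀ ≤ t → ‖source σ a A t‖ ≤ δ / 2 * t ^ (-(1 / 2) : ℝ) := fun t ht =>
    (hE t ht).1.trans (mul_le_mul_of_nonneg_right (by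
      rw [hδ, mul_assoc, mul_div_cancel_left₀ _ (two_ne_zero)]
      exact mul_le_mul_of_nonneg_right
        (by linarith [show (0 : ℝ) ≤ 6 * 2 ^ (m + 1) by positivity]) hε0)
      (Real.rpow_nonneg (ht₀.trans_le ht).le _))
  have hEk : ∀ k, 1 ≤ k → k ≤ m → ∀ t, t₀ ≤ t →
      ‖cp k (source σ a A t)‖ ≤ δ / 2 * t ^ (-1 : ℝ) := fun k hk1 hk2 t ht =>
    ((hE t ht).2 k hk1 hk2).trans (mul_le_mul_of_nonneg_right (by
      rw [hδ, mul_assoc 2, mul_div_cancel_left₀ _ (two_ne_zero)]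
      exact mul_le_mul_of_nonneg_right (by linarith) hε0)
      (Real.rpow_nonneg (ht₀.trans_le ht).le _))
  have hN0 : ∀ t, rem σ a A t 0 = 0 := fun t => by simp [rem]
  obtain ⟨y, hyc, hy0, hyk, hy⟩ := exists_decaying_solution (E := source σ a A) (N := rem σ a A)
    (L := L) ht₀ hδ0
    (fun t ht => (hasDerivAt_source ht₀ hA hd σ a ht).continuousAt.continuousWithinAt)
    hE0 hEk (continuousOn_rem σ a A) hN0
    (fun ρ hρ t ht y y' h h' => norm_rem_sub_le hσ ht₀ hε0 hd hρ ht h h') hLδ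
    (fun t ht y h k _ hk2 hk => norm_cp_rem_le hσ ht₀ hε0 hd hδ0 hμ hcomp ht h hk2 hk)
  refine ⟨fun t => UH m t (y t), continuous_UH.comp_continuousOn (continuousOn_id.prodMk hyc),
    fun t ht => by rw [LinearIsometry.norm_map]; exact hy0 t ht, fun k hk1 hk2 t ht => by
      rw [cp_UH hk2, LinearIsometryEquiv.norm_map]; exact hyk k hk1 hk2 t ht, fun t ht => ?_⟩
  have hb : ∀ τ, t₀ ≤ τ → ‖rem σ a A τ (y τ)‖ ≤ (L δ * δ) * τ ^ (-(3 / 2) : ℝ) := by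
    intro τ hτ
    have hpos := ht₀.trans_le hτ
    have h1 := norm_rem_sub_le (a := a) hσ ht₀ hε0 hd hδ0 hτ (hy0 τ hτ) (y' := 0)
      (by rw [norm_zero]; exact mul_nonneg hδ0 (Real.rpow_nonneg hpos.le _))
    rw [hN0, sub_zero, sub_zero] at h1
    have e : τ ^ (-(3 / 2) : ℝ) = τ ^ (-1 : ℝ) * τ ^ (-(1 / 2) : ℝ) := by
      rw [← Real.rpow_add hpos]; norm_num
    have h2 : 0 ≤ L δ * τ ^ (-1 : ℝ) :=
      mul_nonneg (by rw [hL]; positivity) (Real.rpow_nonneg hpos.le _)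
    rw [e, show L δ * δ * (τ ^ (-1 : ℝ) * τ ^ (-(1 / 2) : ℝ)) =
      L δ * τ ^ (-1 : ℝ) * (δ * τ ^ (-(1 / 2) : ℝ)) by ring]
    exact h1.trans (mul_le_mul_of_nonneg_left (hy0 τ hτ) h2)
  exact hasDerivWithinAt_of_duhamel ht₀ hA hd hyc hb hy ht

end

/-! ### Uniqueness -/

/-- Grönwall's inequality in the reversed time `T - s`. -/
lemma eq_zero_of_deriv_le_left {F : Type*} [NormedAddCommGroup F] [NormedSpace ℝ F]
    {D D' : ℝ → F} {t₀ T K : ℝ} (hT : D T = 0)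
    (hD : ∀ t, t₀ ≤ t → HasDerivWithinAt D (D' t) (Ici t₀) t)
    (hK : ∀ t, t₀ ≤ t → t ≤ T → ‖D' t‖ ≤ K * ‖D t‖) {t : ℝ} (ht : t₀ ≤ t) (htT : t ≤ T) :
    D t = 0 := by
  have h := norm_le_gronwallBound_of_norm_deriv_right_le (f := fun s => D (T - s))
    (f' := fun s => -D' (T - s)) (δ := 0) (K := K) (ε := 0) (a := 0) (b := T - t₀) ?_ ?_ ?_ ?_
    (T - t) ⟨by linarith, by linarith⟩
  · simpa [gronwallBound_ε0_δ0] using h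
  · intro s hs
    have h1 : ContinuousWithinAt D (Ici t₀) (T - s) :=
      (hD (T - s) (by linarith [hs.2])).continuousWithinAt
    exact ContinuousWithinAt.comp (t := Ici t₀) h1 (by fun_prop)
      fun x hx => by simp only [mem_Ici]; linarith [hx.2]
  · intro s hs
    have h1 : HasDerivAt D (D' (T - s)) (T - s) :=
      (hD (T - s) (by linarith [hs.2])).hasDerivAt (Ici_mem_nhds (by linarith [hs.2]))
    have h2 := h1.scomp s ((hasDerivAt_id s).const_sub T)
    exact (h2.congr_deriv (by simp)).hasDerivWithinAt
  · simp [hT]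
  · intro s hs
    rw [norm_neg, add_zero]
    exact hK _ (by linarith [hs.2]) (by linarith [hs.1])

/-- Grönwall's inequality cannot start from infinity, since `1/t` is not integrable. The decay helps
instead: a bound `Mt^{-1/2}` on `D` gives `‖D'‖ ≤ (M/4)t^{-3/2}`, hence the bound `(M/2)t^{-1/2}` on
`D`, and iteration forces zero. -/
lemma eq_zero_of_deriv_le_right {F : Type*} [NormedAddCommGroup F] [NormedSpace ℝ F]
    [CompleteSpace F]
    {D D' : ℝ → F} {T M : ℝ} (hT : 0 < T)
    (hD : ∀ t, T ≤ t → HasDerivWithinAt D (D' t) (Ici T) t) (hc : ContinuousOn D' (Ici T))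
    (hK : ∀ t, T ≤ t → ‖D' t‖ ≤ 1 / 4 * t ^ (-1 : ℝ) * ‖D t‖)
    (hM : ∀ t, T ≤ t → ‖D t‖ ≤ M * t ^ (-(1 / 2) : ℝ)) {t : ℝ} (ht : T ≤ t) : D t = 0 := by
  have hlim : Tendsto D atTop (𝓝 0) :=
    tendsto_zero_of_norm_le_rpow (t₀ := T) (p := -(1 / 2)) (by norm_num) hM
  have step : ∀ n : ℕ, ∀ t, T ≤ t → ‖D t‖ ≤ (M / 2 ^ n) * t ^ (-(1 / 2) : ℝ) := by
    intro n
    induction n with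
    | zero => simpa using hM
    | succ n ih =>
      intro t ht
      have hb : ∀ τ, T ≤ τ → ‖D' τ‖ ≤ (1 / 4 * (M / 2 ^ n)) * τ ^ (-(3 / 2) : ℝ) := by
        intro τ hτ
        have hpos := hT.trans_le hτ
        refine (hK τ hτ).trans ?_
        have e : τ ^ (-(3 / 2) : ℝ) = τ ^ (-1 : ℝ) * τ ^ (-(1 / 2) : ℝ) := by
          rw [← Real.rpow_add hpos]; norm_num
        have h1 := mul_le_mul_of_nonneg_left (ih τ hτ) (Real.rpow_nonneg hpos.le (-1 : ℝ))
        rw [e]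
        linarith
      have hint : IntegrableOn D' (Ioi t) := by
        have hi : IntegrableOn (fun τ => (1 / 4 * (M / 2 ^ n)) * τ ^ (-(3 / 2) : ℝ)) (Ioi t) :=
          (integrableOn_Ioi_rpow_of_lt (by norm_num) (hT.trans_le ht)).const_mul _
        refine Integrable.mono' hi ?_ ?_
        · exact (hc.mono fun x hx => ht.trans (le_of_lt hx)).aestronglyMeasurable measurableSet_Ioi
        · exact (ae_restrict_iff' measurableSet_Ioi).2
            (Eventually.of_forall fun τ hτ => hb τ (ht.trans (le_of_lt hτ)))
      have h1 := integral_Ioi_of_hasDerivAt_of_tendsto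
        ((hD t ht).continuousWithinAt.mono (Ici_subset_Ici.2 ht))
        (fun τ hτ => (hD τ (ht.trans (le_of_lt hτ))).hasDerivAt (Ici_mem_nhds (ht.trans_lt hτ)))
        hint hlim
      have h2 := norm_tail_le (p := 3 / 2) hT ht (by norm_num) hb
      rw [h1, zero_sub, norm_neg] at h2
      refine h2.trans (le_of_eq ?_)
      rw [pow_succ, show (1 : ℝ) - 3 / 2 = -(1 / 2) by norm_num]
      ring
  refine norm_le_zero_iff.1 (ge_of_tendsto' (x := atTop)
    (f := fun n : ℕ => (M / 2 ^ n) * t ^ (-(1 / 2) : ℝ)) ?_ fun n => step n t ht)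
  have h1 : Tendsto (fun n : ℕ => M * (1 / 2 : ℝ) ^ n * t ^ (-(1 / 2) : ℝ)) atTop (𝓝 (M * 0 * _)) :=
    ((tendsto_pow_atTop_nhds_zero_of_lt_one (by norm_num) (by norm_num)).const_mul M).mul_const _
  simpa [div_eq_mul_inv] using h1

/-- Uniqueness of mild solutions which are asymptotic to the profile. -/
theorem mild_solution_unique [Fact (1 ≤ m)] {A : H (m + 2)} {t₀ ε σ a M : ℝ} (hσ : |σ| = 1)
    (ht₀ : 0 < t₀) (ha : 2 * a ^ 2 ≤ 1 / 8)
    (hd : ∀ t, t₀ ≤ t → ‖mulH m (fr A t)‖ ≤ ε * t ^ (-(1 / 2) : ℝ)) {w w' : ℝ → H m}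
    (hw : ContinuousOn w (Ici t₀)) (hw' : ContinuousOn w' (Ici t₀))
    (hm : ∀ t, t₀ ≤ t → HasDerivWithinAt (fun t => UH m (-t) (w t))
      ((Complex.I * σ / t) • UH m (-t) (nl a (w t))) (Ici t₀) t)
    (hm' : ∀ t, t₀ ≤ t → HasDerivWithinAt (fun t => UH m (-t) (w' t))
      ((Complex.I * σ / t) • UH m (-t) (nl a (w' t))) (Ici t₀) t)
    (hb : ∀ᶠ t : ℝ in atTop, ‖w t - prof σ a A t‖ ≤ M * t ^ (-(1 / 2) : ℝ))
    (hb' : ∀ᶠ t : ℝ in atTop, ‖w' t - prof σ a A t‖ ≤ M * t ^ (-(1 / 2) : ℝ)) {t : ℝ}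
    (ht : t₀ ≤ t) : w t = w' t := by
  set D : ℝ → H m := fun t => UH m (-t) (w t) - UH m (-t) (w' t) with hD
  set D' : ℝ → H m := fun t => (Complex.I * σ / t) • UH m (-t) (nl a (w t)) -
    (Complex.I * σ / t) • UH m (-t) (nl a (w' t)) with hD'
  have hder : ∀ t, t₀ ≤ t → HasDerivWithinAt D (D' t) (Ici t₀) t := fun t ht =>
    (hm t ht).sub (hm' t ht)
  have hDn : ∀ t, ‖D t‖ = ‖w t - w' t‖ := fun t => by
    rw [hD]; simp only; rw [← map_sub, LinearIsometry.norm_map]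
  have hD'n : ∀ t, t₀ ≤ t → ∀ μ, ‖mulH m (w t)‖ ≤ μ → ‖mulH m (w' t)‖ ≤ μ →
      ‖D' t‖ ≤ (2 * a ^ 2 + (6 * |a| * μ + 3 * μ ^ 2)) * t ^ (-1 : ℝ) * ‖D t‖ := by
    intro t ht μ h1 h2
    have hpos := ht₀.trans_le ht
    have e : D' t = (Complex.I * σ / t) • UH m (-t) (nl a (w t) - nl a (w' t)) := by
      rw [hD', map_sub, smul_sub]
    rw [e, norm_smul, LinearIsometry.norm_map, norm_coeff hσ hpos, hDn]
    have h3 := mul_le_mul_of_nonneg_left (norm_nl_sub_le a h1 h2) (Real.rpow_nonneg hpos.le (-1 : ℝ))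
    linarith
  have hcc : ∀ {w : ℝ → H m}, ContinuousOn w (Ici t₀) →
      ContinuousOn (fun t : ℝ => (Complex.I * σ / t) • UH m (-t) (nl a (w t))) (Ici t₀) := by
    intro w hw
    exact ((continuousOn_coeff σ).mono fun t ht => ht₀.trans_le ht).smul
      (continuousOn_UH_neg ((continuous_nl a).comp_continuousOn hw))
  have hc : ContinuousOn D' (Ici t₀) := (hcc hw).sub (hcc hw')
  set ν := ε + 2 ^ (m + 1) * M with hν
  -- For large times multiplication by either solution has norm `O(t^{-1/2})`, so only `2a² ≤ 1/8`
  -- remains. On the bounded interval before that no smallness is needed.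
  have hsmall : ∀ᶠ t : ℝ in atTop, 2 * a ^ 2 + (6 * |a| * (ν * t ^ (-(1 / 2) : ℝ)) +
      3 * (ν * t ^ (-(1 / 2) : ℝ)) ^ 2) ≤ 1 / 4 := by
    have h0 : Tendsto (fun t : ℝ => t ^ (-(1 / 2) : ℝ)) atTop (𝓝 0) :=
      tendsto_rpow_neg_atTop (by norm_num)
    have h1 : Tendsto (fun t : ℝ => 2 * a ^ 2 + (6 * |a| * (ν * t ^ (-(1 / 2) : ℝ)) +
      3 * (ν * t ^ (-(1 / 2) : ℝ)) ^ 2)) atTop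
        (𝓝 (2 * a ^ 2 + (6 * |a| * (ν * 0) + 3 * (ν * 0) ^ 2))) :=
      (((h0.const_mul ν).const_mul _).add (((h0.const_mul ν).pow 2).const_mul 3)).const_add _
    exact h1.eventually_le_const (by norm_num; linarith)
  obtain ⟨T, hT⟩ := eventually_atTop.1 (hb.and (hb'.and hsmall))
  set T' := max T t₀ with hT'
  have hT0 : t₀ ≤ T' := le_max_right _ _
  have hμ : ∀ t, T' ≤ t → ∀ v : H m, ‖v - prof σ a A t‖ ≤ M * t ^ (-(1 / 2) : ℝ) →
      ‖mulH m v‖ ≤ ν * t ^ (-(1 / 2) : ℝ) := by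
    intro t ht v hv
    have h1 := (norm_mulH_prof σ a A t).le.trans (hd t (hT0.trans ht))
    have h2 := norm_mulH_le (v - prof σ a A t)
    have h3 := mul_le_mul_of_nonneg_left hv (by positivity : (0 : ℝ) ≤ 2 ^ (m + 1))
    have h4 := norm_add_le (mulH m (prof σ a A t)) (mulH m (v - prof σ a A t))
    rw [← map_add, add_sub_cancel] at h4
    linarith
  have hright : ∀ t, T' ≤ t → D t = 0 := by
    intro t ht
    refine eq_zero_of_deriv_le_right (D' := D') (M := 2 * M) (ht₀.trans_le hT0)
      (fun τ hτ => (hder τ (hT0.trans hτ)).mono (Ici_subset_Ici.2 hT0))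
      (hc.mono (Ici_subset_Ici.2 hT0)) (fun τ hτ => ?_) (fun τ hτ => ?_) ht
    · obtain ⟨h1, h2, h3⟩ := hT τ ((le_max_left _ _).trans hτ)
      refine (hD'n τ (hT0.trans hτ) _ (hμ τ hτ _ h1) (hμ τ hτ _ h2)).trans ?_
      have := Real.rpow_nonneg (ht₀.trans_le (hT0.trans hτ)).le (-1 : ℝ)
      gcongr
    · obtain ⟨h1, h2, -⟩ := hT τ ((le_max_left _ _).trans hτ)
      rw [hDn, ← sub_sub_sub_cancel_right _ _ (prof σ a A τ)]
      linarith [norm_sub_le (w τ - prof σ a A τ) (w' τ - prof σ a A τ)]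
  have hDt : D t = 0 := by
    rcases le_total T' t with h | h
    · exact hright t h
    · obtain ⟨B, hB⟩ := (isCompact_Icc (a := t₀) (b := T')).exists_bound_of_continuousOn
        (hw.mono Icc_subset_Ici_self)
      obtain ⟨B', hB'⟩ := (isCompact_Icc (a := t₀) (b := T')).exists_bound_of_continuousOn
        (hw'.mono Icc_subset_Ici_self)
      set μ := 2 ^ (m + 1) * max B B' with hμd
      have hle : ∀ {v : H m}, ‖v‖ ≤ max B B' → ‖mulH m v‖ ≤ μ := fun hv =>
        (norm_mulH_le _).trans (mul_le_mul_of_nonneg_left hv (by positivity))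
      refine eq_zero_of_deriv_le_left (T := T') (hright _ le_rfl) hder
        (K := (2 * a ^ 2 + (6 * |a| * μ + 3 * μ ^ 2)) * t₀ ^ (-1 : ℝ)) (fun τ h1 h2 => ?_) ht h
      have hμ1 := hle ((hB τ ⟨h1, h2⟩).trans (le_max_left _ _))
      have hμ0 : 0 ≤ μ := (norm_nonneg _).trans hμ1
      refine (hD'n τ h1 μ hμ1 (hle ((hB' τ ⟨h1, h2⟩).trans (le_max_right _ _)))).trans ?_
      have := Real.rpow_le_rpow_of_nonpos (z := -1) ht₀ h1 (by norm_num)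
      gcongr
  have := sub_eq_zero.1 hDt
  exact (UH m (-t)).injective this

/-! ### Oscillatory integrals and the second antiderivative -/

lemma continuous_fourier {u : ℝ → ℂ} (hu : Integrable u) : Continuous (𝓕 u) :=
  VectorFourier.fourierIntegral_continuous Real.continuous_fourierChar continuous_inner hu

lemma continuous_fourierInv {u : ℝ → ℂ} (hu : Integrable u) : Continuous (𝓕⁻ u) := by
  rw [show 𝓕⁻ u = fun x => 𝓕 u (-x) from funext fun x => Real.fourierInv_eq_fourier_neg u x]
  exact (continuous_fourier hu).comp continuous_neg

lemma integral_fourier_mul {u v : ℝ → ℂ} (hu : Integrable u) (hv : Integrable v) :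
    ∫ x, 𝓕 u x * v x = ∫ x, u x * 𝓕 v x := by
  simpa using! VectorFourier.integral_fourierIntegral_smul_eq_flip (L := innerₗ ℝ)
      Real.continuous_fourierChar continuous_inner hu hv

lemma integral_fourierInv_mul {u v : ℝ → ℂ} (hu : Integrable u) (hv : Integrable v) :
    ∫ x, 𝓕⁻ u x * v x = ∫ x, u x * 𝓕⁻ v x := by
  have e : ∀ f : ℝ → ℂ, ∀ x, 𝓕⁻ f x = 𝓕 (fun y => f (-y)) x := fun f x => by
    rw [Real.fourierInv_eq_fourier_comp_neg]
  have e2 : ∀ x, 𝓕⁻ v x = 𝓕 v (-x) := Real.fourierInv_eq_fourier_neg v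
  simp only [e u]
  rw [integral_fourier_mul hu.comp_neg hv, ← integral_neg_eq_self]
  simp only [neg_neg, e2]

/-- The Fourier transforms on `L¹` and on `L²` agree. -/
lemma fourier_L2_ae {f : L2} {u : ℝ → ℂ} (hu : Integrable u) (h : u =ᵐ[volume] f) :
    ((𝓕 f : L2) : ℝ → ℂ) =ᵐ[volume] 𝓕 u := by
  refine ae_eq_of_integral_schwartz (L2.locallyIntegrable _)
    (continuous_fourier hu).locallyIntegrable fun φ => ?_
  rw [← pair_sL, pair_fourier, pair_sL, integral_fourier_mul hu φ.integrable]
  refine integral_congr_ae ?_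
  filter_upwards [h] with x hx
  rw [hx, SchwartzMap.fourier_coe]

lemma norm_fourier_symbol (ξ : ℝ) : ‖(2 * Real.pi * Complex.I * (ξ : ℂ))‖ = 2 * Real.pi * |ξ| := by
  simp [abs_of_pos Real.pi_pos]

lemma memLp_jap : MemLp (fun ξ => (jap ξ : ℂ)) 2 volume := by
  refine (memLp_two_iff_integrable_sq_norm
    (Complex.continuous_ofReal.comp jap_continuous).aestronglyMeasurable).2 ?_
  refine integrable_inv_one_add_sq.congr (Eventually.of_forall fun ξ => ?_)
  change (1 + ξ ^ 2)⁻¹ = ‖(jap ξ : ℂ)‖ ^ 2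
  rw [Complex.norm_real, Real.norm_of_nonneg (jap_pos ξ).le, jap_eq, inv_pow,
    Real.sq_sqrt (by positivity)]

/-- The transform is `⟨ξ⟩^{-1}` times `⟨ξ⟩û`, a product of two `L²` functions, because `u` has one
derivative in `L²`. -/
lemma integrable_fourier {F : H m} (hm : 1 ≤ m) {u : ℝ → ℂ} (hu : Integrable u)
    (h : u =ᵐ[volume] cp 0 F) : Integrable (𝓕 u) := by
  have h1 := (Lp.memLp (𝓕 (cp 0 F) : L2)).norm.add (Lp.memLp (𝓕 (cp 1 F) : L2)).norm
  have h2 : Integrable (fun ξ => ‖(jap ξ : ℂ)‖ *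
      (‖(𝓕 (cp 0 F) : L2) ξ‖ + ‖(𝓕 (cp 1 F) : L2) ξ‖)) := memLp_jap.norm.integrable_mul h1
  refine h2.mono' (continuous_fourier hu).aestronglyMeasurable ?_
  filter_upwards [fourier_L2_ae hu h, fourier_cp hm F] with ξ h3 h4
  rw [h4, h3, pow_one, norm_mul, norm_fourier_symbol, Complex.norm_real,
    Real.norm_of_nonneg (jap_pos ξ).le]
  have h5 : (jap ξ)⁻¹ ≤ 1 + 2 * Real.pi * |ξ| := by
    refine (inv_jap_le ξ).trans ?_
    nlinarith [Real.pi_gt_three, abs_nonneg ξ]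
  have h6 : 1 ≤ jap ξ * (1 + 2 * Real.pi * |ξ|) := by
    rwa [inv_le_iff_one_le_mul₀ (jap_pos ξ), mul_comm] at h5
  nlinarith [mul_le_mul_of_nonneg_right h6 (norm_nonneg (𝓕 u ξ))]

/-- The free evolution as an oscillatory integral is the one on `L²`. -/
lemma freeSchrodinger_ae {F : H m} (hm : 1 ≤ m) {u : ℝ → ℂ} (hu : Integrable u)
    (h : u =ᵐ[volume] cp 0 F) (t : ℝ) : freeSchrodinger t u =ᵐ[volume] cp 0 (UH m t F) := by
  have hi : Integrable (fun ξ : ℝ => sym t ξ * 𝓕 u ξ) := by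
    refine (integrable_fourier hm hu h).norm.mono' ((sym_continuous t).mul
      (continuous_fourier hu)).aestronglyMeasurable (Eventually.of_forall fun ξ => ?_)
    rw [norm_mul, norm_sym, one_mul]
  change 𝓕⁻ (fun ξ : ℝ => sym t ξ * 𝓕 u ξ) =ᵐ[volume] _
  refine ae_eq_of_integral_schwartz (continuous_fourierInv hi).locallyIntegrable
    (L2.locallyIntegrable _) fun φ => ?_
  rw [integral_fourierInv_mul hi φ.integrable, ← pair_sL, cp_UH (Nat.zero_le m), pair_U, pair_sL]
  have e : ∀ ψ : 𝓢(ℝ, ℂ), ∀ ξ, 𝓕⁻ ψ ξ = 𝓕 ψ (-ξ) := by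
    intro ψ ξ
    rw [SchwartzMap.fourierInv_coe, SchwartzMap.fourier_coe, Real.fourierInv_eq_fourier_neg]
  have e1 : ∫ x, cp 0 F x * US t φ x = ∫ x, u x * 𝓕 (𝓕⁻ (US t φ) : 𝓢(ℝ, ℂ)) x := by
    rw [FourierTransform.fourier_fourierInv_eq]
    refine integral_congr_ae ?_
    filter_upwards [h] with x hx
    rw [hx]
  rw [e1, SchwartzMap.fourier_coe, ← integral_fourier_mul hu (SchwartzMap.integrable _)]
  refine integral_congr_ae (Eventually.of_forall fun ξ => ?_)
  simp only [e, fourier_US]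
  rw [← SchwartzMap.fourierInv_coe, e, show sym t (-ξ) = sym t ξ by
    simp only [sym]; push_cast; ring_nf]
  ring

/-- An element of `H^{m+2}` from its derivatives of order `0`, `1` and `2 + j`, `j ≤ m`. -/
lemma exists_shiftH_two_eq (F : H m) {A0 A1 : L2} {C : ℝ}
    (h1 : ((𝓕 A1 : L2) : ℝ → ℂ) =ᵐ[volume]
      fun ξ => (2 * Real.pi * Complex.I * ξ) * (𝓕 A0 : L2) ξ)
    (h2 : ((𝓕 (cp 0 F) : L2) : ℝ → ℂ) =ᵐ[volume]
      fun ξ => (2 * Real.pi * Complex.I * ξ) ^ 2 * (𝓕 A0 : L2) ξ)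
    (hA0 : ‖A0‖ ≤ C) (hA1 : ‖A1‖ ≤ C) (hF : ‖F‖ ≤ C) :
    ∃ A : H (m + 2), shiftH m 2 (by omega) A = F ∧ ‖A‖ ≤ C := by
  obtain ⟨f, f0, f1, f2⟩ : ∃ f : ℕ → L2, f 0 = A0 ∧ f 1 = A1 ∧ ∀ j, f (j + 2) = cp j F :=
    ⟨fun k => match k with
      | 0 => A0
      | 1 => A1
      | j + 2 => cp j F, rfl, rfl, fun _ => rfl⟩
  have hfk : ∀ k ≤ m + 2, ((𝓕 (f k) : L2) : ℝ → ℂ) =ᵐ[volume]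
      fun ξ => (2 * Real.pi * Complex.I * ξ) ^ k * (𝓕 (f 0) : L2) ξ := by
    intro k hk
    rw [f0]
    match k with
    | 0 => rw [f0]; simp
    | 1 => rw [f1]; simpa only [pow_one] using h1
    | j + 2 =>
      rw [f2]
      filter_upwards [fourier_cp (k := j) (by omega) F, h2] with ξ h3 h4
      rw [h3, h4]; ring
  refine ⟨mkH (m + 2) f fun k hk φ => pair_eq_of_fourier (hfk k hk) φ, H_ext ?_, ?_⟩
  · rw [cp_shiftH _ (Nat.zero_le m), cp_mkH (by omega)]
    exact f2 0
  · refine norm_H_le ((norm_nonneg F).trans hF) fun k hk => ?_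
    rw [cp_mkH hk]
    match k with
    | 0 => rwa [f0]
    | 1 => rwa [f1]
    | j + 2 => rw [f2]; exact (norm_cp_le j F).trans hF

lemma eLpNorm_le_add_of_ae {f g h : ℝ → ℂ} (hg : AEStronglyMeasurable g volume)
    (hh : AEStronglyMeasurable h volume) (hb : ∀ᵐ x, ‖f x‖ ≤ ‖g x‖ + ‖h x‖) :
    eLpNorm f 2 volume ≤ eLpNorm g 2 volume + eLpNorm h 2 volume := by
  have h1 : eLpNorm f 2 volume ≤ eLpNorm (fun x => ‖g x‖ + ‖h x‖) 2 volume := by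
    refine eLpNorm_mono_ae ?_
    filter_upwards [hb] with x hx
    rwa [Real.norm_of_nonneg (by positivity)]
  have h2 := eLpNorm_add_le (p := 2) hg.norm hh.norm (by norm_num)
  rw [eLpNorm_norm, eLpNorm_norm] at h2
  exact h1.trans h2

/-- A function in `Ḣ^{-2} ∩ H^m` is the second derivative of a function in `H^{m+2}`. -/
lemma exists_second_antiderivative {F : H m} {u : ℝ → ℂ} (hu : Integrable u)
    (h : u =ᵐ[volume] cp 0 F) (hfin : homNegTwoENorm u < ∞) :
    ∃ A : H (m + 2), shiftH m 2 (by omega) A = F ∧ ‖A‖ ≤ (homNegTwoENorm u).toReal + ‖F‖ := by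
  obtain ⟨g, hg⟩ : ∃ g : ℝ → ℂ, g = fun ξ : ℝ => (((2 * Real.pi * ξ) ^ 2)⁻¹ : ℂ) * 𝓕 u ξ :=
    ⟨_, rfl⟩
  have hgn : eLpNorm g 2 volume = homNegTwoENorm u := by rw [hg, homNegTwoENorm]
  have hgm : MemLp g 2 volume := by
    refine ⟨?_, hgn.trans_lt hfin⟩
    rw [hg]
    refine AEStronglyMeasurable.mul ?_ (continuous_fourier hu).aestronglyMeasurable
    exact Measurable.aestronglyMeasurable (by fun_prop)
  have hu2 : ∀ᵐ ξ : ℝ, (𝓕 (cp 0 F) : L2) ξ = (2 * Real.pi * ξ) ^ 2 * g ξ := by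
    have hne : ∀ᵐ ξ : ℝ, ξ ≠ 0 := by simp [ae_iff]
    filter_upwards [fourier_L2_ae hu h, hne] with ξ h1 h2
    have h3 : (ξ : ℂ) ≠ 0 := by exact_mod_cast h2
    have hpi : (Real.pi : ℂ) ≠ 0 := by exact_mod_cast Real.pi_ne_zero
    rw [h1, hg]
    field_simp
  -- Interpolation between the weights: `|η| ≤ 1 + η²` controls the first derivative of the
  -- antiderivative by the other two.
  have hbound : ∀ᵐ ξ : ℝ, ‖(2 * Real.pi * Complex.I * (ξ : ℂ)) * g ξ‖ ≤
      ‖g ξ‖ + ‖(𝓕 (cp 0 F) : L2) ξ‖ := by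
    filter_upwards [hu2] with ξ h1
    have h4 : ‖(2 * Real.pi * ξ : ℂ)‖ = 2 * Real.pi * |ξ| := by simp [abs_of_pos Real.pi_pos]
    rw [h1, norm_mul, norm_fourier_symbol, norm_mul, norm_pow, h4]
    nlinarith [norm_nonneg (g ξ), sq_nonneg (2 * Real.pi * |ξ| - 1)]
  have hg1m : MemLp (fun ξ : ℝ => (2 * Real.pi * Complex.I * (ξ : ℂ)) * g ξ) 2 volume := by
    refine (hgm.norm.add (Lp.memLp (𝓕 (cp 0 F) : L2)).norm).of_le
      ((Continuous.aestronglyMeasurable (by fun_prop)).mul hgm.1) ?_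
    filter_upwards [hbound] with ξ h1
    rw [Pi.add_apply, Real.norm_of_nonneg (by positivity)]
    exact h1
  -- The minus sign is there because `∂_s²` has symbol `(iη)² = -η²`.
  have e0 : (𝓕 (𝓕⁻ (-hgm.toLp : L2) : L2) : L2) = -hgm.toLp :=
    FourierTransform.fourier_fourierInv_eq _
  have e1 : (𝓕 (𝓕⁻ (-hg1m.toLp : L2) : L2) : L2) = -hg1m.toLp :=
    FourierTransform.fourier_fourierInv_eq _
  refine exists_shiftH_two_eq F (A0 := 𝓕⁻ (-hgm.toLp : L2)) (A1 := 𝓕⁻ (-hg1m.toLp : L2)) ?_ ?_ ?_ ?_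
    (le_add_of_nonneg_left ENNReal.toReal_nonneg)
  · rw [e0, e1]
    filter_upwards [Lp.coeFn_neg hgm.toLp, hgm.coeFn_toLp, Lp.coeFn_neg hg1m.toLp,
      hg1m.coeFn_toLp] with ξ h1 h2 h3 h4
    rw [h1, h3, Pi.neg_apply, Pi.neg_apply, h2, h4]
    ring
  · rw [e0]
    filter_upwards [Lp.coeFn_neg hgm.toLp, hgm.coeFn_toLp, hu2] with ξ h1 h2 h3
    rw [h1, h3, Pi.neg_apply, h2]
    linear_combination (2 * Real.pi * (ξ : ℂ)) ^ 2 * g ξ * Complex.I_sq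
  · rw [← Lp.norm_fourier_eq, e0, norm_neg, Lp.norm_toLp, hgn]
    exact le_add_of_nonneg_right (norm_nonneg F)
  · rw [← Lp.norm_fourier_eq, e1, norm_neg, Lp.norm_toLp]
    have h1 := eLpNorm_le_add_of_ae hgm.1 (Lp.aestronglyMeasurable (𝓕 (cp 0 F) : L2)) hbound
    rw [hgn] at h1
    have h2 := ENNReal.toReal_mono (ENNReal.add_ne_top.2 ⟨hfin.ne, Lp.eLpNorm_ne_top _⟩) h1
    rw [ENNReal.toReal_add hfin.ne (Lp.eLpNorm_ne_top _), ← Lp.norm_def, Lp.norm_fourier_eq] at h2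
    exact h2.trans (add_le_add le_rfl (norm_cp_le 0 F))

/-! ### The Sobolev norms of the statement in terms of `H^m` -/

lemma isWeakDeriv_cp {F : H m} {f : ℝ → ℂ} (hf : f =ᵐ[volume] cp 0 F) {k : ℕ} (hk : k ≤ m) :
    IsWeakDeriv 2 k f (cp k F) := by
  refine ⟨(memLp_congr_ae hf).2 (Lp.memLp _), Lp.memLp _, fun φ => ?_⟩
  have h : ∫ s, f s * iteratedDeriv k φ s = pair (cp 0 F) (sL (dS k φ)) := by
    rw [pair_sL, dS_coe]
    refine integral_congr_ae ?_
    filter_upwards [hf] with x hx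
    rw [hx]
  rw [h, ← pair_sL, pair_cp hk, ← mul_assoc, ← mul_pow]
  simp

/-- Uniqueness of weak derivatives. -/
lemma IsWeakDeriv.ae_eq {p q : ℝ≥0∞} (hp : 1 ≤ p) (hq : 1 ≤ q) {k : ℕ} {f f' g g' : ℝ → ℂ}
    (h : IsWeakDeriv p k f g) (h' : IsWeakDeriv q k f' g') (hf : f =ᵐ[volume] f') :
    g =ᵐ[volume] g' := by
  refine ae_eq_of_integral_schwartz (h.2.1.locallyIntegrable hp) (h'.2.1.locallyIntegrable hq)
    fun φ => ?_
  have h1 := h.2.2 φ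
  have h2 := h'.2.2 φ
  have h3 : ∫ s, f s * iteratedDeriv k φ s = ∫ s, f' s * iteratedDeriv k φ s := by
    refine integral_congr_ae ?_
    filter_upwards [hf] with x hx
    rw [hx]
  rw [h3, h2] at h1
  exact mul_left_cancel₀ (pow_ne_zero k (by norm_num)) h1.symm

lemma eLpNorm_L2 (f : L2) : eLpNorm f 2 volume = ENNReal.ofReal ‖f‖ := by
  rw [Lp.norm_def, ENNReal.ofReal_toReal (Lp.eLpNorm_ne_top f)]

lemma derivENorm_eq {F : H m} {f : ℝ → ℂ} (hf : f =ᵐ[volume] cp 0 F) {k : ℕ} (hk : k ≤ m) :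
    derivENorm 2 k f = ENNReal.ofReal ‖cp k F‖ := by
  rw [← eLpNorm_L2]
  refine le_antisymm (iInf₂_le _ (isWeakDeriv_cp hf hk)) (le_iInf₂ fun g hg => ?_)
  exact (eLpNorm_congr_ae ((isWeakDeriv_cp hf hk).ae_eq (by norm_num) (by norm_num) hg
    (EventuallyEq.refl _ f))).le

lemma exists_isWeakDeriv {p c : ℝ≥0∞} {k : ℕ} {f : ℝ → ℂ} (h : derivENorm p k f < c) :
    ∃ g, IsWeakDeriv p k f g ∧ eLpNorm g p volume < c := by
  simpa [derivENorm, iInf_lt_iff] using h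

lemma derivENorm_le_sobolevENorm {p : ℝ≥0∞} {f : ℝ → ℂ} {k : ℕ} (hk : k ≤ m) :
    derivENorm p k f ≤ sobolevENorm m p f :=
  Finset.single_le_sum (f := fun k => derivENorm p k f) (fun _ _ => zero_le)
    (Finset.mem_range.2 (Nat.lt_succ_of_le hk))

lemma exists_H {f : ℝ → ℂ} (h : sobolevENorm m 2 f < ∞) : ∃ F : H m, f =ᵐ[volume] cp 0 F := by
  have hg : ∀ k, ∃ g : L2, k ≤ m → ∀ φ : 𝓢(ℝ, ℂ),
      pair g (sL φ) = (-1) ^ k * ∫ s, f s * dS k φ s := by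
    intro k
    by_cases hk : k ≤ m
    · obtain ⟨g, hg, -⟩ := exists_isWeakDeriv ((derivENorm_le_sobolevENorm hk).trans_lt h)
      refine ⟨hg.2.1.toLp, fun _ φ => ?_⟩
      rw [dS_coe, hg.2.2 φ, ← mul_assoc, ← mul_pow, pair_sL]
      simp only [mul_neg, mul_one, neg_neg, one_pow, one_mul]
      refine integral_congr_ae ?_
      filter_upwards [hg.2.1.coeFn_toLp] with x hx
      rw [hx]
    · exact ⟨0, fun h => absurd h hk⟩
  choose g hg using hg
  have hf : MemLp f 2 volume := by
    obtain ⟨_, h1, -⟩ := exists_isWeakDeriv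
      ((derivENorm_le_sobolevENorm (k := 0) (Nat.zero_le m)).trans_lt h)
    exact h1.1
  refine ⟨mkH m g fun k hk φ => ?_, ?_⟩
  · rw [hg k hk, hg 0 (Nat.zero_le m), dS_zero]; simp
  · rw [cp_mkH (Nat.zero_le m)]
    refine ae_eq_of_integral_schwartz (hf.locallyIntegrable (by norm_num))
      (L2.locallyIntegrable _) fun φ => ?_
    rw [← pair_sL, hg 0 (Nat.zero_le m), dS_zero]; simp

lemma sobolevENorm_le {F : H m} {f : ℝ → ℂ} (hf : f =ᵐ[volume] cp 0 F) :
    sobolevENorm m 2 f ≤ (m + 1 : ℕ) * ENNReal.ofReal ‖F‖ := by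
  have : ∀ k ∈ Finset.range (m + 1), derivENorm 2 k f ≤ ENNReal.ofReal ‖F‖ := fun k hk => by
    rw [derivENorm_eq hf (Nat.lt_succ_iff.1 (Finset.mem_range.1 hk))]
    exact ENNReal.ofReal_le_ofReal (norm_cp_le k F)
  simpa [sobolevENorm] using Finset.sum_le_card_nsmul _ _ _ this

lemma norm_le_sobolevENorm {F : H m} {f : ℝ → ℂ} (hf : f =ᵐ[volume] cp 0 F)
    (hfin : sobolevENorm m 2 f < ∞) : ‖F‖ ≤ (sobolevENorm m 2 f).toReal := by
  refine norm_H_le ENNReal.toReal_nonneg fun k hk => ?_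
  refine (ENNReal.ofReal_le_iff_le_toReal hfin.ne).1 ?_
  rw [← derivENorm_eq hf hk]
  exact derivENorm_le_sobolevENorm hk

lemma continuousInH_iff {t₀ : ℝ} {r : ℝ → ℝ → ℂ} {R : ℝ → H m}
    (h : ∀ t, t₀ ≤ t → r t =ᵐ[volume] cp 0 (R t)) :
    ContinuousInH m t₀ r ↔ ContinuousOn R (Ici t₀) := by
  have hfin : ∀ {F : H m} {f : ℝ → ℂ}, f =ᵐ[volume] cp 0 F → sobolevENorm m 2 f < ∞ := fun hf =>
    (sobolevENorm_le hf).trans_lt (ENNReal.mul_lt_top (by simp) ENNReal.ofReal_lt_top)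
  have hsub : ∀ t τ, t₀ ≤ t → t₀ ≤ τ → r τ - r t =ᵐ[volume] cp 0 (R τ - R t) := by
    intro t τ ht hτ
    rw [map_sub]
    filter_upwards [h t ht, h τ hτ, Lp.coeFn_sub (cp 0 (R τ)) (cp 0 (R t))] with x h1 h2 h3
    rw [h3, Pi.sub_apply, Pi.sub_apply, h1, h2]
  refine ⟨fun hc t ht => ?_, fun hc => ⟨fun t ht => hfin (h t ht), fun t ht => ?_⟩⟩
  · rw [ContinuousWithinAt, tendsto_iff_norm_sub_tendsto_zero]
    have h1 := (ENNReal.tendsto_toReal ENNReal.zero_ne_top).comp (hc.2 t ht)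
    refine squeeze_zero' (Eventually.of_forall fun _ => norm_nonneg _) ?_ h1
    filter_upwards [self_mem_nhdsWithin] with τ hτ
    exact norm_le_sobolevENorm (hsub t τ ht hτ) (hfin (hsub t τ ht hτ))
  · have h1 := tendsto_iff_norm_sub_tendsto_zero.1 (hc t ht)
    have h2 := ENNReal.Tendsto.const_mul (a := ((m + 1 : ℕ) : ℝ≥0∞)) (ENNReal.tendsto_ofReal h1)
      (Or.inr (ENNReal.natCast_ne_top _))
    rw [ENNReal.ofReal_zero, mul_zero] at h2
    refine tendsto_of_tendsto_of_tendsto_of_le_of_le' tendsto_const_nhds h2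
      (Eventually.of_forall fun _ => zero_le) ?_
    filter_upwards [self_mem_nhdsWithin] with τ hτ
    exact sobolevENorm_le (hsub t τ ht hτ)

/-- Weak derivatives in `L¹` and in `L²` agree almost everywhere. So the `L²` components are
integrable, as the dispersive estimate requires for every derivative. -/
lemma integral_norm_cp_le {F : H m} {f : ℝ → ℂ} (hf : f =ᵐ[volume] cp 0 F) {ε : ℝ}
    (h : sobolevENorm m 1 f < ENNReal.ofReal ε) {k : ℕ} (hk : k ≤ m) :
    Integrable (cp k F) ∧ ∫ x, ‖cp k F x‖ ≤ ε := by
  obtain ⟨g, hg, hn⟩ := exists_isWeakDeriv ((derivENorm_le_sobolevENorm hk).trans_lt h)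
  have hae : g =ᵐ[volume] cp k F :=
    hg.ae_eq (by norm_num) (by norm_num) (isWeakDeriv_cp hf hk) (EventuallyEq.refl _ f)
  have hi : Integrable (cp k F) := (memLp_one_iff_integrable.1 hg.2.1).congr hae
  refine ⟨hi, ?_⟩
  rw [eLpNorm_congr_ae hae, eLpNorm_one_eq_lintegral_enorm] at hn
  rw [integral_norm_eq_lintegral_enorm hi.1]
  have hε : 0 ≤ ε := by
    by_contra hε
    rw [ENNReal.ofReal_of_nonpos (by linarith)] at hn
    exact absurd hn (by simp)
  exact ENNReal.toReal_le_of_le_ofReal hε hn.le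

/-- Decay of the free evolution as a multiplication operator on `H^m`. -/
lemma norm_mulH_fr_le [Fact (1 ≤ m)] {A : H (m + 2)} {F : H m} (hA : shiftH m 2 (by omega) A = F)
    {ε : ℝ} (hε : 0 ≤ ε) (h : ∀ k ≤ m, Integrable (cp k F) ∧ ∫ x, ‖cp k F x‖ ≤ ε) {t : ℝ}
    (ht : 0 < t) : ‖mulH m (fr A t)‖ ≤ 2 ^ m * ε * t ^ (-(1 / 2) : ℝ) := by
  have hr := Real.rpow_nonneg ht.le (-(1 / 2) : ℝ)
  rw [mul_assoc]
  refine norm_mulH_le_of_ae (by positivity) fun k hk => ?_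
  rw [fr, hA, cp_UH hk]
  filter_upwards [dispersive t ht (cp k F) (h k hk).1] with x hx
  refine hx.trans ?_
  have h1 : (4 * Real.pi * t) ^ (-(1 / 2) : ℝ) ≤ t ^ (-(1 / 2) : ℝ) :=
    Real.rpow_le_rpow_of_nonpos ht (by nlinarith [Real.pi_gt_three]) (by norm_num)
  rw [mul_comm ε]
  exact mul_le_mul h1 (h k hk).2 (integral_nonneg fun _ => norm_nonneg _) hr

/-! ### The statement's notion of solution in mild form -/

/-- Removes the constant `a` of `v = a + w` from the term `v_ss`, although `a` is not in `L²`. -/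
lemma integral_dS_two (φ : 𝓢(ℝ, ℂ)) : ∫ s, dS 2 φ s = 0 := by
  have h : ∀ s, HasDerivAt (dS 1 φ) (dS 2 φ s) s := fun s => by
    rw [show dS 2 φ = dS 1 (dS 1 φ) from (dS_dS 1 1 φ).symm, dS_one_coe (dS 1 φ)]
    exact (dS 1 φ).differentiableAt.hasDerivAt
  exact integral_eq_zero_of_hasDerivAt_of_integrable h (dS 2 φ).integrable (dS 1 φ).integrable

lemma integral_const_add_mul {f : ℝ → ℂ} {a : ℂ} {w : H m} (h : f =ᵐ[volume] fun s => a + cp 0 w s)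
    (φ : 𝓢(ℝ, ℂ)) : ∫ s, f s * φ s = a * (∫ s, φ s) + tst m φ w := by
  have hi : Integrable (fun s => cp 0 w s * φ s) :=
    (Lp.memLp (cp 0 w)).integrable_mul (φ.memLp 2)
  rw [tst_apply, pair_sL, ← integral_const_mul, ← integral_add (φ.integrable.const_mul a) hi]
  refine integral_congr_ae ?_
  filter_upwards [h] with s hs
  rw [hs]; ring

lemma nl_ae [Fact (1 ≤ m)] (a : ℝ) (w : H m) : (cp 0 (nl a w) : ℝ → ℂ) =ᵐ[volume] fun s =>
    ((‖a + cp 0 w s‖ ^ 2 - a ^ 2 : ℝ) : ℂ) * (a + cp 0 w s) := by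
  have e : cp 0 (nl a w) = (a ^ 2 : ℂ) • (cp 0 w + conjL (cp 0 w)) +
      ((2 * a : ℂ) • cp 0 (mulH m w (cj m w)) + (a : ℂ) • cp 0 (mulH m w w) +
        cp 0 (mulH m w (mulH m w (cj m w)))) := by
    simp only [nl, Bn, map_add, map_smul, cp_cj (Nat.zero_le m)]
  rw [e]
  have hc : (cp 0 (cj m w) : ℝ → ℂ) =ᵐ[volume] fun x => (starRingEnd ℂ) (cp 0 w x) := by
    rw [cp_cj (Nat.zero_le m)]; exact conjL_ae _
  set X := cp 0 w + conjL (cp 0 w) with hX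
  set Y := cp 0 (mulH m w (cj m w)) with hY
  set Z := cp 0 (mulH m w w) with hZ
  set V := cp 0 (mulH m w (mulH m w (cj m w))) with hV
  filter_upwards [hc, conjL_ae (cp 0 w), Lp.coeFn_add (cp 0 w) (conjL (cp 0 w)),
    mulH_ae w (cj m w), mulH_ae w w, mulH_ae w (mulH m w (cj m w)),
    Lp.coeFn_smul (a ^ 2 : ℂ) X, Lp.coeFn_smul (2 * a : ℂ) Y, Lp.coeFn_smul (a : ℂ) Z,
    Lp.coeFn_add ((a ^ 2 : ℂ) • X) ((2 * a : ℂ) • Y + (a : ℂ) • Z + V),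
    Lp.coeFn_add ((2 * a : ℂ) • Y + (a : ℂ) • Z) V,
    Lp.coeFn_add ((2 * a : ℂ) • Y) ((a : ℂ) • Z)] with s h1 h2 h3 h4 h5 h6 h7 h8 h9 h10 h11 h12
  rw [h10, Pi.add_apply, h11, Pi.add_apply, h12, Pi.add_apply, h7, h8, h9]
  simp only [Pi.smul_apply, smul_eq_mul]
  rw [h3, Pi.add_apply, h2, h4, h5, h6, h4, h1]
  push_cast
  rw [← Complex.conj_mul', map_add, Complex.conj_ofReal]
  ring

lemma memLp_top_const_add (hm : 1 ≤ m) {f : ℝ → ℂ} {a : ℂ} {w : H m}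
    (h : f =ᵐ[volume] fun s => a + cp 0 w s) : MemLp f ∞ volume := by
  rw [memLp_congr_ae h]
  refine memLp_top_of_bound (aestronglyMeasurable_const.add (Lp.aestronglyMeasurable _))
    (‖a‖ + 2 * ‖w‖) ?_
  filter_upwards [sobolev_embedding (j := 0) hm w] with s hs
  exact (norm_add_le _ _).trans (add_le_add le_rfl hs)

/-- The equation in `H^m` for `w`, when `v = a + w`. -/
lemma isSolution_iff_mild [Fact (1 ≤ m)] {σ a t₀ : ℝ} (ht₀ : 0 < t₀) {v : ℝ → ℝ → ℂ} {w : ℝ → H m}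
    (hw : ContinuousOn w (Ici t₀))
    (h : ∀ t, t₀ ≤ t → v t =ᵐ[volume] fun s => a + cp 0 (w t) s) :
    IsSolution σ a t₀ v ↔ ∀ t, t₀ ≤ t → HasDerivWithinAt (fun t => UH m (-t) (w t))
      ((Complex.I * σ / t) • UH m (-t) (nl a (w t))) (Ici t₀) t := by
  have e : ∀ φ : 𝓢(ℝ, ℂ), ∀ t, t₀ ≤ t →
      Complex.I * ((∫ s, v t s * iteratedDeriv 2 φ s) + ((σ / t : ℝ) : ℂ) *
        ∫ s, ((‖v t s‖ ^ 2 - a ^ 2 : ℝ) : ℂ) * v t s * φ s) =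
      Complex.I * tst m (dS 2 φ) (w t) + tst m φ ((Complex.I * σ / t : ℂ) • nl a (w t)) := by
    intro φ t ht
    have h1 := integral_const_add_mul (h t ht) (dS 2 φ)
    rw [integral_dS_two, mul_zero, zero_add, dS_coe] at h1
    have h2 : ∫ s, ((‖v t s‖ ^ 2 - a ^ 2 : ℝ) : ℂ) * v t s * φ s = tst m φ (nl a (w t)) := by
      rw [tst_apply, pair_sL]
      refine integral_congr_ae ?_
      filter_upwards [h t ht, nl_ae a (w t)] with s h3 h4
      rw [h3, h4]
    rw [h1, h2, map_smul, smul_eq_mul]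
    push_cast
    ring
  have hder : ∀ φ : 𝓢(ℝ, ℂ), ∀ t, t₀ ≤ t → ∀ D,
      HasDerivWithinAt (fun τ => ∫ s, v τ s * φ s) D (Ici t₀) t ↔
        HasDerivWithinAt (fun τ => tst m φ (w τ)) D (Ici t₀) t := by
    intro φ t ht D
    have hc : ∀ τ, t₀ ≤ τ → ∫ s, v τ s * φ s = a * (∫ s, φ s) + tst m φ (w τ) :=
      fun τ hτ => integral_const_add_mul (h τ hτ) φ
    rw [← hasDerivWithinAt_const_add_iff ((a : ℂ) * ∫ s, φ s) (f := fun τ => tst m φ (w τ))]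
    exact ⟨fun h => h.congr (fun τ hτ => (hc τ hτ).symm) (hc t ht).symm,
      fun h => h.congr hc (hc t ht)⟩
  constructor
  · intro hs t ht
    have hG : ContinuousOn (fun t : ℝ => (Complex.I * σ / t : ℂ) • nl a (w t)) (Ici t₀) :=
      ((continuousOn_coeff σ).mono fun t ht => ht₀.trans_le ht).smul
        ((continuous_nl a).comp_continuousOn hw)
    have := mild_of_weak hw hG (fun φ t ht => by
      rw [← hder φ t ht, ← e φ t ht]; exact hs.2 φ t ht) t ht
    rwa [map_smul] at this
  · intro hmild
    refine ⟨fun t ht => memLp_top_const_add Fact.out (h t ht), fun φ t ht => ?_⟩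
    rw [hder φ t ht, e φ t ht]
    exact weak_of_mild (G := fun t : ℝ => (Complex.I * σ / t : ℂ) • nl a (w t))
      ((hmild t ht).congr_deriv (map_smul _ _ _).symm) φ

/-- The asymptotic solutions in terms of the remainder. -/
lemma isAsymptoticSolution_iff [Fact (1 ≤ m)] {σ a t₀ : ℝ} (ht₀ : 0 < t₀) {u : ℝ → ℂ}
    {A : H (m + 2)} (hu : ∀ t, freeSchrodinger t u =ᵐ[volume] cp 0 (fr A t)) {v : ℝ → ℝ → ℂ}
    {r : ℝ → H m} (h : ∀ t, t₀ ≤ t → v t - profile σ a u t =ᵐ[volume] cp 0 (r t)) :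
    IsAsymptoticSolution σ a t₀ m u v ↔ ContinuousOn r (Ici t₀) ∧
      (∀ t, t₀ ≤ t → HasDerivWithinAt (fun t => UH m (-t) (prof σ a A t + r t))
        ((Complex.I * σ / t) • UH m (-t) (nl a (prof σ a A t + r t))) (Ici t₀) t) ∧
      (∃ C : ℝ, ∀ᶠ t : ℝ in atTop, ‖cp 0 (r t)‖ ≤ C * t ^ (-(1 / 2) : ℝ)) ∧
      ∀ k, 0 < k → k ≤ m → ∃ C : ℝ, ∀ᶠ t : ℝ in atTop, ‖cp k (r t)‖ ≤ C * t ^ (-1 : ℝ) := by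
  have hv : ∀ t, t₀ ≤ t → v t =ᵐ[volume] fun s => a + cp 0 (prof σ a A t + r t) s := by
    intro t ht
    rw [prof, map_add, map_smul]
    filter_upwards [h t ht, hu t, Lp.coeFn_add (ph (σ * a ^ 2) t • cp 0 (fr A t)) (cp 0 (r t)),
      Lp.coeFn_smul (ph (σ * a ^ 2) t) (cp 0 (fr A t))] with s h1 h2 h3 h4
    rw [h3, Pi.add_apply, h4, Pi.smul_apply, ← h1, ← h2, Pi.sub_apply, profile, ph, smul_eq_mul]
    ring
  have hrate : ∀ k, k ≤ m → ∀ p : ℝ,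
      (∃ C : ℝ, ∀ᶠ t : ℝ in atTop,
        derivENorm 2 k (v t - profile σ a u t) ≤ ENNReal.ofReal (C * t ^ p)) ↔
      ∃ C : ℝ, ∀ᶠ t : ℝ in atTop, ‖cp k (r t)‖ ≤ C * t ^ p := by
    intro k hk p
    constructor
    · rintro ⟨C, hC⟩
      -- `ENNReal.ofReal` sends negative numbers to zero, so a negative `C` has to be replaced.
      refine ⟨max C 0, ?_⟩
      filter_upwards [hC, eventually_ge_atTop t₀] with t h1 h2
      have h3 := Real.rpow_nonneg (ht₀.trans_le h2).le p
      rw [derivENorm_eq (h t h2) hk] at h1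
      refine (ENNReal.ofReal_le_ofReal_iff (mul_nonneg (le_max_right _ _) h3)).1 (h1.trans ?_)
      exact ENNReal.ofReal_le_ofReal (mul_le_mul_of_nonneg_right (le_max_left _ _) h3)
    · rintro ⟨C, hC⟩
      refine ⟨C, ?_⟩
      filter_upwards [hC, eventually_ge_atTop t₀] with t h1 h2
      rw [derivENorm_eq (h t h2) hk]
      exact ENNReal.ofReal_le_ofReal h1
  have hsol : ContinuousOn r (Ici t₀) → (IsSolution σ a t₀ v ↔ _) := fun hc =>
    isSolution_iff_mild (σ := σ) ht₀
      (((continuousOn_prof σ a A).mono fun t ht => ht₀.trans_le ht).add hc) hv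
  constructor
  · intro H
    have hc := (continuousInH_iff h).1 H.continuous
    exact ⟨hc, (hsol hc).1 H.solution, (hrate 0 (Nat.zero_le m) _).1 H.rate_zero,
      fun k hk1 hk2 => (hrate k hk2 _).1 (H.rate_deriv k hk1 hk2)⟩
  · rintro ⟨hc, hs, h0, hk⟩
    exact ⟨(hsol hc).2 hs, (continuousInH_iff h).2 hc, (hrate 0 (Nat.zero_le m) _).2 h0,
      fun k hk1 hk2 => (hrate k hk2 _).2 (hk k hk1 hk2)⟩

/-- The componentwise rates imply a rate in `H^m`. -/
lemma eventually_norm_le_of_rates {r : ℝ → H m}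
    (h0 : ∃ C : ℝ, ∀ᶠ t : ℝ in atTop, ‖cp 0 (r t)‖ ≤ C * t ^ (-(1 / 2) : ℝ))
    (hk : ∀ k, 0 < k → k ≤ m → ∃ C : ℝ, ∀ᶠ t : ℝ in atTop, ‖cp k (r t)‖ ≤ C * t ^ (-1 : ℝ)) :
    ∃ M : ℝ, ∀ᶠ t : ℝ in atTop, ‖r t‖ ≤ M * t ^ (-(1 / 2) : ℝ) := by
  have h : ∀ k, ∃ C : ℝ, k ≤ m → ∀ᶠ t : ℝ in atTop, ‖cp k (r t)‖ ≤ C * t ^ (-(1 / 2) : ℝ) := by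
    intro k
    by_cases hkm : k ≤ m
    · rcases Nat.eq_zero_or_pos k with rfl | hpos
      · obtain ⟨C, hC⟩ := h0
        exact ⟨C, fun _ => hC⟩
      · obtain ⟨C, hC⟩ := hk k hpos hkm
        refine ⟨max C 0, fun _ => ?_⟩
        filter_upwards [hC, eventually_ge_atTop 1] with t h1 h2
        have h3 : t ^ (-1 : ℝ) ≤ t ^ (-(1 / 2) : ℝ) :=
          Real.rpow_le_rpow_of_exponent_le h2 (by norm_num)
        have h4 := Real.rpow_nonneg (zero_le_one.trans h2) (-1 : ℝ)
        exact h1.trans (mul_le_mul (le_max_left _ _) h3 h4 (le_max_right _ _))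
    · exact ⟨0, fun h => absurd h hkm⟩
  choose C hC using h
  refine ⟨∑ k ∈ Finset.range (m + 1), |C k|, ?_⟩
  have hall : ∀ᶠ t : ℝ in atTop, ∀ k ∈ Finset.range (m + 1),
      ‖cp k (r t)‖ ≤ C k * t ^ (-(1 / 2) : ℝ) :=
    (Filter.eventually_all_finset _).2 fun k hk => hC k (Nat.lt_succ_iff.1 (Finset.mem_range.1 hk))
  filter_upwards [hall, eventually_ge_atTop 0] with t h1 h2
  have h3 := Real.rpow_nonneg h2 (-(1 / 2) : ℝ)
  refine norm_H_le (by positivity) fun k hk => ?_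
  have hkr := Finset.mem_range.2 (Nat.lt_succ_of_le hk)
  refine (h1 k hkr).trans (mul_le_mul_of_nonneg_right ((le_abs_self _).trans ?_) h3)
  exact Finset.single_le_sum (f := fun k => |C k|) (fun _ _ => abs_nonneg _) hkr

end GrossPitaevskii

end

/-! ### Choice of constants and conclusion -/

open GrossPitaevskii

theorem mainTheorem4 (σ : ℝ) (hσ : σ = 1 ∨ σ = -1) (t₀ : ℝ) (ht₀ : 0 < t₀) (m : ℕ) (hm : 1 ≤ m) :
    ∃ a₀ : ℝ, 0 < a₀ ∧ ∃ ε : ℝ, 0 < ε ∧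
      ∀ a : ℝ, |a| < a₀ → ∀ u : ℝ → ℂ,
        GrossPitaevskii.homNegTwoENorm u + GrossPitaevskii.sobolevENorm m 2 u +
            GrossPitaevskii.sobolevENorm m 1 u < ENNReal.ofReal ε →
          ∃ v : ℝ → ℝ → ℂ, GrossPitaevskii.IsAsymptoticSolution σ a t₀ m u v ∧
            ∀ v' : ℝ → ℝ → ℂ, GrossPitaevskii.IsAsymptoticSolution σ a t₀ m u v' →
              ∀ t, t₀ ≤ t → v' t =ᵐ[volume] v t := by
  have : Fact (1 ≤ m) := ⟨hm⟩
  have hσ1 : |σ| = 1 := by rcases hσ with rfl | rfl <;> norm_num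
  set s := t₀ ^ (-(1 / 2) : ℝ) with hs
  have hs0 : 0 ≤ s := Real.rpow_nonneg ht₀.le _
  -- `C` dominates both constants `6 + 3s` and `3 + 6 · 2^{m+1}` of `norm_source_le`, and the
  -- remainder is sought in the ball of radius `δ = 2Ce`.
  set C : ℝ := 9 + 6 * 2 ^ (m + 1) + 3 * s with hC
  -- `Ke = e + 2^{m+1}δ`; times `t^{-1/2}` it bounds multiplication by profile plus remainder.
  set K : ℝ := 1 + 2 ^ (m + 1) * (2 * C) with hK
  have hC0 : 0 ≤ C := by positivity
  have hK1 : 1 ≤ K := le_add_of_nonneg_right (by positivity)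
  have hS1 : 1 ≤ (1 + s) ^ 2 := by nlinarith
  set e : ℝ := 1 / (16 * K * (1 + s) ^ 2) with he
  have he0 : 0 < e := by positivity
  have heK : K * e * (1 + s) ^ 2 = 1 / 16 := by rw [he]; field_simp
  have hKe : K * e ≤ 1 / 16 := by
    have : 0 ≤ K * e := by positivity
    nlinarith
  have he1 : e ≤ 1 := by nlinarith
  -- Division by `2^m` compensates the loss in `norm_mulH_fr_le`. Of the bound on `a` only `|a| ≤
  -- 1/8` is used.
  refine ⟨1 / (8 * (1 + s)), by positivity, e / 2 ^ m, by positivity, fun a ha u hu => ?_⟩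
  have hpow : (1 : ℝ) ≤ 2 ^ m := one_le_pow₀ (by norm_num)
  have hε1 : e / 2 ^ m ≤ e := div_le_self he0.le hpow
  have hε2 : 2 ^ m * (e / 2 ^ m) = e := by field_simp
  have ha8 : |a| ≤ 1 / 8 := by
    refine ha.le.trans ?_
    gcongr
    linarith
  have ha2 : a ^ 2 ≤ 1 / 64 := by
    rw [← sq_abs]
    nlinarith [abs_nonneg a]
  have h12 := lt_of_le_of_lt le_self_add hu
  have hL1 := lt_of_le_of_lt le_add_self hu
  have hfin1 := (lt_of_le_of_lt le_self_add h12).trans ENNReal.ofReal_lt_top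
  have hfin2 := (lt_of_le_of_lt le_add_self h12).trans ENNReal.ofReal_lt_top
  obtain ⟨F, hF⟩ := exists_H hfin2
  have hint := fun k (hk : k ≤ m) => integral_norm_cp_le hF hL1 hk
  have hui : Integrable u := (hint 0 (Nat.zero_le m)).1.congr hF.symm
  obtain ⟨A, hA, hAn⟩ := exists_second_antiderivative hui hF hfin1
  have hAe : ‖A‖ ≤ e := by
    have h1 := hAn.trans (add_le_add le_rfl (norm_le_sobolevENorm hF hfin2))
    rw [← ENNReal.toReal_add hfin1.ne hfin2.ne] at h1
    exact h1.trans ((ENNReal.toReal_le_of_le_ofReal (by positivity) h12.le).trans hε1)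
  have hd : ∀ t, t₀ ≤ t → ‖mulH m (fr A t)‖ ≤ e * t ^ (-(1 / 2) : ℝ) := fun t ht => by
    have := norm_mulH_fr_le hA (by positivity) hint (ht₀.trans_le ht)
    rwa [hε2] at this
  have hfree : ∀ t, freeSchrodinger t u =ᵐ[volume] cp 0 (fr A t) := fun t => by
    rw [fr, hA]; exact freeSchrodinger_ae hm hui hF t
  obtain ⟨r, hrc, hr0, hrk, hr⟩ := exists_mild_solution (a := a) (μ := K * e) hσ1 ht₀ he1
    (by linarith) hAe hd le_rfl (by rw [hK]; linarith) (by
      have h1 : |a| * (K * e * (1 + s) ^ 2) ≤ 1 / 8 * (1 / 16) := by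
        rw [heK]; gcongr
      have h2 : (K * e) * (K * e * (1 + s) ^ 2) ≤ 1 / 16 * (1 / 16) := by
        rw [heK]; gcongr
      linarith)
  set v : ℝ → ℝ → ℂ := fun t x => profile σ a u t x + cp 0 (r t) x with hv
  have hvr : ∀ t, t₀ ≤ t → v t - profile σ a u t =ᵐ[volume] cp 0 (r t) := fun t _ =>
    Eventually.of_forall fun x => by simp [hv]
  have hrc' : ContinuousOn r (Ici t₀) := hrc.mono fun t ht => ht₀.trans_le ht
  refine ⟨v, (isAsymptoticSolution_iff ht₀ hfree hvr).2 ⟨hrc', hr, ⟨2 * C * e, ?_⟩,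
    fun k hk1 hk2 => ⟨2 * C * e, ?_⟩⟩, fun v' hv' t ht => ?_⟩
  · filter_upwards [eventually_ge_atTop t₀] with t ht
    exact (norm_cp_le 0 (r t)).trans (hr0 t ht)
  · filter_upwards [eventually_ge_atTop t₀] with t ht
    exact hrk k hk1 hk2 t ht
  · have hex : ∀ t, ∃ R : H m, t₀ ≤ t → v' t - profile σ a u t =ᵐ[volume] cp 0 R := fun t => by
      by_cases h : t₀ ≤ t
      · obtain ⟨R, hR⟩ := exists_H (hv'.continuous.1 t h)
        exact ⟨R, fun _ => hR⟩
      · exact ⟨0, fun h' => absurd h' h⟩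
    choose r' hr' using hex
    obtain ⟨hc', hm', h0', hk'⟩ := (isAsymptoticSolution_iff ht₀ hfree hr').1 hv'
    obtain ⟨M, hM⟩ := eventually_norm_le_of_rates h0' hk'
    have hprof : ContinuousOn (prof σ a A) (Ici t₀) :=
      (continuousOn_prof σ a A).mono fun t ht => ht₀.trans_le ht
    -- The competing solution comes with its own, possibly large, constant `M`. Uniqueness needs
    -- only the rate `t^{-1/2}` and no smallness of that constant.
    have heq := mild_solution_unique (M := max M (2 * C * e)) hσ1 ht₀ (by linarith) hd
      (hprof.add hc') (hprof.add hrc') hm' hr (by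
        filter_upwards [hM, eventually_ge_atTop 0] with τ h1 h2
        rw [Pi.add_apply, add_sub_cancel_left]
        exact h1.trans (mul_le_mul_of_nonneg_right (le_max_left _ _) (Real.rpow_nonneg h2 _))) (by
        filter_upwards [eventually_ge_atTop t₀] with τ h1
        rw [Pi.add_apply, add_sub_cancel_left]
        exact (hr0 τ h1).trans (mul_le_mul_of_nonneg_right (le_max_right _ _)
          (Real.rpow_nonneg (ht₀.trans_le h1).le _))) ht
    have heq' : r' t = r t := add_left_cancel heq
    have h1 := hr' t ht
    rw [heq'] at h1
    filter_upwards [h1] with x hx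
    change v' t x = profile σ a u t x + cp 0 (r t) x
    rw [← hx, Pi.sub_apply]
    ring
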